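/- **Theorem 5.7 (Symmetric cubic $C^n$).** Let $\mathbb K$ be a good topological ring, i.e. a commutative unital topological ring whose unit group $\mathbb K^\times$ is dense in $\mathbb K$. All topological $\mathbb K$-modules are assumed Hausdorff. *Conventions.* (a) A map $f:U\to W$ from an open subset $U$ of a topological $\mathbb K$-module $V$ to a topological $\mathbb K$-module $W$ is of class $C^0$ if it is continuous, and of class $C^{n+1}$ if the difference quotient $(x,v,s)\mapsto s^{-1}(f(x+sv)-f(x))$, $s\in\mathbb K^\times$, extends to a continuous map $f^{[1]}:U^{[1]}=\{(x,v,s)\in V\times V\times \mathbb K\mid x\in U,\ x+sv\in U\}\to W$ and $f^{[1]}$ is of class $C^n$. (b) A Hausdorff manifold of class $C^n$ over $\mathbb K$ is a Hausdorff space $M$ with an atlas of charts, with values in a topological $\mathbb K$-module, whose transition maps are of class $C^n$. If $\mathbb K$ is not a field it is moreover required that every non-empty finite subset of $M$ be contained in one (not necessarily connected) chart domain of the atlas. $C^n$-maps between manifolds are continuous maps that are of class $C^n$ in the charts of the atlases; an open subset of a topological module is a manifold with the inclusion as its only chart. (c) An $n$-fold groupoid is a family of sets $(G^A)_{A\subset\{1,\dots,n\}}$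 with a groupoid $(G^A,G^B)$ for each edge $A=B\cup\{k\}$, $k\notin B$, such that every face is a double groupoid; it is a groupoid over $M$ if $G^\emptyset=M$. Morphisms are families of maps that are functors along all edges. (d) For $t\in\mathbb K$ and $U\subset V$, let $U_t=\{(x,v)\in V^2\mid x\in U,\ x+tv\in U\}$, a groupoid over $U$ with source $x$, target $x+tv$, units $(x,0)$ and product $(x',v')*(x,v)=(x,v+v')$ when $x'=x+tv$; for a $C^1$-map $f$ let $f_t(x,v)=(f(x),f^{[1]}(x,v,t))$. For $\mathbf t\in\mathbb K^n$, iteration gives the $n$-fold groupoid $U^{\mathsf n}_{\mathbf t}=((U_{t_1})_{t_2}\dots)_{t_n}$ and, for a $C^n$-map $f$ between open sets, the map $f^{\mathsf n}_{\mathbf t}=((f_{t_1})_{t_2}\dots)_{t_n}$. The $n$-fold pair groupoid $\mathsf{PG}^{\mathsf n}(M)$ is obtained from the set $M$ by iterating $n$ times the pair groupoid construction, and the $n$-fold tangent bundle $T^nM$ by gluing the local constructions with $\mathbf t=0$ for the ranges of all charts along the iterated tangent maps of the transition maps. *Statement.* Let $n\in\mathbb N$ and fix $\mathbf t\in\mathbb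 K^n$. Then to every Hausdorff manifold $M$ of class $C^n$ over $\mathbb K$ one can assign an $n$-fold groupoid $M^{\mathsf n}_{\mathbf t}$ over $M$, and to every $C^n$-map $f:M\to N$ a morphism of $n$-fold groupoids $f^{\mathsf n}_{\mathbf t}:M^{\mathsf n}_{\mathbf t}\to N^{\mathsf n}_{\mathbf t}$ over $f$, with $(\mathrm{id}_M)^{\mathsf n}_{\mathbf t}=\mathrm{id}$ and $(g\circ f)^{\mathsf n}_{\mathbf t}=g^{\mathsf n}_{\mathbf t}\circ f^{\mathsf n}_{\mathbf t}$ whenever $f,g,g\circ f$ are of class $C^n$, such that: - for $M=U$ and $N=U'$ open in topological modules, $M^{\mathsf n}_{\mathbf t}$ is (identified with) $U^{\mathsf n}_{\mathbf t}$, and $f^{\mathsf n}_{\mathbf t}$ is the iterated tangent map defined in (d); for every chart $\varphi$ of a manifold $M$, the map $\varphi^{-1}$ induces an injective morphism $(\operatorname{ran}\varphi)^{\mathsf n}_{\mathbf t}\to M^{\mathsf n}_{\mathbf t}$, and if every non-empty finite subset of $M$ is contained in a chart domain, then $M^{\mathsf n}_{\mathbf t}$ is glued from these via the iterated tangent maps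 of the transition maps; - when $\mathbf t=(0,\dots,0)$, $M^{\mathsf n}_{\mathbf t}$ agrees with the $n$-fold tangent bundle $T^nM$; - when $\mathbf t\in(\mathbb K^\times)^n$, $M^{\mathsf n}_{\mathbf t}$ is isomorphic, over $M$ and naturally in $M$, to the $n$-fold pair groupoid $\mathsf{PG}^{\mathsf n}(M)$. -/

import Mathlib

open Set Topology TopologicalSpace

universe u

namespace SymCubic

set_option linter.unusedSimpArgs false

/-! ### Groupoids and n-fold groupoids -/

/-- A groupoid with set of morphisms `G₁` and set of objects `G₀`; the product `a * b` is defined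
if the source of `a` is the target of `b`. -/
structure Gpd (G₁ G₀ : Type u) where
  src : G₁ → G₀
  tgt : G₁ → G₀
  one : G₀ → G₁
  inv : G₁ → G₁
  mul : ∀ a b : G₁, src a = tgt b → G₁
  src_mul : ∀ a b h, src (mul a b h) = src b
  tgt_mul : ∀ a b h, tgt (mul a b h) = tgt a
  mul_assoc : ∀ (a b c : G₁) (hab : src a = tgt b) (hbc : src b = tgt c),
    mul (mul a b hab) c ((src_mul a b hab).trans hbc)
      = mul a (mul b c hbc) (hab.trans (tgt_mul b c hbc).symm)
  src_one : ∀ x, src (one x) = x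
  tgt_one : ∀ x, tgt (one x) = x
  mul_one : ∀ a, mul a (one (src a)) (tgt_one (src a)).symm = a
  one_mul : ∀ a, mul (one (tgt a)) a (src_one (tgt a)) = a
  src_inv : ∀ a, src (inv a) = tgt a
  tgt_inv : ∀ a, tgt (inv a) = src a
  mul_inv : ∀ a, mul a (inv a) (tgt_inv a).symm = one (tgt a)
  inv_mul : ∀ a, mul (inv a) a (src_inv a) = one (src a)

/-- The pair `(f₁, f₀)` is a functor (morphism of groupoids) from `(G₁, G₀)` to `(H₁, H₀)`. -/
structure IsFunctor {G₁ G₀ H₁ H₀ : Type u} (G : Gpd G₁ G₀) (H : Gpd H₁ H₀)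
    (f₁ : G₁ → H₁) (f₀ : G₀ → H₀) : Prop where
  map_src : ∀ a, H.src (f₁ a) = f₀ (G.src a)
  map_tgt : ∀ a, H.tgt (f₁ a) = f₀ (G.tgt a)
  map_one : ∀ x, f₁ (G.one x) = H.one (f₀ x)
  map_mul : ∀ (a b : G₁) (h : G.src a = G.tgt b),
    f₁ (G.mul a b h)
      = H.mul (f₁ a) (f₁ b) ((map_src a).trans ((congrArg f₀ h).trans (map_tgt b).symm))

/-- A double groupoid: a square of sets `A, B, C, D` in which `(A, C)`, `(B, D)` (horizontal) and
`(A, B)`, `(C, D)` (vertical) are groupoids, the projections and the unit sections are morphisms,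
and the interchange law holds. -/
structure IsDouble {A B C D : Type u} (R : Gpd A C) (S : Gpd B D) (P : Gpd A B) (Q : Gpd C D) :
    Prop where
  src_h : IsFunctor P Q R.src S.src
  tgt_h : IsFunctor P Q R.tgt S.tgt
  one_h : IsFunctor Q P R.one S.one
  src_v : IsFunctor R S P.src Q.src
  tgt_v : IsFunctor R S P.tgt Q.tgt
  one_v : IsFunctor S R P.one Q.one
  interchange : ∀ (a b c d : A) (hab : R.src a = R.tgt b) (hcd : R.src c = R.tgt d)
    (hac : P.src a = P.tgt c) (hbd : P.src b = P.tgt d)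
    (h₁ : P.src (R.mul a b hab) = P.tgt (R.mul c d hcd))
    (h₂ : R.src (P.mul a c hac) = R.tgt (P.mul b d hbd)),
    P.mul (R.mul a b hab) (R.mul c d hcd) h₁ = R.mul (P.mul a c hac) (P.mul b d hbd) h₂

/-- `(B, A)` is an edge in direction `k` of the hypercube of subsets of `{1, …, n}`:
`A` is the disjoint union of `B` and `{k}`. -/
def IsEdge {n : ℕ} (k : Fin n) (B A : Finset (Fin n)) : Prop := k ∉ B ∧ A = insert k B

/-- An `n`-fold groupoid: a set for each vertex of the hypercube of subsets of an `n`-element set,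
a groupoid for each edge, such that each (nondegenerate) face is a double groupoid. -/
structure NGpd (n : ℕ) where
  vertex : Finset (Fin n) → Type u
  edge : ∀ {k : Fin n} {B A : Finset (Fin n)}, IsEdge k B A → Gpd (vertex A) (vertex B)
  face : ∀ {k l : Fin n} {D B C A : Finset (Fin n)} (hDC : IsEdge k D C) (hBA : IsEdge k B A)
    (hDB : IsEdge l D B) (hCA : IsEdge l C A),
    IsDouble (edge hCA) (edge hDB) (edge hBA) (edge hDC)

/-- A morphism of `n`-fold groupoids: a map for each vertex, functorial along each edge. -/
structure Hom {n : ℕ} (G H : NGpd.{u} n) where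
  map : ∀ A, G.vertex A → H.vertex A
  isFunctor : ∀ {k : Fin n} {B A : Finset (Fin n)} (h : IsEdge k B A),
    IsFunctor (G.edge h) (H.edge h) (map A) (map B)

/-- The identity morphism. -/
def Hom.id {n : ℕ} (G : NGpd.{u} n) : Hom G G where
  map _ z := z
  isFunctor _ := ⟨fun _ => rfl, fun _ => rfl, fun _ => rfl, fun _ _ _ => rfl⟩

/-- The composite `g ∘ f`. -/
def Hom.comp {n : ℕ} {G H L : NGpd.{u} n} (g : Hom H L) (f : Hom G H) : Hom G L where
  map A z := g.map A (f.map A z)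
  isFunctor h :=
    { map_src := fun a => by rw [(g.isFunctor h).map_src, (f.isFunctor h).map_src]
      map_tgt := fun a => by rw [(g.isFunctor h).map_tgt, (f.isFunctor h).map_tgt]
      map_one := fun x => by rw [(f.isFunctor h).map_one, (g.isFunctor h).map_one]
      map_mul := fun a b hab => by rw [(f.isFunctor h).map_mul, (g.isFunctor h).map_mul] }

/-- A morphism is an isomorphism if it is bijective on each vertex set. -/
def Hom.IsIso {n : ℕ} {G H : NGpd.{u} n} (f : Hom G H) : Prop :=
  ∀ A, Function.Bijective (f.map A)

/-! ### Families indexed by the subsets of `A` -/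

/-- The set of subsets of `A`. -/
abbrev Subs {n : ℕ} (A : Finset (Fin n)) : Type := {S : Finset (Fin n) // S ⊆ A}

section Index

variable {n : ℕ} {k : Fin n} {B A : Finset (Fin n)} {X : Type u}

theorem IsEdge.mem (h : IsEdge k B A) : k ∈ A := by rw [h.2]; exact Finset.mem_insert_self _ _

theorem IsEdge.sub (h : IsEdge k B A) : B ⊆ A := by rw [h.2]; exact Finset.subset_insert _ _

theorem IsEdge.notMem (h : IsEdge k B A) (S : Subs B) : k ∉ S.1 := fun hk => h.1 (S.2 hk)

/-- A subset `S` of `B`, considered as a subset of `A = B ∪ {k}`. -/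
def lo (h : IsEdge k B A) (S : Subs B) : Subs A := ⟨S.1, S.2.trans h.sub⟩

/-- The subset `S ∪ {k}` of `A = B ∪ {k}`, for a subset `S` of `B`. -/
def hi (h : IsEdge k B A) (S : Subs B) : Subs A :=
  ⟨insert k S.1, by rw [h.2]; exact Finset.insert_subset_insert k S.2⟩

/-- The subset `S \ {k}` of `B`, for a subset `S` of `A = B ∪ {k}`. -/
def cut (h : IsEdge k B A) (S : Subs A) : Subs B :=
  ⟨S.1.erase k, by
    exact Finset.subset_insert_iff.1 (S.2.trans h.2.subset)⟩

/-- The family indexed by the subsets of `A = B ∪ {k}` that is `x` on the subsets of `B` and is `w`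
on their unions with `{k}`. -/
def join (h : IsEdge k B A) (x w : Subs B → X) : Subs A → X :=
  fun S => if k ∈ S.1 then w (cut h S) else x (cut h S)

@[simp] theorem cut_lo (h : IsEdge k B A) (S : Subs B) : cut h (lo h S) = S :=
  Subtype.ext (Finset.erase_eq_of_notMem (h.notMem S))

@[simp] theorem cut_hi (h : IsEdge k B A) (S : Subs B) : cut h (hi h S) = S :=
  Subtype.ext (Finset.erase_insert (h.notMem S))

theorem lo_cut (h : IsEdge k B A) (S : Subs A) (hS : k ∉ S.1) : lo h (cut h S) = S :=
  Subtype.ext (Finset.erase_eq_of_notMem hS)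

theorem hi_cut (h : IsEdge k B A) (S : Subs A) (hS : k ∈ S.1) : hi h (cut h S) = S :=
  Subtype.ext (Finset.insert_erase hS)

@[simp] theorem join_lo (h : IsEdge k B A) (x w : Subs B → X) (S : Subs B) :
    join h x w (lo h S) = x S := by
  have : k ∉ (lo h S).1 := h.notMem S
  simp [join, this]

@[simp] theorem join_hi (h : IsEdge k B A) (x w : Subs B → X) (S : Subs B) :
    join h x w (hi h S) = w S := by
  have : k ∈ (hi h S).1 := Finset.mem_insert_self _ _
  simp [join, this]

theorem sub_cases (h : IsEdge k B A) (S : Subs A) :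
    (∃ T, S = lo h T) ∨ (∃ T, S = hi h T) := by
  by_cases hS : k ∈ S.1
  · exact Or.inr ⟨_, (hi_cut h S hS).symm⟩
  · exact Or.inl ⟨_, (lo_cut h S hS).symm⟩

theorem fam_ext (h : IsEdge k B A) {v w : Subs A → X} (h₁ : ∀ S, v (lo h S) = w (lo h S))
    (h₂ : ∀ S, v (hi h S) = w (hi h S)) : v = w := by
  funext S
  rcases sub_cases h S with ⟨T, rfl⟩ | ⟨T, rfl⟩
  · exact h₁ T
  · exact h₂ T

section Face

variable {l : Fin n} {D C : Finset (Fin n)}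

theorem lo_lo (hDC : IsEdge k D C) (hBA : IsEdge k B A) (hDB : IsEdge l D B) (hCA : IsEdge l C A)
    (S : Subs D) : lo hCA (lo hDC S) = lo hBA (lo hDB S) := rfl

theorem lo_hi (hDC : IsEdge k D C) (hBA : IsEdge k B A) (hDB : IsEdge l D B) (hCA : IsEdge l C A)
    (S : Subs D) : lo hCA (hi hDC S) = hi hBA (lo hDB S) := rfl

theorem hi_lo (hDC : IsEdge k D C) (hBA : IsEdge k B A) (hDB : IsEdge l D B) (hCA : IsEdge l C A)
    (S : Subs D) : hi hCA (lo hDC S) = lo hBA (hi hDB S) := rfl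

theorem hi_hi (hDC : IsEdge k D C) (hBA : IsEdge k B A) (hDB : IsEdge l D B) (hCA : IsEdge l C A)
    (S : Subs D) : hi hCA (hi hDC S) = hi hBA (hi hDB S) :=
  Subtype.ext (Finset.insert_comm l k S.1)

theorem join_lo_lo (hDC : IsEdge k D C) (hBA : IsEdge k B A) (hDB : IsEdge l D B)
    (hCA : IsEdge l C A) (x w : Subs B → X) (S : Subs D) :
    join hBA x w (lo hCA (lo hDC S)) = x (lo hDB S) := by
  rw [lo_lo hDC hBA hDB hCA, join_lo]

theorem join_lo_hi (hDC : IsEdge k D C) (hBA : IsEdge k B A) (hDB : IsEdge l D B)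
    (hCA : IsEdge l C A) (x w : Subs B → X) (S : Subs D) :
    join hBA x w (lo hCA (hi hDC S)) = w (lo hDB S) := by
  rw [lo_hi hDC hBA hDB hCA, join_hi]

theorem join_hi_lo (hDC : IsEdge k D C) (hBA : IsEdge k B A) (hDB : IsEdge l D B)
    (hCA : IsEdge l C A) (x w : Subs B → X) (S : Subs D) :
    join hBA x w (hi hCA (lo hDC S)) = x (hi hDB S) := by
  rw [hi_lo hDC hBA hDB hCA, join_lo]

theorem join_hi_hi (hDC : IsEdge k D C) (hBA : IsEdge k B A) (hDB : IsEdge l D B)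
    (hCA : IsEdge l C A) (x w : Subs B → X) (S : Subs D) :
    join hBA x w (hi hCA (hi hDC S)) = w (hi hDB S) := by
  rw [hi_hi hDC hBA hDB hCA, join_hi]

theorem fam_ext₂ (hDC : IsEdge k D C) (hCA : IsEdge l C A) {v w : Subs A → X}
    (h₁ : ∀ S, v (lo hCA (lo hDC S)) = w (lo hCA (lo hDC S)))
    (h₂ : ∀ S, v (lo hCA (hi hDC S)) = w (lo hCA (hi hDC S)))
    (h₃ : ∀ S, v (hi hCA (lo hDC S)) = w (hi hCA (lo hDC S)))
    (h₄ : ∀ S, v (hi hCA (hi hDC S)) = w (hi hCA (hi hDC S))) : v = w :=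
  fam_ext hCA
    (fun S => congrFun (fam_ext hDC (v := fun S => v (lo hCA S)) (w := fun S => w (lo hCA S))
      h₁ h₂) S)
    (fun S => congrFun (fam_ext hDC (v := fun S => v (hi hCA S)) (w := fun S => w (hi hCA S))
      h₃ h₄) S)

end Face

theorem sum_split {W : Type u} [AddCommMonoid W] (h : IsEdge k B A) (f : Subs A → W) :
    ∑ S, f S = ∑ S, f (lo h S) + ∑ S, f (hi h S) := by
  rw [← Finset.sum_filter_add_sum_filter_not Finset.univ (fun S : Subs A => k ∉ S.1)]
  congr 1
  · symm
    refine Finset.sum_bij' (fun S _ => lo h S) (fun S _ => cut h S) ?_ ?_ ?_ ?_ ?_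
    · intro S _; simpa [lo] using h.notMem S
    · intro S _; exact Finset.mem_univ _
    · intro S _; exact cut_lo h S
    · intro S hS; exact lo_cut h S (by simpa using hS)
    · intro S _; rfl
  · symm
    refine Finset.sum_bij' (fun S _ => hi h S) (fun S _ => cut h S) ?_ ?_ ?_ ?_ ?_
    · intro S _; simp [hi]
    · intro S _; exact Finset.mem_univ _
    · intro S _; exact cut_hi h S
    · intro S hS; exact hi_cut h S (by simpa using hS)
    · intro S _; rfl

end Index

/-! ### The n-fold pair groupoid -/

section Pair

variable {n : ℕ} (M : Type u)

/-- The pair groupoid of the set `Subs B → M`, its morphism set being identified with `Subs A → M`: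
a pair `(y, x)` is a family `v` with `x = v ∘ lo` (source) and `y = v ∘ hi` (target). -/
def pairGpd {k : Fin n} {B A : Finset (Fin n)} (h : IsEdge k B A) :
    Gpd (Subs A → M) (Subs B → M) where
  src v := fun S => v (lo h S)
  tgt v := fun S => v (hi h S)
  one x := join h x x
  inv v := join h (fun S => v (hi h S)) (fun S => v (lo h S))
  mul a b _ := join h (fun S => b (lo h S)) (fun S => a (hi h S))
  src_mul a b _ := by simp
  tgt_mul a b _ := by simp
  mul_assoc a b c _ _ := by simp
  src_one x := by simp
  tgt_one x := by simp
  mul_one a := fam_ext h (by simp) (by simp)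
  one_mul a := fam_ext h (by simp) (by simp)
  src_inv a := by simp
  tgt_inv a := by simp
  mul_inv a := by simp
  inv_mul a := by simp

/-- The `n`-fold pair groupoid of `M`, obtained from the set `M` by applying `n` times the functor
"pair groupoid": the vertex set of `A` is the set of families in `M` indexed by the subsets
of `A`. -/
def pairNGpd : NGpd.{u} n where
  vertex A := Subs A → M
  edge h := pairGpd M h
  face {k l D B C A} hDC hBA hDB hCA := by
    have e1 := fun S => (lo_lo hDC hBA hDB hCA S).symm
    have e2 := fun S => (lo_hi hDC hBA hDB hCA S).symm
    have e3 := fun S => (hi_lo hDC hBA hDB hCA S).symm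
    have e4 := fun S => (hi_hi hDC hBA hDB hCA S).symm
    have j1 := @join_lo_lo n k B A M l D C hDC hBA hDB hCA
    have j2 := @join_lo_hi n k B A M l D C hDC hBA hDB hCA
    have j3 := @join_hi_lo n k B A M l D C hDC hBA hDB hCA
    have j4 := @join_hi_hi n k B A M l D C hDC hBA hDB hCA
    refine ⟨⟨?_, ?_, ?_, ?_⟩, ⟨?_, ?_, ?_, ?_⟩, ⟨?_, ?_, ?_, ?_⟩, ⟨?_, ?_, ?_, ?_⟩,
      ⟨?_, ?_, ?_, ?_⟩, ⟨?_, ?_, ?_, ?_⟩, ?_⟩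
    all_goals
      intros
      first
        | (refine fam_ext₂ hDC hCA ?_ ?_ ?_ ?_ <;> intro S <;>
            simp [pairGpd, e1, e2, e3, e4, j1, j2, j3, j4])
        | (refine fam_ext hDC ?_ ?_ <;> intro S <;>
            simp [pairGpd, e1, e2, e3, e4, j1, j2, j3, j4])
        | (refine fam_ext hDB ?_ ?_ <;> intro S <;>
            simp [pairGpd, e1, e2, e3, e4, j1, j2, j3, j4])
        | (funext S; simp [pairGpd, e1, e2, e3, e4])

end Pair

/-! ### The local construction -/

section Local

variable {K : Type u} [CommRing K] {n : ℕ} (t : Fin n → K)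
variable {V : Type u} [AddCommGroup V] [Module K V]

/-- The point `∑_{S ⊆ C} t_S v_S` of `V`, where `t_S` is the product of the `t_i`, `i ∈ S`. -/
def foot {A : Finset (Fin n)} (C : Subs A) (v : Subs A → V) : V :=
  ∑ S : Subs A, if S.1 ⊆ C.1 then (∏ i ∈ S.1, t i) • v S else 0

/-- The vertex set at `A = {i₁ < … < i_p}` of the local construction, that is, the iterated
extended domain `(…((U_{t_{i₁}})_{t_{i₂}})…)_{t_{i_p}}`, where
`U_t = {(x, v) | x ∈ U, x + t v ∈ U}`; its elements are written as families `(v_S)_{S ⊆ A}` in `V`.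
See `extDom_empty` and `mem_extDom_iff` for the description by iteration. -/
def extDom (U : Set V) (A : Finset (Fin n)) : Set (Subs A → V) :=
  {v | ∀ C : Subs A, foot t C v ∈ U}

section

variable {k : Fin n} {B A : Finset (Fin n)} (h : IsEdge k B A)

/-- The target map `(x, v) ↦ x + t_k v`. -/
def tgtMap (v : Subs A → V) : Subs B → V := fun S => v (lo h S) + t k • v (hi h S)

theorem foot_lo (C : Subs B) (v : Subs A → V) :
    foot t (lo h C) v = foot t C (fun S => v (lo h S)) := by
  unfold foot
  rw [sum_split h]
  have : ∀ S : Subs B, ¬ (hi h S).1 ⊆ (lo h C).1 := fun S hS =>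
    h.notMem C (hS (Finset.mem_insert_self _ _))
  simp only [this, if_false, Finset.sum_const_zero, add_zero]
  rfl

theorem foot_hi (C : Subs B) (v : Subs A → V) :
    foot t (hi h C) v = foot t C (tgtMap t h v) := by
  unfold foot tgtMap
  rw [sum_split h, ← Finset.sum_add_distrib]
  refine Finset.sum_congr rfl fun S _ => ?_
  have h1 : (lo h S).1 ⊆ (hi h C).1 ↔ S.1 ⊆ C.1 :=
    Finset.subset_insert_iff_of_notMem (h.notMem S)
  have h2 : (hi h S).1 ⊆ (hi h C).1 ↔ S.1 ⊆ C.1 :=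
    Finset.insert_subset_insert_iff (h.notMem S)
  simp only [h1, h2]
  split_ifs
  · have : ∏ i ∈ (hi h S).1, t i = t k * ∏ i ∈ S.1, t i := Finset.prod_insert (h.notMem S)
    rw [this, smul_add, smul_smul, mul_comm]
    rfl
  · simp

/-- The iterative description of the vertex sets: an element of the vertex set at `A = B ∪ {k}` is
a pair `(x, v)` such that `x` and `x + t_k v` belong to the vertex set at `B`. -/
theorem mem_extDom_iff (U : Set V) (v : Subs A → V) :
    v ∈ extDom t U A ↔ (fun S => v (lo h S)) ∈ extDom t U B ∧
      ((fun S => v (lo h S)) + t k • (fun S => v (hi h S))) ∈ extDom t U B := by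
  constructor
  · intro hv
    exact ⟨fun C => by rw [← foot_lo t h]; exact hv _,
      fun C => by
        have := hv (hi h C)
        rwa [foot_hi] at this⟩
  · rintro ⟨h1, h2⟩ C
    rcases sub_cases h C with ⟨T, rfl⟩ | ⟨T, rfl⟩
    · rw [foot_lo]; exact h1 T
    · rw [foot_hi]; exact h2 T

theorem extDom_empty (U : Set V) (v : Subs (∅ : Finset (Fin n)) → V) :
    v ∈ extDom t U ∅ ↔ v ⟨∅, subset_rfl⟩ ∈ U := by
  have key : ∀ C : Subs (∅ : Finset (Fin n)), foot t C v = v ⟨∅, subset_rfl⟩ := by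
    intro C
    have hS : ∀ S : Subs (∅ : Finset (Fin n)), S = ⟨∅, subset_rfl⟩ := fun S =>
      Subtype.ext (Finset.subset_empty.1 S.2)
    unfold foot
    rw [Fintype.sum_eq_single ⟨∅, subset_rfl⟩ (fun S hne => absurd (hS S) hne)]
    simp
  exact ⟨fun hv => by rw [← key ⟨∅, subset_rfl⟩]; exact hv _, fun hv C => by rwa [key C]⟩

theorem mem_src {U : Set V} {v : Subs A → V} (hv : v ∈ extDom t U A) :
    (fun S => v (lo h S)) ∈ extDom t U B := ((mem_extDom_iff t h U v).1 hv).1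

theorem mem_tgt {U : Set V} {v : Subs A → V} (hv : v ∈ extDom t U A) :
    tgtMap t h v ∈ extDom t U B := ((mem_extDom_iff t h U v).1 hv).2

theorem mem_join {U : Set V} {x w : Subs B → V} (hx : x ∈ extDom t U B)
    (hw : (fun S => x S + t k • w S) ∈ extDom t U B) : join h x w ∈ extDom t U A := by
  rw [mem_extDom_iff t h]
  simp only [join_lo, join_hi]
  exact ⟨hx, hw⟩

/-- The groupoid `((U^B)_{t_k}, U^B)`, where `U^B` is the vertex set at `B`: for morphisms
`(x, v)` one has source `x`, target `x + t_k v`, units `(x, 0)`, product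
`(x', v') * (x, v) = (x, v' + v)`, and inverse `(x + t_k v, -v)`. If `k` is not the largest element
of `A`, these (linear) formulas are the result of applying the remaining derivations to the
structure maps of the edge at which the direction `k` has just been added. -/
def localGpd (U : Set V) : Gpd (extDom t U A) (extDom t U B) where
  src v := ⟨fun S => v.1 (lo h S), mem_src t h v.2⟩
  tgt v := ⟨tgtMap t h v.1, mem_tgt t h v.2⟩
  one x := ⟨join h x.1 0, mem_join t h x.2 (by simp)⟩
  inv v := ⟨join h (tgtMap t h v.1) (fun S => - v.1 (hi h S)),
    mem_join t h (mem_tgt t h v.2) (by simpa [tgtMap] using mem_src t h v.2)⟩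
  mul a b hab := ⟨join h (fun S => b.1 (lo h S)) (fun S => a.1 (hi h S) + b.1 (hi h S)),
    mem_join t h (mem_src t h b.2) (by
      have e : ∀ S, a.1 (lo h S) = b.1 (lo h S) + t k • b.1 (hi h S) := fun S =>
        congrFun (congrArg Subtype.val hab) S
      have := mem_tgt t h a.2
      unfold tgtMap at this
      simp only [e] at this
      convert this using 2
      rw [smul_add]; abel)⟩
  src_mul a b hab := by simp
  tgt_mul a b hab := by
    have e : ∀ S, a.1 (lo h S) = b.1 (lo h S) + t k • b.1 (hi h S) := fun S =>
      congrFun (congrArg Subtype.val hab) S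
    apply Subtype.ext
    funext S
    simp only [tgtMap, join_lo, join_hi, e, smul_add]
    abel
  mul_assoc a b c _ _ := Subtype.ext (by simp [add_assoc])
  src_one x := by simp
  tgt_one x := Subtype.ext (by funext S; simp [tgtMap])
  mul_one a := Subtype.ext (fam_ext h (by simp) (by simp))
  one_mul a := Subtype.ext (fam_ext h (by simp) (by simp))
  src_inv a := by simp
  tgt_inv a := Subtype.ext (by funext S; simp [tgtMap])
  mul_inv a := Subtype.ext (fam_ext h (by simp) (by simp))
  inv_mul a := Subtype.ext (fam_ext h (by simp) (by simp))

end

/-- The local construction: the `n`-fold groupoid `U^n_t = (…(U_{t_1})_{t_2}…)_{t_n}` of a subset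
`U` of a module `V`. -/
def localNGpd (U : Set V) : NGpd.{u} n where
  vertex A := extDom t U A
  edge h := localGpd t h U
  face {k l D B C A} hDC hBA hDB hCA := by
    have e1 := fun S => (lo_lo hDC hBA hDB hCA S).symm
    have e2 := fun S => (lo_hi hDC hBA hDB hCA S).symm
    have e3 := fun S => (hi_lo hDC hBA hDB hCA S).symm
    have e4 := fun S => (hi_hi hDC hBA hDB hCA S).symm
    have j1 := @join_lo_lo n k B A V l D C hDC hBA hDB hCA
    have j2 := @join_lo_hi n k B A V l D C hDC hBA hDB hCA
    have j3 := @join_hi_lo n k B A V l D C hDC hBA hDB hCA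
    have j4 := @join_hi_hi n k B A V l D C hDC hBA hDB hCA
    refine ⟨⟨?_, ?_, ?_, ?_⟩, ⟨?_, ?_, ?_, ?_⟩, ⟨?_, ?_, ?_, ?_⟩, ⟨?_, ?_, ?_, ?_⟩,
      ⟨?_, ?_, ?_, ?_⟩, ⟨?_, ?_, ?_, ?_⟩, ?_⟩
    all_goals
      intros
      apply Subtype.ext
      first
        | (refine fam_ext₂ hDC hCA ?_ ?_ ?_ ?_ <;> intro S <;>
            simp [localGpd, tgtMap, e1, e2, e3, e4, j1, j2, j3, j4, smul_smul,
              mul_comm, add_comm, add_left_comm, add_assoc])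
        | (refine fam_ext hDC ?_ ?_ <;> intro S <;>
            simp [localGpd, tgtMap, e1, e2, e3, e4, j1, j2, j3, j4, smul_smul,
              mul_comm, add_comm, add_left_comm, add_assoc])
        | (refine fam_ext hDB ?_ ?_ <;> intro S <;>
            simp [localGpd, tgtMap, e1, e2, e3, e4, j1, j2, j3, j4, smul_smul,
              mul_comm, add_comm, add_left_comm, add_assoc])
        | (funext S; simp [localGpd, tgtMap, e1, e2, e3, e4, smul_smul,
              mul_comm, add_comm, add_left_comm, add_assoc])

end Local

/-! ### Topological differential calculus -/

section Calculus

variable (K : Type u) [CommRing K] [TopologicalSpace K]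

/-- The extended domain `U^[1] = {(x, v, t) | x ∈ U, x + t v ∈ U}`. -/
def extOne {V : Type u} [AddCommGroup V] [Module K V] (U : Set V) : Set (V × V × K) :=
  {p | p.1 ∈ U ∧ p.1 + p.2.2 • p.2.1 ∈ U}

/-- `g` is a continuous map on `U^[1]` that extends the difference quotient
`(x, v, s) ↦ (f (x + s v) - f x) / s`, `s` invertible. -/
def IsSlope {V W : Type u} [AddCommGroup V] [Module K V] [TopologicalSpace V]
    [AddCommGroup W] [Module K W] [TopologicalSpace W]
    (f : V → W) (U : Set V) (g : V × V × K → W) : Prop :=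
  ContinuousOn g (extOne K U) ∧
    ∀ (s : Kˣ) (x v : V), (x, v, (s : K)) ∈ extOne K U →
      g (x, v, (s : K)) = ((s⁻¹ : Kˣ) : K) • (f (x + (s : K) • v) - f x)

/-- `f` is of class `C^n` over `K` on the (open) set `U`: for `n = 0` it is continuous; it is of
class `C^{n+1}` if the difference quotient extends to a continuous map on `U^[1]` and this extension
is of class `C^n`. -/
def CnOn : ℕ → ∀ {V W : Type u} [AddCommGroup V] [Module K V] [TopologicalSpace V]
    [AddCommGroup W] [Module K W] [TopologicalSpace W], (V → W) → Set V → Prop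
  | 0, _, _, _, _, _, _, _, _, f, U => ContinuousOn f U
  | n + 1, _, _, _, _, _, _, _, _, f, U => ∃ g, IsSlope K f U g ∧ CnOn n g (extOne K U)

variable {K}

section

variable {V W : Type u} [AddCommGroup V] [Module K V] [TopologicalSpace V]
  [AddCommGroup W] [Module K W] [TopologicalSpace W]

theorem CnOn.congr {n : ℕ} {f f' : V → W} {U : Set V} (hf : CnOn K n f U) (h : EqOn f' f U) :
    CnOn K n f' U := by
  cases n with
  | zero => exact ContinuousOn.congr hf h
  | succ n =>
    obtain ⟨g, ⟨hg, hs⟩, hn⟩ := hf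
    refine ⟨g, ⟨hg, fun s x v hx => ?_⟩, hn⟩
    rw [hs s x v hx, h hx.1, h hx.2]

end

theorem cnOn_linear (n : ℕ) : ∀ {V W : Type u} [AddCommGroup V] [Module K V] [TopologicalSpace V]
    [AddCommGroup W] [Module K W] [TopologicalSpace W] (L : V →L[K] W) (U : Set V),
    CnOn K n L U := by
  induction n with
  | zero => intro V W _ _ _ _ _ _ L U; exact L.continuous.continuousOn
  | succ n ih =>
    intro V W _ _ _ _ _ _ L U
    let L' : V × V × K →L[K] W :=
      L.comp ((ContinuousLinearMap.fst K V K).comp (ContinuousLinearMap.snd K V (V × K)))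
    refine ⟨L', ⟨L'.continuous.continuousOn, fun s x v _ => ?_⟩, ih L' _⟩
    simp [L', smul_smul]

/-- `F = (F_A)_A` is the family of iterated tangent maps
`f^A_t = (…((f_{t_{i₁}})_{t_{i₂}})…)_{t_{i_p}}`, `A = {i₁ < … < i_p}`, of a map `f` defined on `U`:
one has `F_∅ = f`, and if `k` is larger than all elements of `B`, then
`F_{B ∪ {k}} (x, v) = (F_B (x), (F_B)^[1] (x, v, t_k))`. -/
def IsIteratedTangent {n : ℕ} (t : Fin n → K) {V W : Type u}
    [AddCommGroup V] [Module K V] [TopologicalSpace V]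
    [AddCommGroup W] [Module K W] [TopologicalSpace W] (U : Set V) (f : U → W)
    (F : ∀ A : Finset (Fin n), (Subs A → V) → (Subs A → W)) : Prop :=
  (∀ x : U, F ∅ (fun _ => (x : V)) = fun _ => f x) ∧
  ∀ (k : Fin n) (B A : Finset (Fin n)) (h : IsEdge k B A), (∀ i ∈ B, i < k) →
    ∃ g, IsSlope K (F B) (extDom t U B) g ∧
      ∀ v ∈ extDom t U A, F A v =
        join h (F B (fun S => v (lo h S))) (g (fun S => v (lo h S), fun S => v (hi h S), t k))

end Calculus

/-! ### Manifolds -/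

section Manifold

/-- A Hausdorff manifold of class `C^n` over `K`, modelled on a Hausdorff topological `K`-module:
a Hausdorff space with an atlas whose transition maps are of class `C^n`. The class `C^n` is a
local notion only if `K` is a field; in general, one needs to require that finitely many points
always lie in a common (not necessarily connected) chart domain. -/
structure CnManifold (K : Type u) [CommRing K] [TopologicalSpace K] (n : ℕ) where
  carrier : Type u
  [topCarrier : TopologicalSpace carrier]
  [t2Carrier : T2Space carrier]
  model : Type u
  [addModel : AddCommGroup model]
  [moduleModel : Module K model]
  [topModel : TopologicalSpace model]
  [topAddModel : IsTopologicalAddGroup model]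
  [smulModel : ContinuousSMul K model]
  [t2Model : T2Space model]
  atlas : Set (OpenPartialHomeomorph carrier model)
  exists_chart : ∀ x : carrier, ∃ φ ∈ atlas, x ∈ φ.source
  compatible : ∀ φ ∈ atlas, ∀ ψ ∈ atlas,
    CnOn K n (fun v => ψ (φ.symm v)) (φ.target ∩ φ.symm ⁻¹' ψ.source)
  exists_common_chart : IsField K ∨
    ∀ s : Set carrier, s.Finite → s.Nonempty → ∃ φ ∈ atlas, s ⊆ φ.source

attribute [instance] CnManifold.topCarrier CnManifold.t2Carrier CnManifold.addModel
  CnManifold.moduleModel CnManifold.topModel CnManifold.topAddModel CnManifold.smulModel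
  CnManifold.t2Model

variable {K : Type u} [CommRing K] [TopologicalSpace K] {n : ℕ}

/-- `f` is a map of class `C^n` between manifolds: it is continuous, and it is of class `C^n`
in the charts of the two atlases. -/
def IsCnMap (X Y : CnManifold K n) (f : X.carrier → Y.carrier) : Prop :=
  Continuous f ∧ ∀ φ ∈ X.atlas, ∀ ψ ∈ Y.atlas,
    CnOn K n (fun v => ψ (f (φ.symm v))) (φ.target ∩ φ.symm ⁻¹' (f ⁻¹' ψ.source))

/-- An open subset `U` of a topological module, as a manifold: its only chart is the inclusion
(there is none if `U` is empty). -/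
def openManifold (n : ℕ) {V : Type u} [AddCommGroup V] [Module K V] [TopologicalSpace V]
    [IsTopologicalAddGroup V] [ContinuousSMul K V] [T2Space V] (U : Opens V) :
    CnManifold K n where
  carrier := U
  model := V
  atlas := {e | ∃ hU : Nonempty U, e = U.openPartialHomeomorphSubtypeCoe hU}
  exists_chart x := ⟨_, ⟨⟨x⟩, rfl⟩, by simp⟩
  compatible := by
    rintro φ ⟨hU, rfl⟩ ψ ⟨_, rfl⟩
    refine (cnOn_linear n (ContinuousLinearMap.id K V) _).congr fun v hv => ?_
    exact (U.openPartialHomeomorphSubtypeCoe hU).right_inv hv.1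
  exists_common_chart := Or.inr fun s _ hs =>
    ⟨_, ⟨⟨hs.some⟩, rfl⟩, by simp⟩

/-- The inverse of a chart `φ` of a manifold `X`, as a map to `X` from the open set that is the
range of `φ`. -/
def chartInv (X : CnManifold K n) (φ : OpenPartialHomeomorph X.carrier X.model) :
    (openManifold (K := K) n ⟨φ.target, φ.open_target⟩).carrier → X.carrier :=
  fun y => φ.symm y.1

theorem isCnMap_chartInv (X : CnManifold K n) (φ : OpenPartialHomeomorph X.carrier X.model)
    (hφ : φ ∈ X.atlas) : IsCnMap (openManifold n ⟨φ.target, φ.open_target⟩) X (chartInv X φ) := by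
  refine ⟨continuousOn_iff_continuous_domRestrict.1 φ.continuousOn_symm, ?_⟩
  rintro _ ⟨hU, rfl⟩ ψ hψ
  let U : Opens X.model := ⟨φ.target, φ.open_target⟩
  have key : ∀ v ∈ φ.target, ((U.openPartialHomeomorphSubtypeCoe hU).symm v).1 = v := fun v hv =>
    (U.openPartialHomeomorphSubtypeCoe hU).right_inv (by simpa [U] using hv)
  have hset : (U.openPartialHomeomorphSubtypeCoe hU).target ∩
      (U.openPartialHomeomorphSubtypeCoe hU).symm ⁻¹' (chartInv X φ ⁻¹' ψ.source)
      = φ.target ∩ φ.symm ⁻¹' ψ.source := by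
    ext v
    have ht : v ∈ (U.openPartialHomeomorphSubtypeCoe hU).target ↔ v ∈ φ.target := by simp [U]
    rw [mem_inter_iff, mem_inter_iff, ht]
    refine and_congr_right fun hv => ?_
    show φ.symm ((U.openPartialHomeomorphSubtypeCoe hU).symm v).1 ∈ ψ.source ↔ _
    rw [key v hv]
    rfl
  change CnOn K n _ ((U.openPartialHomeomorphSubtypeCoe hU).target ∩
      (U.openPartialHomeomorphSubtypeCoe hU).symm ⁻¹' (chartInv X φ ⁻¹' ψ.source))
  rw [hset]
  refine (X.compatible φ hφ ψ hψ).congr fun v hv => ?_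
  show ψ (φ.symm ((U.openPartialHomeomorphSubtypeCoe hU).symm v).1) = _
  rw [key v hv.1]

/-- Elements `(φ, v)` and `(ψ, w)` (where `φ, ψ` are charts, and `v, w` belong to the vertex sets at
`A` of the local construction for the ranges of `φ, ψ`) represent the same element: `v` belongs to
the vertex set for the domain of the transition map `ψ ∘ φ⁻¹`, and `w` is its image under the
iterated tangent map `(ψ ∘ φ⁻¹)^A_t`. -/
def GlueRel (t : Fin n → K) (X : CnManifold K n) (A : Finset (Fin n))
    (a b : Σ φ : X.atlas, extDom t φ.1.target A) : Prop :=
  a.2.1 ∈ extDom t (a.1.1.target ∩ a.1.1.symm ⁻¹' b.1.1.source) A ∧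
  ∃ F : ∀ A : Finset (Fin n), (Subs A → X.model) → (Subs A → X.model),
    IsIteratedTangent t (a.1.1.target ∩ a.1.1.symm ⁻¹' b.1.1.source)
      (fun v => b.1.1 (a.1.1.symm v)) F ∧ b.2.1 = F A a.2.1

/-- The set glued from the vertex sets at `A` of the local construction for the ranges of all
charts. -/
def Glued (t : Fin n → K) (X : CnManifold K n) (A : Finset (Fin n)) : Type u :=
  Quot (GlueRel t X A)

/-- The iterated tangent bundle `T^A M`: its elements are represented by pairs of a chart `φ`
of `M` and an element of `T^A (ran φ) = {(v_S)_{S ⊆ A} | v_∅ ∈ ran φ}`, where `(φ, v)` is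
identified with `(ψ, T^A (ψ ∘ φ⁻¹) v)`. For the full set `A`, this is `T^n M = T (T (… M))`. -/
abbrev IterTangent (X : CnManifold K n) (A : Finset (Fin n)) : Type u := Glued (0 : Fin n → K) X A

/-- The `n`-fold groupoid `H` is glued, via morphisms `c φ`, from the local constructions for the
ranges of all charts `φ` of `X`. -/
def IsGlued (t : Fin n → K) (X : CnManifold K n) (H : NGpd.{u} n)
    (c : ∀ φ : X.atlas, Hom (localNGpd t φ.1.target) H) : Prop :=
  ∀ A, ∃ e : Glued t X A ≃ H.vertex A,
    ∀ (φ : X.atlas) (v : extDom t φ.1.target A), e (Quot.mk _ ⟨φ, v⟩) = (c φ).map A v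

/-- The `n`-fold groupoid `H` is the `n`-fold tangent bundle of `X`: its vertex sets are the iterated
tangent bundles `T^A X`, and in the charts its edges are given by the tangent bundle projections
`(x, v) ↦ x` and the addition of tangent vectors (the charts `c φ` are morphisms from the local
construction at `t = 0`). -/
def IsNFoldTangentBundle (X : CnManifold K n) (H : NGpd.{u} n)
    (c : ∀ φ : X.atlas, Hom (localNGpd (0 : Fin n → K) φ.1.target) H) : Prop :=
  ∀ A, ∃ e : IterTangent X A ≃ H.vertex A,
    ∀ (φ : X.atlas) (v : extDom (0 : Fin n → K) φ.1.target A),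
      e (Quot.mk _ ⟨φ, v⟩) = (c φ).map A v

end Manifold

end SymCubic

open SymCubic

namespace SymCubic

set_option linter.unusedSectionVars false

open Filter Function

/-! ### Tangent images as limits along invertible parameters -/

section Foot

variable {K : Type u} [CommRing K] {n : ℕ} {V : Type u} [AddCommGroup V] [Module K V]

/-! The feet of a family `v` over the subsets of `A` are the points ∑_{S ⊆ C} t_S v_S, one for each
C ⊆ A. If the t_i are invertible, `v` is determined by its feet, which may be arbitrary points of
`U`: the local construction is then the pair groupoid, and the iterated tangent map of `f` simply
applies `f` to each foot. In this form, functoriality and compatibility with all structure maps are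
evident, and the order of the directions plays no role. As the units are dense and the modules
Hausdorff, these facts pass to the limit for arbitrary `t`. This is the role of `HasTan`, which
characterises iterated tangent maps as limits from invertible parameters.

That the limits exist is where class C^n enters. By `exists_continuous_feet`, the map over B ∪ {k}
is assembled from the maps over `B` of `f` and of its slope f^[1], with t_k as an additional
coordinate, and it is jointly continuous in points and parameters. `exists_isIteratedTangent` and
`IsIteratedTangent.hasTan` identify the limits with the recursively defined iterated tangent maps.

The global difficulty is that the feet of one element may be far apart; over a field, no chart need
contain them all. Let I be the set of directions with t_i invertible. In these directions the
passage to feet (`splitHom`, bijective by `bijective_splitHom`) leads to pair groupoids, which need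
no charts. In the other directions the local constructions are glued with the parameters `offParam
t`. Over a field these vanish, so that an element has only one foot and any chart at this point will
do; otherwise the axiom on finite subsets provides charts (`enoughCharts`). Elements entering a
groupoid axiom lie over the same point, at most four at a time, so each axiom is checked within one
chart (`Gluing`). The n-fold groupoid of a manifold is `mixed I` of the glued one.

By `HasTan.partialFeet_eq`, the splitting commutes with iterated tangent maps, so it commutes with
changes of charts. Hence one recovers the direct gluing of the local constructions whenever the feet
of each element lie in one chart. If all t_i are invertible, only the pair groupoid of points
remains. -/

/-- The parameters `s` such that `s i` is invertible for each `i ∈ A`. -/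
def unitsOn (K : Type u) [CommRing K] {n : ℕ} (A : Finset (Fin n)) : Set (Fin n → K) :=
  {s | ∀ i ∈ A, IsUnit (s i)}

theorem unitsOn_anti {A B : Finset (Fin n)} (h : B ⊆ A) : unitsOn K A ⊆ unitsOn K B :=
  fun _ hs i hi => hs i (h hi)

theorem isEdge_insert {k : Fin n} {B : Finset (Fin n)} (h : k ∉ B) : IsEdge k B (insert k B) :=
  ⟨h, rfl⟩

theorem foot_congr {A : Finset (Fin n)} {s t : Fin n → K} (h : ∀ i ∈ A, s i = t i) (C : Subs A)
    (v : Subs A → V) : foot s C v = foot t C v := by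
  unfold foot
  refine Finset.sum_congr rfl fun S _ => ?_
  rw [Finset.prod_congr rfl fun i hi => h i (S.2 hi)]

theorem extDom_congr {A : Finset (Fin n)} {s t : Fin n → K} (h : ∀ i ∈ A, s i = t i)
    (U : Set V) : extDom s U A = extDom t U A := by
  ext v
  exact forall_congr' fun C => by rw [foot_congr h]

theorem foot_of_empty (s : Fin n → K) (C : Subs (∅ : Finset (Fin n)))
    (v : Subs (∅ : Finset (Fin n)) → V) : foot s C v = v ⟨∅, subset_rfl⟩ := by
  have hS : ∀ S : Subs (∅ : Finset (Fin n)), S = ⟨∅, subset_rfl⟩ := fun S =>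
    Subtype.ext (Finset.subset_empty.1 S.2)
  unfold foot
  rw [Fintype.sum_eq_single ⟨∅, subset_rfl⟩ (fun S hne => absurd (hS S) hne)]
  simp

/-- Along a direction k, the feet of `v` are those of its source and those of its target x + s_k w.
By induction these determine x and x + s_k w, and the unit s_k can be cancelled. -/
theorem foot_inj {s : Fin n → K} : ∀ {A : Finset (Fin n)}, s ∈ unitsOn K A →
    ∀ {v w : Subs A → V}, (∀ C, foot s C v = foot s C w) → v = w := by
  intro A
  induction A using Finset.induction_on with
  | empty =>
    intro _ v w h
    funext S
    have := h S
    rwa [foot_of_empty, foot_of_empty,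
      ← show S = ⟨∅, subset_rfl⟩ from Subtype.ext (Finset.subset_empty.1 S.2)] at this
  | insert k B hk ih =>
    intro hs v w h
    have e := isEdge_insert hk
    have hB : s ∈ unitsOn K B := unitsOn_anti e.sub hs
    have h1 := ih hB (v := fun S => v (lo e S)) (w := fun S => w (lo e S)) fun C => by
      rw [← foot_lo, ← foot_lo]; exact h _
    have h2 := ih hB (v := tgtMap s e v) (w := tgtMap s e w) fun C => by
      rw [← foot_hi, ← foot_hi]; exact h _
    refine fam_ext e (fun S => congrFun h1 S) fun S => ?_
    have h3 := congrFun h2 S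
    have h4 := congrFun h1 S
    simp only [tgtMap] at h3
    rw [h4, add_right_inj] at h3
    exact (hs k e.mem).smul_left_cancel.1 h3

theorem tgtMap_join {k : Fin n} {B A : Finset (Fin n)} (h : IsEdge k B A) (t : Fin n → K)
    (x y : Subs B → V) : tgtMap t h (join h x y) = fun S => x S + t k • y S := by
  funext S; simp [tgtMap]

end Foot

/-! ### Tangent images: uniqueness, composition and dependence on the parameters. -/

section Tangent

variable {K : Type u} [CommRing K] [TopologicalSpace K] [IsTopologicalRing K] {n : ℕ}
  {V W Y : Type u}
  [AddCommGroup V] [Module K V] [TopologicalSpace V] [IsTopologicalAddGroup V] [ContinuousSMul K V]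
  [AddCommGroup W] [Module K W] [TopologicalSpace W] [IsTopologicalAddGroup W] [ContinuousSMul K W]
  [AddCommGroup Y] [Module K Y] [TopologicalSpace Y] [IsTopologicalAddGroup Y] [ContinuousSMul K Y]

theorem continuous_foot {A : Finset (Fin n)} (C : Subs A) :
    Continuous fun p : (Subs A → V) × (Fin n → K) => foot p.2 C p.1 := by
  unfold foot
  refine continuous_finsetSum _ fun S _ => ?_
  split_ifs
  · fun_prop
  · exact continuous_const

theorem continuous_join {X : Type u} [TopologicalSpace X] {k : Fin n} {B A : Finset (Fin n)}
    (h : IsEdge k B A) : Continuous fun p : (Subs B → X) × (Subs B → X) => join h p.1 p.2 := by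
  refine continuous_pi fun S => ?_
  unfold join
  split_ifs <;> fun_prop

theorem continuous_tgtMap {k : Fin n} {B A : Finset (Fin n)} (h : IsEdge k B A) :
    Continuous fun p : (Subs A → V) × (Fin n → K) => tgtMap p.2 h p.1 := by
  unfold tgtMap
  fun_prop

/-- Openness in the point and the parameter together keeps nearby pairs (v', s) inside the extended
domains, although these vary with s. -/
theorem isOpen_extDom {U : Set V} (hU : IsOpen U) (A : Finset (Fin n)) :
    IsOpen {p : (Subs A → V) × (Fin n → K) | p.1 ∈ extDom p.2 U A} := by
  have : {p : (Subs A → V) × (Fin n → K) | p.1 ∈ extDom p.2 U A}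
      = ⋂ C : Subs A, (fun p : (Subs A → V) × (Fin n → K) => foot p.2 C p.1) ⁻¹' U := by
    ext p; simp [extDom]
  rw [this]
  exact isOpen_iInter_of_finite fun C => hU.preimage (continuous_foot C)

/-- A product of dense sets is dense. This makes limits from invertible parameters unique. -/
theorem neBot_units (hK : Dense {s : K | IsUnit s}) (A : Finset (Fin n)) (t : Fin n → K) :
    (𝓝[unitsOn K A] t).NeBot := by
  have : Dense (unitsOn K (n := n) A) := by
    have h : unitsOn K (n := n) A = (A : Set (Fin n)).pi fun _ => {s : K | IsUnit s} := by
      ext s; simp [unitsOn, Set.mem_pi]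
    rw [h]
    exact dense_pi _ fun _ _ => hK
  exact mem_closure_iff_nhdsWithin_neBot.1 (this t)

/-- The filter of all pairs `(v', s)` tending to `(v, t)`, where `s i` is invertible
for `i ∈ A`. -/
def tanFilter {A : Finset (Fin n)} (t : Fin n → K) (v : Subs A → V) :
    Filter ((Subs A → V) × (Fin n → K)) := 𝓝 v ×ˢ 𝓝[unitsOn K A] t

theorem tanFilter_le {A : Finset (Fin n)} (t : Fin n → K) (v : Subs A → V) :
    tanFilter t v ≤ 𝓝 (v, t) := by
  rw [nhds_prod_eq]
  exact Filter.prod_mono le_rfl nhdsWithin_le_nhds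

theorem eventually_units {A : Finset (Fin n)} (t : Fin n → K) (v : Subs A → V) :
    ∀ᶠ p in tanFilter t v, p.2 ∈ unitsOn K A :=
  (tendsto_snd (f := 𝓝 v)).eventually self_mem_nhdsWithin

theorem tendsto_tanFilter {ι : Type*} {l : Filter ι} {A : Finset (Fin n)} {t : Fin n → K}
    {v : Subs A → V} {v' : ι → Subs A → V} {s : ι → Fin n → K} (hv : Tendsto v' l (𝓝 v))
    (hs : Tendsto s l (𝓝 t)) (hu : ∀ᶠ i in l, s i ∈ unitsOn K A) :
    Tendsto (fun i => (v' i, s i)) l (tanFilter t v) :=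
  hv.prodMk (tendsto_nhdsWithin_iff.2 ⟨hs, hu⟩)

/-- `w` is the image of `v` under the iterated tangent map of `f` with parameters `t`: it is the
limit of the families `w'` with feet `f (foot s C v')`, as `v'` tends to `v` and as `s` tends to
`t` with invertible `s i`. -/
def HasTan {A : Finset (Fin n)} (t : Fin n → K) (f : V → W) (v : Subs A → V)
    (w : Subs A → W) : Prop :=
  ∃ Φ : (Subs A → V) × (Fin n → K) → (Subs A → W), Tendsto Φ (tanFilter t v) (𝓝 w) ∧
    ∀ᶠ p in tanFilter t v, ∀ C, foot p.2 C (Φ p) = f (foot p.2 C p.1)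

variable {A : Finset (Fin n)} {t : Fin n → K} {f : V → W} {v : Subs A → V} {w : Subs A → W}

/-- A tangent image along a family of points and parameters. -/
theorem HasTan.along (h : HasTan t f v w) {ι : Type*} {l : Filter ι} {v' : ι → Subs A → V}
    {s : ι → Fin n → K} (hv : Tendsto v' l (𝓝 v))
    (hs : Tendsto s l (𝓝 t)) (hu : ∀ᶠ i in l, s i ∈ unitsOn K A) :
    ∃ w' : ι → Subs A → W, Tendsto w' l (𝓝 w) ∧
      ∀ᶠ i in l, ∀ C, foot (s i) C (w' i) = f (foot (s i) C (v' i)) := by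
  obtain ⟨Φ, h1, h2⟩ := h
  have := tendsto_tanFilter hv hs hu
  exact ⟨_, h1.comp this, this.eventually h2⟩

/-- The uniqueness principle for tangent images. -/
theorem HasTan.eq_of_tendsto [T2Space W] (h : HasTan t f v w) {ι : Type*} {l : Filter ι} [l.NeBot]
    {v' : ι → Subs A → V} {s : ι → Fin n → K} (hv : Tendsto v' l (𝓝 v))
    (hs : Tendsto s l (𝓝 t)) (hu : ∀ᶠ i in l, s i ∈ unitsOn K A) {w' : ι → Subs A → W}
    {w₀ : Subs A → W} (hw : Tendsto w' l (𝓝 w₀))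
    (he : ∀ᶠ i in l, ∀ C, foot (s i) C (w' i) = f (foot (s i) C (v' i))) : w = w₀ := by
  obtain ⟨w'', h1, h2⟩ := h.along hv hs hu
  refine tendsto_nhds_unique_of_eventuallyEq h1 hw ?_
  filter_upwards [h2, he, hu] with i a b c
  exact foot_inj c fun C => by rw [a, b]

theorem HasTan.unique (hK : Dense {s : K | IsUnit s}) [T2Space W] (h : HasTan t f v w)
    {w₀ : Subs A → W} (h₀ : HasTan t f v w₀) : w = w₀ := by
  have := neBot_units hK A t
  have hs : Tendsto id (𝓝[unitsOn K A] t) (𝓝 t) := nhdsWithin_le_nhds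
  have hu : ∀ᶠ s in 𝓝[unitsOn K A] t, s ∈ unitsOn K A := self_mem_nhdsWithin
  obtain ⟨w', h1, h2⟩ := h₀.along (tendsto_const_nhds (x := v)) hs hu
  exact h.eq_of_tendsto tendsto_const_nhds hs hu h1 h2

/-- The definition lets the points vary together with the parameters exactly for this purpose: the
approximating images under `f` serve as the varying points for `g`. -/
theorem HasTan.comp {g : W → Y} {y : Subs A → Y} (hg : HasTan t g w y) (hf : HasTan t f v w) :
    HasTan t (g ∘ f) v y := by
  obtain ⟨Φ, h1, h2⟩ := hf
  obtain ⟨y', h3, h4⟩ := hg.along h1 ((tendsto_snd).mono_right nhdsWithin_le_nhds)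
    (eventually_units t v)
  refine ⟨y', h3, ?_⟩
  filter_upwards [h2, h4] with p a b C
  rw [b, a]; rfl

theorem HasTan.refl (t : Fin n → K) (v : Subs A → V) : HasTan t id v v :=
  ⟨fun p => p.1, tendsto_fst, Eventually.of_forall fun _ _ => rfl⟩

theorem HasTan.congr {f' : V → W} {U : Set V} (h : HasTan t f v w) (hU : IsOpen U)
    (hv : v ∈ extDom t U A) (he : EqOn f' f U) : HasTan t f' v w := by
  obtain ⟨Φ, h1, h2⟩ := h
  refine ⟨Φ, h1, ?_⟩
  have : ∀ᶠ p in tanFilter t v, p.1 ∈ extDom p.2 U A :=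
    tanFilter_le t v ((isOpen_extDom hU A).mem_nhds hv)
  filter_upwards [h2, this] with p a b C
  rw [a, he (b C)]

/-- Feet depend continuously on family and parameter, so the defining identity on feet survives in
the limit, also at non-invertible parameters. -/
theorem HasTan.foot_eq (hK : Dense {s : K | IsUnit s}) [T2Space W] (h : HasTan t f v w)
    (C : Subs A) (hf : ContinuousAt f (foot t C v)) : foot t C w = f (foot t C v) := by
  have := neBot_units hK A t
  have hs : Tendsto id (𝓝[unitsOn K A] t) (𝓝 t) := nhdsWithin_le_nhds
  obtain ⟨w', h1, h2⟩ := h.along (tendsto_const_nhds (x := v)) hs self_mem_nhdsWithin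
  have h3 := ((continuous_foot C).tendsto (w, t)).comp (h1.prodMk_nhds hs)
  have h4 := hf.tendsto.comp (((continuous_foot C).tendsto (v, t)).comp
    ((tendsto_const_nhds (x := v)).prodMk_nhds hs))
  refine tendsto_nhds_unique_of_eventuallyEq h3 h4 ?_
  filter_upwards [h2] with s hs'
  exact hs' C

/-- Tangent images at `A` only depend on the parameters `t i` with `i ∈ A`. -/
theorem HasTan.congr_param {t' : Fin n → K} (h : HasTan t f v w) (ht : ∀ i ∈ A, t i = t' i) :
    HasTan t' f v w := by
  classical
  -- The parameters outside `A` are frozen at the values of `t`. Feet over `A` do not see them, and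
  -- `m s` tends to `t` as `s` tends to `t'`.
  let m : (Fin n → K) → (Fin n → K) := fun s i => if i ∈ A then s i else t i
  have hm : ∀ s, ∀ i ∈ A, m s i = s i := fun s i hi => if_pos hi
  have hc : Continuous m := by
    refine continuous_pi fun i => ?_
    by_cases hi : i ∈ A
    · simpa [m, hi] using continuous_apply i
    · simpa [m, hi] using continuous_const
  have ht' : m t' = t := by
    funext i
    by_cases hi : i ∈ A
    · simp [m, hi, ht i hi]
    · simp [m, hi]
  obtain ⟨w', h1, h2⟩ := h.along (l := tanFilter t' v) (v' := fun p => p.1) (s := fun p => m p.2)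
    tendsto_fst (by
      have := (hc.tendsto t').comp ((tendsto_snd (f := 𝓝 v)).mono_right
        (nhdsWithin_le_nhds (a := t') (s := unitsOn K A)))
      rwa [ht'] at this) (by
      filter_upwards [eventually_units t' v] with p hp i hi
      rw [hm _ _ hi]; exact hp i hi)
  refine ⟨w', h1, ?_⟩
  filter_upwards [h2] with p hp C
  have := hp C
  rwa [foot_congr (hm p.2), foot_congr (hm p.2)] at this

end Tangent

/-! ### Compatibility of tangent images with the groupoid structure. -/

section Structure

variable {K : Type u} [CommRing K] [TopologicalSpace K] [IsTopologicalRing K] {n : ℕ}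
  {V W : Type u}
  [AddCommGroup V] [Module K V] [TopologicalSpace V] [IsTopologicalAddGroup V] [ContinuousSMul K V]
  [AddCommGroup W] [Module K W] [TopologicalSpace W] [IsTopologicalAddGroup W] [ContinuousSMul K W]
  [T2Space W]
  {k : Fin n} {B A : Finset (Fin n)} (h : IsEdge k B A) {t : Fin n → K} {f : V → W}

theorem continuous_lo {X : Type u} [TopologicalSpace X] :
    Continuous fun v : Subs A → X => fun S => v (lo h S) := by fun_prop

theorem continuous_hi {X : Type u} [TopologicalSpace X] :
    Continuous fun v : Subs A → X => fun S => v (hi h S) := by fun_prop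

/-- At invertible parameters the feet of the source are the feet indexed by subsets without k, so
both sides are limits of families with equal feet. The other structure maps are treated on the same
pattern. -/
theorem HasTan.src (hK : Dense {s : K | IsUnit s}) {v : Subs A → V} {w : Subs A → W}
    {y : Subs B → W} (hv : HasTan t f v w) (hy : HasTan t f (fun S => v (lo h S)) y) :
    y = fun S => w (lo h S) := by
  have := neBot_units hK A t
  have hs : Tendsto id (𝓝[unitsOn K A] t) (𝓝 t) := nhdsWithin_le_nhds
  have hu : ∀ᶠ s in 𝓝[unitsOn K A] t, s ∈ unitsOn K A := self_mem_nhdsWithin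
  obtain ⟨w', h1, h2⟩ := hv.along (tendsto_const_nhds (x := v)) hs hu
  refine hy.eq_of_tendsto tendsto_const_nhds hs (hu.mono fun s h' => unitsOn_anti h.sub h')
    (((continuous_lo h).tendsto _).comp h1) ?_
  filter_upwards [h2] with s hs' C
  have := hs' (lo h C)
  rwa [foot_lo, foot_lo] at this

theorem HasTan.tgt (hK : Dense {s : K | IsUnit s}) {v : Subs A → V} {w : Subs A → W}
    {y : Subs B → W} (hv : HasTan t f v w) (hy : HasTan t f (tgtMap t h v) y) :
    y = tgtMap t h w := by
  have := neBot_units hK A t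
  have hs : Tendsto id (𝓝[unitsOn K A] t) (𝓝 t) := nhdsWithin_le_nhds
  have hu : ∀ᶠ s in 𝓝[unitsOn K A] t, s ∈ unitsOn K A := self_mem_nhdsWithin
  obtain ⟨w', h1, h2⟩ := hv.along (tendsto_const_nhds (x := v)) hs hu
  refine hy.eq_of_tendsto (((continuous_tgtMap h).tendsto (v, t)).comp
      ((tendsto_const_nhds (x := v)).prodMk_nhds hs)) hs
    (hu.mono fun s h' => unitsOn_anti h.sub h')
    (((continuous_tgtMap h).tendsto (w, t)).comp (h1.prodMk_nhds hs)) ?_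
  filter_upwards [h2] with s hs' C
  have := hs' (hi h C)
  rw [foot_hi, foot_hi] at this
  exact this

theorem HasTan.one (hK : Dense {s : K | IsUnit s}) {x : Subs B → V} {y : Subs B → W}
    {w : Subs A → W} (hx : HasTan t f x y) (hw : HasTan t f (join h x 0) w) :
    w = join h y 0 := by
  have := neBot_units hK A t
  have hs : Tendsto id (𝓝[unitsOn K A] t) (𝓝 t) := nhdsWithin_le_nhds
  have hu : ∀ᶠ s in 𝓝[unitsOn K A] t, s ∈ unitsOn K A := self_mem_nhdsWithin
  obtain ⟨y', h1, h2⟩ := hx.along (tendsto_const_nhds (x := x)) hs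
    (hu.mono fun s h' => unitsOn_anti h.sub h')
  refine hw.eq_of_tendsto tendsto_const_nhds hs hu
    (((continuous_join h).tendsto (y, 0)).comp (h1.prodMk_nhds tendsto_const_nhds)) ?_
  filter_upwards [h2] with s hs' C
  rcases sub_cases h C with ⟨T, rfl⟩ | ⟨T, rfl⟩
  · simpa [foot_lo] using hs' T
  · simpa [foot_hi, tgtMap_join] using hs' T

/-- At invertible parameters, the product combines the feet of `b` without k and the feet of `a`
with k, a rule that commutes with applying `f` to feet. -/
theorem HasTan.mul (hK : Dense {s : K | IsUnit s}) {a b : Subs A → V} {a' b' m : Subs A → W}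
    (ha : HasTan t f a a') (hb : HasTan t f b b')
    (hab : (fun S => a (lo h S)) = tgtMap t h b)
    (hm : HasTan t f (join h (fun S => b (lo h S)) (fun S => a (hi h S) + b (hi h S))) m) :
    m = join h (fun S => b' (lo h S)) (fun S => a' (hi h S) + b' (hi h S)) := by
  have := neBot_units hK A t
  have hs : Tendsto id (𝓝[unitsOn K A] t) (𝓝 t) := nhdsWithin_le_nhds
  have hu : ∀ᶠ s in 𝓝[unitsOn K A] t, s ∈ unitsOn K A := self_mem_nhdsWithin
  have hcb := tendsto_const_nhds (x := b) (f := 𝓝[unitsOn K A] t)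
  obtain ⟨β, h1, h2⟩ := hb.along hcb hs hu
  -- Composability depends on the parameter: at s ≠ t the pair (a, b) need not be composable.
  -- Therefore `b` is fixed and the source of `a` is replaced by the target of `b` at s, which tends
  -- to the source of `a`.
  have hta := ((continuous_join h).tendsto (tgtMap t h b, fun S => a (hi h S))).comp
    ((((continuous_tgtMap h).tendsto (b, t)).comp (hcb.prodMk_nhds hs)).prodMk_nhds
      (tendsto_const_nhds (x := fun S => a (hi h S))))
  have ea : join h (tgtMap t h b) (fun S => a (hi h S)) = a := by
    rw [← hab]
    exact fam_ext h (by simp) (by simp)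
  simp only [ea] at hta
  obtain ⟨α, h3, h4⟩ := ha.along hta hs hu
  refine hm.eq_of_tendsto tendsto_const_nhds hs hu
    (((continuous_join h).tendsto (_, _)).comp ((((continuous_lo h).tendsto _).comp h1).prodMk_nhds
      ((((continuous_hi h).tendsto _).comp h3).add (((continuous_hi h).tendsto _).comp h1)))) ?_
  filter_upwards [h2, h4, hu] with s hb' ha' hu'
  -- The approximating images are composable at s, since the feet of both sides are the images of
  -- the same points.
  have key : (fun S => α s (lo h S)) = tgtMap s h (β s) := by
    refine foot_inj (unitsOn_anti h.sub hu') fun C => ?_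
    have e1 := ha' (lo h C)
    have e2 := hb' (hi h C)
    simp only [id, foot_lo, foot_hi, Function.comp_apply, join_lo] at e1 e2 ⊢
    rw [e1, e2]
  intro C
  rcases sub_cases h C with ⟨T, rfl⟩ | ⟨T, rfl⟩
  · have e2 := hb' (lo h T)
    simpa [foot_lo] using e2
  · have e1 := ha' (hi h T)
    simp only [id, foot_hi, Function.comp_apply, tgtMap_join] at e1 ⊢
    have e3 : ∀ {X : Type u} [AddCommGroup X] [Module K X] (x : Subs A → X) (y : Subs A → X),
        (fun S => x (lo h S) + s k • (y (hi h S) + x (hi h S)))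
          = fun S => tgtMap s h x S + s k • y (hi h S) := by
      intro X _ _ x y; funext S; simp only [tgtMap, smul_add]; abel
    have e4 : tgtMap s h (α s) = fun S => tgtMap s h (β s) S + s k • α s (hi h S) := by
      funext S; rw [← key]; rfl
    rw [e4] at e1
    refine (congrArg (foot s T) (e3 (β s) (α s))).trans (e1.trans ?_)
    exact congrArg (fun x => f (foot s T x)) (e3 b a).symm

/-- Inversion exchanges the feet at C and at C ∪ {k}. As the inverse itself depends on the
parameter, the inverses at s are used as approximating points. -/
theorem HasTan.inv (hK : Dense {s : K | IsUnit s}) {a : Subs A → V} {a' m : Subs A → W}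
    (ha : HasTan t f a a') (hm : HasTan t f (join h (tgtMap t h a) (fun S => - a (hi h S))) m) :
    m = join h (tgtMap t h a') (fun S => - a' (hi h S)) := by
  have := neBot_units hK A t
  have hs : Tendsto id (𝓝[unitsOn K A] t) (𝓝 t) := nhdsWithin_le_nhds
  have hu : ∀ᶠ s in 𝓝[unitsOn K A] t, s ∈ unitsOn K A := self_mem_nhdsWithin
  have hca := tendsto_const_nhds (x := a) (f := 𝓝[unitsOn K A] t)
  obtain ⟨α, h1, h2⟩ := ha.along hca hs hu
  have key : ∀ {X : Type u} [AddCommGroup X] [Module K X] (s : Fin n → K) (x : Subs A → X),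
      tgtMap s h (join h (tgtMap s h x) (fun S => - x (hi h S))) = fun S => x (lo h S) := by
    intro X _ _ s x
    rw [tgtMap_join]
    funext S
    simp [tgtMap]
  refine hm.eq_of_tendsto
    (((continuous_join h).tendsto (_, _)).comp ((((continuous_tgtMap h).tendsto (a, t)).comp
      (hca.prodMk_nhds hs)).prodMk_nhds (tendsto_const_nhds (x := fun S => - a (hi h S))))) hs hu
    (((continuous_join h).tendsto (_, _)).comp ((((continuous_tgtMap h).tendsto (a', t)).comp
      (h1.prodMk_nhds hs)).prodMk_nhds (((continuous_hi h).tendsto _).comp h1).neg)) ?_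
  filter_upwards [h2] with s hs' C
  rcases sub_cases h C with ⟨T, rfl⟩ | ⟨T, rfl⟩
  · have := hs' (hi h T)
    simp only [id, foot_lo, foot_hi, Function.comp_apply, join_lo] at this ⊢
    exact this
  · have := hs' (lo h T)
    simp only [id, foot_lo, foot_hi, Function.comp_apply] at this ⊢
    rw [key s a]
    exact (congrArg (foot s T) (key s (α s))).trans this

end Structure

/-! ### Existence of iterated tangent maps -/

theorem CnOn.pred {K : Type u} [CommRing K] [TopologicalSpace K] [IsTopologicalRing K] (m : ℕ) :
    ∀ {V W : Type u} [AddCommGroup V] [Module K V]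
    [TopologicalSpace V] [IsTopologicalAddGroup V]
    [AddCommGroup W] [Module K W] [TopologicalSpace W] [IsTopologicalAddGroup W]
    {f : V → W} {U : Set V}, CnOn K (m + 1) f U → CnOn K m f U := by
  induction m with
  | zero =>
    rintro V W _ _ _ _ _ _ _ _ f U ⟨g, ⟨hg, hs⟩, -⟩
    change ContinuousOn f U
    intro x hx
    -- The slope at the unit parameter 1 recovers the map: f y = f x + f^[1](x, y - x, 1).
    have hc : ContinuousOn (fun y => f x + g (x, y - x, 1)) U :=
      continuousOn_const.add (hg.comp (by fun_prop) fun y hy => ⟨hx, by simpa using hy⟩)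
    refine (hc.congr fun y hy => ?_) x hx
    have := hs 1 x (y - x) ⟨hx, by simpa using hy⟩
    simp at this
    simp [this]
  | succ m ih =>
    rintro V W _ _ _ _ _ _ _ _ f U ⟨g, hg, hn⟩
    exact ⟨g, hg, ih hn⟩

theorem CnOn.continuousOn {K : Type u} [CommRing K] [TopologicalSpace K] [IsTopologicalRing K]
    {V W : Type u} [AddCommGroup V] [Module K V]
    [TopologicalSpace V] [IsTopologicalAddGroup V]
    [AddCommGroup W] [Module K W] [TopologicalSpace W] [IsTopologicalAddGroup W]
    {f : V → W} {U : Set V} : ∀ {m : ℕ}, CnOn K m f U → ContinuousOn f U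
  | 0, h => h
  | _ + 1, h => (h.pred _).continuousOn

/-! ### Linear algebra of feet. -/

section Algebra

variable {K : Type u} [CommRing K] {n : ℕ} {V W : Type u} [AddCommGroup V] [Module K V]
  [AddCommGroup W] [Module K W] {k : Fin n} {B A : Finset (Fin n)}

theorem map_foot (L : V →ₗ[K] W) (t : Fin n → K) (C : Subs A) (v : Subs A → V) :
    L (foot t C v) = foot t C fun S => L (v S) := by
  unfold foot
  rw [map_sum]
  refine Finset.sum_congr rfl fun S _ => ?_
  split_ifs <;> simp

/-- A family concentrated at ∅ has constant feet; this is how a parameter, or a single point, is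
regarded as a family. -/
theorem foot_single (t : Fin n → K) (C : Subs A) (c : V) :
    foot t C (fun S => if S.1 = ∅ then c else 0) = c := by
  unfold foot
  rw [Fintype.sum_eq_single ⟨∅, Finset.empty_subset A⟩]
  · simp
  · intro S hS
    have : S.1 ≠ ∅ := fun h => hS (Subtype.ext h)
    simp [this]

theorem foot_add (t : Fin n → K) (C : Subs A) (v w : Subs A → V) :
    foot t C (fun S => v S + w S) = foot t C v + foot t C w := by
  unfold foot
  rw [← Finset.sum_add_distrib]
  refine Finset.sum_congr rfl fun S _ => ?_
  split_ifs <;> simp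

theorem foot_smul (t : Fin n → K) (C : Subs A) (c : K) (v : Subs A → V) :
    foot t C (fun S => c • v S) = c • foot t C v :=
  (map_foot (LinearMap.lsmul K V c) t C v).symm

theorem foot_tgtMap (h : IsEdge k B A) (t : Fin n → K) (C : Subs B) (v : Subs A → V) :
    foot t C (tgtMap t h v)
      = foot t C (fun S => v (lo h S)) + t k • foot t C (fun S => v (hi h S)) := by
  unfold tgtMap
  rw [foot_add, foot_smul]

/-- An element `(x, v)` of the vertex set at `A = B ∪ {k}`, considered with the parameter `t_k`
as an element over `B` of the module `V × V × K`. -/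
def slopeArg (h : IsEdge k B A) (p : (Subs A → V) × (Fin n → K)) : Subs B → V × V × K :=
  fun S => (p.1 (lo h S), p.1 (hi h S), if S.1 = ∅ then p.2 k else 0)

theorem foot_slopeArg (h : IsEdge k B A) (p : (Subs A → V) × (Fin n → K)) (C : Subs B) :
    foot p.2 C (slopeArg h p)
      = (foot p.2 C (fun S => p.1 (lo h S)), foot p.2 C (fun S => p.1 (hi h S)), p.2 k) := by
  refine Prod.ext ?_ (Prod.ext ?_ ?_)
  · exact map_foot (LinearMap.fst K V (V × K)) p.2 C _
  · exact map_foot (LinearMap.fst K V K ∘ₗ LinearMap.snd K V (V × K)) p.2 C _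
  · exact (map_foot (LinearMap.snd K V K ∘ₗ LinearMap.snd K V (V × K)) p.2 C _).trans
      (foot_single p.2 C (p.2 k))

theorem slopeArg_mem (h : IsEdge k B A) {U : Set V} {p : (Subs A → V) × (Fin n → K)}
    (hp : p.1 ∈ extDom p.2 U A) : slopeArg h p ∈ extDom p.2 (extOne K U) B := by
  intro C
  rw [foot_slopeArg]
  have h1 := mem_src p.2 h hp C
  have h2 := mem_tgt p.2 h hp C
  rw [foot_tgtMap] at h2
  exact ⟨h1, h2⟩

end Algebra

/-- Induction on the differentiability class. The half over the subsets without k comes from `f`,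
the other half from its slope g, evaluated on (x, v, t_k) as a family over A \ {k}. Any k in `A` may
be removed, as feet do not refer to an order. Invertibility is used only for the identity on feet;
continuity holds at all parameters. -/
theorem exists_continuous_feet {K : Type u} [CommRing K] [TopologicalSpace K]
    [IsTopologicalRing K] {n : ℕ} (m : ℕ) : ∀ {V W : Type u}
    [AddCommGroup V] [Module K V] [TopologicalSpace V] [IsTopologicalAddGroup V]
    [ContinuousSMul K V]
    [AddCommGroup W] [Module K W] [TopologicalSpace W] [IsTopologicalAddGroup W]
    [ContinuousSMul K W] {f : V → W} {U : Set V}, CnOn K m f U →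
    ∀ A : Finset (Fin n), A.card ≤ m →
    ∃ Φ : (Subs A → V) × (Fin n → K) → (Subs A → W),
      ContinuousOn Φ {p | p.1 ∈ extDom p.2 U A} ∧
      ∀ p, p.1 ∈ extDom p.2 U A → p.2 ∈ unitsOn K A →
        ∀ C, foot p.2 C (Φ p) = f (foot p.2 C p.1) := by
  induction m with
  | zero =>
    intro V W _ _ _ _ _ _ _ _ _ _ f U hf A hA
    obtain rfl : A = ∅ := Finset.card_eq_zero.1 (Nat.le_zero.1 hA)
    refine ⟨fun p _ => f (p.1 ⟨∅, subset_rfl⟩), ?_, ?_⟩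
    · refine continuousOn_pi.2 fun _ => hf.continuousOn.comp (by fun_prop) fun p hp => ?_
      exact (extDom_empty p.2 U p.1).1 hp
    · intro p _ _ C
      rw [foot_of_empty, foot_of_empty]
  | succ m ih =>
    intro V W _ _ _ _ _ _ _ _ _ _ f U hf A hA
    rcases A.eq_empty_or_nonempty with rfl | ⟨k, hk⟩
    · exact ih (hf.pred _) ∅ (by simp)
    obtain ⟨g, ⟨hgc, hgs⟩, hg⟩ := id hf
    have h : IsEdge k (A.erase k) A := ⟨Finset.notMem_erase k A, (Finset.insert_erase hk).symm⟩
    have hB : (A.erase k).card ≤ m := by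
      rw [Finset.card_erase_of_mem hk]; omega
    obtain ⟨Φ, hΦ, hΦ'⟩ := ih (hf.pred _) (A.erase k) hB
    obtain ⟨Ψ, hΨ, hΨ'⟩ := ih hg (A.erase k) hB
    have hmem : ∀ p : (Subs A → V) × (Fin n → K), p.1 ∈ extDom p.2 U A →
        (fun S => p.1 (lo h S)) ∈ extDom p.2 U (A.erase k) := fun p hp => mem_src p.2 h hp
    refine ⟨fun p => join h (Φ (fun S => p.1 (lo h S), p.2)) (Ψ (slopeArg h p, p.2)), ?_, ?_⟩
    · refine (continuous_join h).comp_continuousOn (f := fun p =>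
        (Φ (fun S => p.1 (lo h S), p.2), Ψ (slopeArg h p, p.2))) (ContinuousOn.prodMk ?_ ?_)
      · exact hΦ.comp (by fun_prop) hmem
      · refine hΨ.comp (Continuous.continuousOn ?_) fun p hp => slopeArg_mem h hp
        unfold slopeArg
        refine Continuous.prodMk (continuous_pi fun S => ?_) continuous_snd
        split_ifs <;> fun_prop
    · intro p hp hu C
      have hu' := unitsOn_anti h.sub hu
      rcases sub_cases h C with ⟨T, rfl⟩ | ⟨T, rfl⟩
      · have := hΦ' (fun S => p.1 (lo h S), p.2) (hmem p hp) hu' T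
        simpa [foot_lo] using this
      · have h1 := hΦ' (fun S => p.1 (lo h S), p.2) (hmem p hp) hu' T
        have h2 := hΨ' (slopeArg h p, p.2) (slopeArg_mem h hp) hu' T
        have h3 := slopeArg_mem h hp T
        simp only [foot_slopeArg] at h1 h2 h3
        -- With x and v the feet of the two halves, the new foot is f x + t_k g(x, v, t_k), which
        -- equals f (x + t_k v) by the slope identity at the unit t_k.
        rw [foot_hi, foot_hi, tgtMap_join, foot_add, foot_smul, foot_tgtMap, h1, h2]
        obtain ⟨s, hs⟩ := hu k h.mem
        rw [← hs] at h3 ⊢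
        rw [hgs s _ _ h3, smul_smul]
        simp

/-! ### Limits from invertible parameters and iterated slopes agree. -/

section Existence

variable {K : Type u} [CommRing K] [TopologicalSpace K] [IsTopologicalRing K] {n : ℕ}
  {V W : Type u}
  [AddCommGroup V] [Module K V] [TopologicalSpace V] [IsTopologicalAddGroup V] [ContinuousSMul K V]
  [AddCommGroup W] [Module K W] [TopologicalSpace W] [IsTopologicalAddGroup W] [ContinuousSMul K W]
  {f : V → W} {U : Set V}

theorem CnOn.exists_continuous_hasTan (hf : CnOn K n f U) (hU : IsOpen U) (A : Finset (Fin n)) :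
    ∃ Φ : (Subs A → V) × (Fin n → K) → (Subs A → W),
      ContinuousOn Φ {p | p.1 ∈ extDom p.2 U A} ∧
      ∀ p, p.1 ∈ extDom p.2 U A → HasTan p.2 f p.1 (Φ p) := by
  obtain ⟨Φ, h1, h2⟩ := exists_continuous_feet n hf A (by simpa using A.card_le_univ)
  refine ⟨Φ, h1, fun p hp => ⟨Φ, ?_, ?_⟩⟩
  · exact (h1.continuousAt ((isOpen_extDom hU A).mem_nhds hp)).tendsto.mono_left (tanFilter_le _ _)
  · have : ∀ᶠ q in tanFilter p.2 p.1, q.1 ∈ extDom q.2 U A :=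
      tanFilter_le _ _ ((isOpen_extDom hU A).mem_nhds hp)
    filter_upwards [this, eventually_units p.2 p.1] with q a b
    exact h2 q a b

theorem CnOn.exists_hasTan (hf : CnOn K n f U) (hU : IsOpen U) {t : Fin n → K}
    {A : Finset (Fin n)} {v : Subs A → V} (hv : v ∈ extDom t U A) : ∃ w, HasTan t f v w := by
  obtain ⟨Φ, _, h⟩ := hf.exists_continuous_hasTan hU A
  exact ⟨_, h (v, t) hv⟩

theorem update_eq_on {k : Fin n} {B A : Finset (Fin n)} (h : IsEdge k B A) (t : Fin n → K) (c : K) :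
    ∀ i ∈ B, update t k c i = t i := fun i hi =>
  update_of_ne (by rintro rfl; exact h.1 hi) _ _

theorem mem_join_update {k : Fin n} {B A : Finset (Fin n)} (h : IsEdge k B A) (t : Fin n → K)
    {x v : Subs B → V} {c : K} (hx : (x, v, c) ∈ extOne K (extDom t U B)) :
    join h x v ∈ extDom (update t k c) U A := by
  refine mem_join _ h ?_ ?_
  · rw [extDom_congr (update_eq_on h t c)]; exact hx.1
  · rw [extDom_congr (update_eq_on h t c), update_self]; exact hx.2

theorem join_lo_hi_self {X : Type u} {k : Fin n} {B A : Finset (Fin n)} (h : IsEdge k B A)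
    (v : Subs A → X) : join h (fun S => v (lo h S)) (fun S => v (hi h S)) = v :=
  fam_ext h (by simp) (by simp)

/-- Joint continuity in the parameters is essential: the slope of the map over `B` in the direction
k must be defined for all values c of the parameter. It is read off from the map over B ∪ {k} at the
parameters `t` with t_k replaced by c. -/
theorem exists_isIteratedTangent (hK : Dense {s : K | IsUnit s}) [T2Space W]
    (hf : CnOn K n f U) (hU : IsOpen U) (t : Fin n → K) :
    ∃ F : ∀ A : Finset (Fin n), (Subs A → V) → (Subs A → W),
      IsIteratedTangent t U (fun x => f x) F ∧
      ∀ (A : Finset (Fin n)) (v : Subs A → V), v ∈ extDom t U A → HasTan t f v (F A v) := by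
  choose Φ hc hT using hf.exists_continuous_hasTan hU
  have hT' : ∀ A s v, v ∈ extDom s U A → HasTan s f v (Φ A (v, s)) := fun A s v hv =>
    hT A (v, s) hv
  refine ⟨fun A v => Φ A (v, t), ⟨fun x => ?_, fun k B A h _ => ?_⟩, fun A v => hT' A t v⟩
  · have hx : (fun _ => (x : V)) ∈ extDom t U ∅ := (extDom_empty t U _).2 x.2
    have := fun C => (hT' ∅ t _ hx).foot_eq hK C (by
      rw [foot_of_empty]
      exact hf.continuousOn.continuousAt (hU.mem_nhds x.2))
    funext S
    have hS := this S
    rw [foot_of_empty, foot_of_empty] at hS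
    rw [show S = ⟨∅, subset_rfl⟩ from Subtype.ext (Finset.subset_empty.1 S.2)]
    exact hS
  -- Tangent images over `B` do not depend on the parameter k, so the source and the target of an
  -- image over `A` at the modified parameters are again values of `Φ B` at `t`.
  · have hres : ∀ x c, x ∈ extDom t U B → HasTan (update t k c) f x (Φ B (x, t)) :=
      fun x c hx => (hT' B t x hx).congr_param fun i hi => (update_eq_on h t c i hi).symm
    have hlo : ∀ x v c, (x, v, c) ∈ extOne K (extDom t U B) →
        (fun S => Φ A (join h x v, update t k c) (lo h S)) = Φ B (x, t) := by
      intro x v c hx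
      refine ((hT' A _ _ (mem_join_update h t hx)).src h hK ?_).symm
      simpa using hres x c hx.1
    have hcont : Continuous fun q : (Subs B → V) × (Subs B → V) × K =>
        (join h q.1 q.2.1, update t k q.2.2) :=
      ((continuous_join h).comp (continuous_fst.prodMk (continuous_fst.comp continuous_snd))).prodMk
        (continuous_const.update k (continuous_snd.comp continuous_snd))
    refine ⟨fun q S => Φ A (join h q.1 q.2.1, update t k q.2.2) (hi h S), ⟨?_, ?_⟩, ?_⟩
    · exact (continuous_hi h).comp_continuousOn ((hc A).comp hcont.continuousOn
        fun q hq => mem_join_update h t hq)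
    · intro s x v hx
      -- Compatibility with targets expresses the value at x + s v as the value at x plus s times
      -- the upper half; dividing by s gives the slope identity.
      have h3 : Φ B (x + (s : K) • v, t) = _ :=
        (hT' A _ _ (mem_join_update h t hx)).tgt h hK (by
          rw [tgtMap_join, update_self]; exact hres _ _ hx.2)
      beta_reduce
      rw [h3, ← hlo x v s hx]
      funext S
      simp [tgtMap, smul_smul]
    · intro v hv
      have hq : ((fun S => v (lo h S)), (fun S => v (hi h S)), t k) ∈ extOne K (extDom t U B) :=
        ⟨mem_src t h hv, mem_tgt t h hv⟩
      have h1 := hlo _ _ _ hq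
      simp only [join_lo_hi_self, update_eq_self] at h1 ⊢
      rw [← h1, join_lo_hi_self]

/-- The recursion has only one solution on the extended domains: two continuous slopes of the same
map agree at invertible parameters, hence by density everywhere. So it suffices to know one solution
that consists of tangent images. -/
theorem IsIteratedTangent.hasTan (hK : Dense {s : K | IsUnit s}) [T2Space W]
    (hf : CnOn K n f U) (hU : IsOpen U) {t : Fin n → K}
    {F : ∀ A : Finset (Fin n), (Subs A → V) → (Subs A → W)}
    (hF : IsIteratedTangent t U (fun x => f x) F) :
    ∀ (A : Finset (Fin n)) (v : Subs A → V), v ∈ extDom t U A → HasTan t f v (F A v) := by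
  obtain ⟨G, hG, hG'⟩ := exists_isIteratedTangent hK hf hU t
  suffices H : ∀ (A : Finset (Fin n)) (v : Subs A → V), v ∈ extDom t U A → F A v = G A v by
    intro A v hv
    rw [H A v hv]
    exact hG' A v hv
  intro A
  induction A using Finset.induction_on_max with
  | empty =>
    intro v hv
    have hv' := (extDom_empty t U v).1 hv
    have e : v = fun _ => ((⟨_, hv'⟩ : U) : V) := by
      funext S
      rw [show S = ⟨∅, subset_rfl⟩ from Subtype.ext (Finset.subset_empty.1 S.2)]
    rw [e, hF.1, hG.1]
  | insert k B hk ih =>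
    have h : IsEdge k B (insert k B) := isEdge_insert fun hkB => lt_irrefl _ (hk k hkB)
    obtain ⟨g, ⟨hgc, hgs⟩, hg⟩ := hF.2 k B _ h hk
    obtain ⟨g', ⟨hgc', hgs'⟩, hg'⟩ := hG.2 k B _ h hk
    intro v hv
    have hq : ((fun S => v (lo h S)), (fun S => v (hi h S)), t k) ∈ extOne K (extDom t U B) :=
      ⟨mem_src t h hv, mem_tgt t h hv⟩
    rw [hg v hv, hg' v hv, ih _ hq.1]
    congr 1
    -- Openness of the slope domain guarantees that (x, v, s) stays in it for all s near t_k, so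
    -- that t_k can be approached through units.
    have hD : IsOpen (extDom t U B) := (isOpen_extDom hU B).preimage (Continuous.prodMk_left t)
    have hO : IsOpen (extOne K (extDom t U B)) :=
      (hD.preimage continuous_fst).inter (hD.preimage (by fun_prop))
    have hne : (𝓝[{s : K | IsUnit s}] (t k)).NeBot := mem_closure_iff_nhdsWithin_neBot.1 (hK _)
    have hts : Tendsto (fun s : K => ((fun S => v (lo h S)), (fun S => v (hi h S)), s))
        (𝓝[{s : K | IsUnit s}] (t k))
        (𝓝 ((fun S => v (lo h S)), (fun S => v (hi h S)), t k)) :=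
      ((by fun_prop : Continuous fun s : K =>
        ((fun S => v (lo h S)), (fun S => v (hi h S)), s)).tendsto _).mono_left nhdsWithin_le_nhds
    refine tendsto_nhds_unique_of_eventuallyEq
      ((hgc.continuousAt (hO.mem_nhds hq)).tendsto.comp hts)
      ((hgc'.continuousAt (hO.mem_nhds hq)).tendsto.comp hts) ?_
    filter_upwards [hts (hO.mem_nhds hq), self_mem_nhdsWithin] with s hs hu
    obtain ⟨s, rfl⟩ := hu
    have hs' : ((fun S => v (lo h S)), (fun S => v (hi h S)), (s : K)) ∈
      extOne K (extDom t U B) := hs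
    simp only [comp_apply]
    rw [hgs s _ _ hs', hgs' s _ _ hs', ih _ hs'.1, ih _ hs'.2]

end Existence

/-! ### Gluing n-fold groupoids -/

/-- A relation between the elements of two families of `n`-fold groupoids that is compatible with
the structure maps. -/
structure Respects {n : ℕ} {J J' : Type u} (L : J → NGpd.{u} n) (L' : J' → NGpd.{u} n)
    (r : ∀ A j j', (L j).vertex A → (L' j').vertex A → Prop) : Prop where
  src : ∀ {k : Fin n} {B A : Finset (Fin n)} (h : IsEdge k B A) j j' a a', r A j j' a a' →
    r B j j' (((L j).edge h).src a) (((L' j').edge h).src a')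
  tgt : ∀ {k : Fin n} {B A : Finset (Fin n)} (h : IsEdge k B A) j j' a a', r A j j' a a' →
    r B j j' (((L j).edge h).tgt a) (((L' j').edge h).tgt a')
  one : ∀ {k : Fin n} {B A : Finset (Fin n)} (h : IsEdge k B A) j j' x x', r B j j' x x' →
    r A j j' (((L j).edge h).one x) (((L' j').edge h).one x')
  inv : ∀ {k : Fin n} {B A : Finset (Fin n)} (h : IsEdge k B A) j j' a a', r A j j' a a' →
    r A j j' (((L j).edge h).inv a) (((L' j').edge h).inv a')
  mul : ∀ {k : Fin n} {B A : Finset (Fin n)} (h : IsEdge k B A) j j' a a' b b', r A j j' a a' →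
    r A j j' b b' → ∀ hab hab', r A j j' (((L j).edge h).mul a b hab)
      (((L' j').edge h).mul a' b' hab')

theorem Respects.of_iff {n : ℕ} {J J' : Type u} {L : J → NGpd.{u} n} {L' : J' → NGpd.{u} n}
    {r r' : ∀ A j j', (L j).vertex A → (L' j').vertex A → Prop}
    (h : ∀ A j j' a a', r A j j' a a' ↔ r' A j j' a a') (hr : Respects L L' r') :
    Respects L L' r := by
  have : r = r' := by
    funext A j j' a a'
    exact propext (h A j j' a a')
  rwa [this]

/-- Data for gluing a family of `n`-fold groupoids `L j` along injections `c j` to sets `Q A`: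
up to four elements over the same base point in `P` lie in a common `L j`. -/
structure Gluing (n : ℕ) where
  J : Type u
  L : J → NGpd.{u} n
  Q : Finset (Fin n) → Type u
  c : ∀ j A, (L j).vertex A → Q A
  P : Type u
  p : ∀ A, Q A → P
  inj : ∀ j A, Function.Injective (c j A)
  cover : ∀ A (z : Fin 4 → Q A), (∀ i i', p A (z i) = p A (z i')) → ∃ j, ∀ i, ∃ a, c j A a = z i
  respects : Respects L L fun A j j' a a' => c j A a = c j' A a'
  p_src : ∀ {k : Fin n} {B A : Finset (Fin n)} (h : IsEdge k B A) j a,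
    p B (c j B (((L j).edge h).src a)) = p A (c j A a)
  p_tgt : ∀ {k : Fin n} {B A : Finset (Fin n)} (h : IsEdge k B A) j a,
    p B (c j B (((L j).edge h).tgt a)) = p A (c j A a)

namespace Gluing

variable {n : ℕ} (D : Gluing.{u} n) {k : Fin n} {B A : Finset (Fin n)}

/-- Four elements are needed for the interchange law; the other axioms use at most three. -/
theorem exists_rep₄ {z₁ z₂ z₃ z₄ : D.Q A} (h₂ : D.p A z₁ = D.p A z₂) (h₃ : D.p A z₁ = D.p A z₃)
    (h₄ : D.p A z₁ = D.p A z₄) : ∃ j a₁ a₂ a₃ a₄, D.c j A a₁ = z₁ ∧ D.c j A a₂ = z₂ ∧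
      D.c j A a₃ = z₃ ∧ D.c j A a₄ = z₄ := by
  have key : ∀ i, D.p A (![z₁, z₂, z₃, z₄] i) = D.p A z₁ := by
    intro i; fin_cases i
    exacts [rfl, h₂.symm, h₃.symm, h₄.symm]
  obtain ⟨j, hj⟩ := D.cover A ![z₁, z₂, z₃, z₄] fun i i' => (key i).trans (key i').symm
  obtain ⟨a₁, e₁⟩ := hj 0
  obtain ⟨a₂, e₂⟩ := hj 1
  obtain ⟨a₃, e₃⟩ := hj 2
  obtain ⟨a₄, e₄⟩ := hj 3
  exact ⟨j, a₁, a₂, a₃, a₄, e₁, e₂, e₃, e₄⟩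

theorem exists_rep₃ {z₁ z₂ z₃ : D.Q A} (h₂ : D.p A z₁ = D.p A z₂) (h₃ : D.p A z₁ = D.p A z₃) :
    ∃ j a₁ a₂ a₃, D.c j A a₁ = z₁ ∧ D.c j A a₂ = z₂ ∧ D.c j A a₃ = z₃ := by
  obtain ⟨j, a₁, a₂, a₃, _, e₁, e₂, e₃, _⟩ := D.exists_rep₄ h₂ h₃ rfl
  exact ⟨j, a₁, a₂, a₃, e₁, e₂, e₃⟩

theorem exists_rep₂ {z₁ z₂ : D.Q A} (h₂ : D.p A z₁ = D.p A z₂) :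
    ∃ j a₁ a₂, D.c j A a₁ = z₁ ∧ D.c j A a₂ = z₂ := by
  obtain ⟨j, a₁, a₂, _, e₁, e₂, _⟩ := D.exists_rep₃ h₂ rfl
  exact ⟨j, a₁, a₂, e₁, e₂⟩

theorem exists_rep (z : D.Q A) : ∃ j a, D.c j A a = z := by
  obtain ⟨j, a, _, e, _⟩ := D.exists_rep₂ (z₁ := z) rfl
  exact ⟨j, a, e⟩

variable (h : IsEdge k B A)

noncomputable def src (z : D.Q A) : D.Q B :=
  D.c (D.exists_rep z).choose B (((D.L _).edge h).src (D.exists_rep z).choose_spec.choose)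

noncomputable def tgt (z : D.Q A) : D.Q B :=
  D.c (D.exists_rep z).choose B (((D.L _).edge h).tgt (D.exists_rep z).choose_spec.choose)

noncomputable def one (z : D.Q B) : D.Q A :=
  D.c (D.exists_rep z).choose A (((D.L _).edge h).one (D.exists_rep z).choose_spec.choose)

noncomputable def inv (z : D.Q A) : D.Q A :=
  D.c (D.exists_rep z).choose A (((D.L _).edge h).inv (D.exists_rep z).choose_spec.choose)

/-- The operations are defined by chosen representatives; compatibility of the identifications with
the structure maps makes the choice immaterial. -/
theorem src_c (j : D.J) (a : (D.L j).vertex A) :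
    D.src h (D.c j A a) = D.c j B (((D.L j).edge h).src a) :=
  D.respects.src h _ _ _ _ (D.exists_rep (D.c j A a)).choose_spec.choose_spec

theorem tgt_c (j : D.J) (a : (D.L j).vertex A) :
    D.tgt h (D.c j A a) = D.c j B (((D.L j).edge h).tgt a) :=
  D.respects.tgt h _ _ _ _ (D.exists_rep (D.c j A a)).choose_spec.choose_spec

theorem one_c (j : D.J) (x : (D.L j).vertex B) :
    D.one h (D.c j B x) = D.c j A (((D.L j).edge h).one x) :=
  D.respects.one h _ _ _ _ (D.exists_rep (D.c j B x)).choose_spec.choose_spec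

theorem inv_c (j : D.J) (a : (D.L j).vertex A) :
    D.inv h (D.c j A a) = D.c j A (((D.L j).edge h).inv a) :=
  D.respects.inv h _ _ _ _ (D.exists_rep (D.c j A a)).choose_spec.choose_spec

/-- Sources and targets preserve the base point, so composable elements lie over the same point, and
thus in a common piece. -/
theorem p_eq {z z' : D.Q A} (e : D.src h z = D.tgt h z') : D.p A z = D.p A z' := by
  obtain ⟨j, a, rfl⟩ := D.exists_rep z
  obtain ⟨j', a', rfl⟩ := D.exists_rep z'
  rw [src_c, tgt_c] at e
  rw [← D.p_src h, e, D.p_tgt]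

theorem composable {j : D.J} {a a' : (D.L j).vertex A}
    (e : D.src h (D.c j A a) = D.tgt h (D.c j A a')) :
    ((D.L j).edge h).src a = ((D.L j).edge h).tgt a' := by
  rw [src_c, tgt_c] at e
  exact D.inj j B e

theorem exists_composable {z z' : D.Q A} (e : D.src h z = D.tgt h z') :
    ∃ j, ∃ q : {q : (D.L j).vertex A × (D.L j).vertex A //
      ((D.L j).edge h).src q.1 = ((D.L j).edge h).tgt q.2},
      D.c j A q.1.1 = z ∧ D.c j A q.1.2 = z' := by
  obtain ⟨j, a, a', rfl, rfl⟩ := D.exists_rep₂ (D.p_eq h e)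
  exact ⟨j, ⟨(a, a'), D.composable h e⟩, rfl, rfl⟩

noncomputable def mul (z z' : D.Q A) (e : D.src h z = D.tgt h z') : D.Q A :=
  D.c (D.exists_composable h e).choose A (((D.L _).edge h).mul _ _
    (D.exists_composable h e).choose_spec.choose.2)

theorem mul_c {j : D.J} {a a' : (D.L j).vertex A} (e) (e') :
    D.mul h (D.c j A a) (D.c j A a') e = D.c j A (((D.L j).edge h).mul a a' e') := by
  have := (D.exists_composable h e).choose_spec.choose_spec
  exact D.respects.mul h _ _ _ _ _ _ this.1 this.2 _ _

/-- The groupoid glued from the groupoids of an edge. -/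
noncomputable def gpd : Gpd (D.Q A) (D.Q B) where
  src := D.src h
  tgt := D.tgt h
  one := D.one h
  inv := D.inv h
  mul := D.mul h
  src_mul z z' e := by
    obtain ⟨j, ⟨⟨a, a'⟩, hq⟩, rfl, rfl⟩ := D.exists_composable h e
    simp only [D.mul_c h e hq, src_c, ((D.L j).edge h).src_mul]
  tgt_mul z z' e := by
    obtain ⟨j, ⟨⟨a, a'⟩, hq⟩, rfl, rfl⟩ := D.exists_composable h e
    simp only [D.mul_c h e hq, tgt_c, ((D.L j).edge h).tgt_mul]
  mul_assoc x y z hxy hyz := by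
    obtain ⟨j, a, b, c, rfl, rfl, rfl⟩ :=
      D.exists_rep₃ (D.p_eq h hxy) ((D.p_eq h hxy).trans (D.p_eq h hyz))
    have hab := D.composable h hxy
    have hbc := D.composable h hyz
    simp only [D.mul_c h _ hab, D.mul_c h _ hbc]
    rw [D.mul_c h _ ((((D.L j).edge h).src_mul a b hab).trans hbc),
      D.mul_c h _ (hab.trans (((D.L j).edge h).tgt_mul b c hbc).symm), Gpd.mul_assoc]
  src_one x := by
    obtain ⟨j, a, rfl⟩ := D.exists_rep x
    rw [one_c, src_c, Gpd.src_one]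
  tgt_one x := by
    obtain ⟨j, a, rfl⟩ := D.exists_rep x
    rw [one_c, tgt_c, Gpd.tgt_one]
  mul_one z := by
    obtain ⟨j, a, rfl⟩ := D.exists_rep z
    simp only [src_c, one_c]
    rw [D.mul_c h _ (((D.L j).edge h).tgt_one _).symm, Gpd.mul_one]
  one_mul z := by
    obtain ⟨j, a, rfl⟩ := D.exists_rep z
    simp only [tgt_c, one_c]
    rw [D.mul_c h _ (((D.L j).edge h).src_one _), Gpd.one_mul]
  src_inv z := by
    obtain ⟨j, a, rfl⟩ := D.exists_rep z
    rw [inv_c, src_c, tgt_c, Gpd.src_inv]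
  tgt_inv z := by
    obtain ⟨j, a, rfl⟩ := D.exists_rep z
    rw [inv_c, src_c, tgt_c, Gpd.tgt_inv]
  mul_inv z := by
    obtain ⟨j, a, rfl⟩ := D.exists_rep z
    simp only [tgt_c, one_c, inv_c]
    rw [D.mul_c h _ (((D.L j).edge h).tgt_inv _).symm, Gpd.mul_inv]
  inv_mul z := by
    obtain ⟨j, a, rfl⟩ := D.exists_rep z
    simp only [src_c, one_c, inv_c]
    rw [D.mul_c h _ (((D.L j).edge h).src_inv _), Gpd.inv_mul]

theorem mul_eq {z z' : D.Q A} (e : (D.gpd h).src z = (D.gpd h).tgt z') {j : D.J}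
    {a a' : (D.L j).vertex A} (ha : D.c j A a = z) (ha' : D.c j A a' = z') (e') :
    (D.gpd h).mul z z' e = D.c j A (((D.L j).edge h).mul a a' e') := by
  subst ha ha'
  exact D.mul_c h e e'

variable {D} in
-- Each functor identity involves at most one composable pair, which has representatives in a single
-- piece.
theorem isFunctor_of_local {k : Fin n} {B A B' A' : Finset (Fin n)}
    {h : IsEdge k B A} {h' : IsEdge k B' A'} {f₁ : D.Q A → D.Q A'} {f₀ : D.Q B → D.Q B'}
    {g₁ : ∀ j, (D.L j).vertex A → (D.L j).vertex A'}
    {g₀ : ∀ j, (D.L j).vertex B → (D.L j).vertex B'}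
    (hf₁ : ∀ j a, f₁ (D.c j A a) = D.c j A' (g₁ j a))
    (hf₀ : ∀ j x, f₀ (D.c j B x) = D.c j B' (g₀ j x))
    (hg : ∀ j, IsFunctor ((D.L j).edge h) ((D.L j).edge h') (g₁ j) (g₀ j)) :
    IsFunctor (D.gpd h) (D.gpd h') f₁ f₀ where
  map_src z := by
    obtain ⟨j, a, rfl⟩ := D.exists_rep z
    change D.src h' _ = f₀ (D.src h _)
    rw [hf₁, src_c, src_c, hf₀, (hg j).map_src]
  map_tgt z := by
    obtain ⟨j, a, rfl⟩ := D.exists_rep z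
    change D.tgt h' _ = f₀ (D.tgt h _)
    rw [hf₁, tgt_c, tgt_c, hf₀, (hg j).map_tgt]
  map_one z := by
    obtain ⟨j, a, rfl⟩ := D.exists_rep z
    change f₁ (D.one h _) = D.one h' _
    rw [hf₀, one_c, one_c, hf₁, (hg j).map_one]
  map_mul z₁ z₂ e := by
    obtain ⟨j, ⟨⟨a, a'⟩, hq⟩, rfl, rfl⟩ := D.exists_composable h e
    have hq' := ((hg j).map_src a).trans ((congrArg (g₀ j) hq).trans ((hg j).map_tgt a').symm)
    rw [D.mul_eq h e rfl rfl hq, hf₁, (hg j).map_mul a a' hq]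
    exact (D.mul_eq h' _ (hf₁ j a).symm (hf₁ j a').symm hq').symm

/-- The glued `n`-fold groupoid. -/
noncomputable def ngpd : NGpd.{u} n where
  vertex := D.Q
  edge h := D.gpd h
  face {k l D₀ B C A} hDC hBA hDB hCA :=
    { src_h := isFunctor_of_local (D.src_c hCA) (D.src_c hDB)
        fun j => ((D.L j).face hDC hBA hDB hCA).src_h
      tgt_h := isFunctor_of_local (D.tgt_c hCA) (D.tgt_c hDB)
        fun j => ((D.L j).face hDC hBA hDB hCA).tgt_h
      one_h := isFunctor_of_local (D.one_c hCA) (D.one_c hDB)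
        fun j => ((D.L j).face hDC hBA hDB hCA).one_h
      src_v := isFunctor_of_local (D.src_c hBA) (D.src_c hDC)
        fun j => ((D.L j).face hDC hBA hDB hCA).src_v
      tgt_v := isFunctor_of_local (D.tgt_c hBA) (D.tgt_c hDC)
        fun j => ((D.L j).face hDC hBA hDB hCA).tgt_v
      one_v := isFunctor_of_local (D.one_c hBA) (D.one_c hDC)
        fun j => ((D.L j).face hDC hBA hDB hCA).one_v
      interchange := by
        intro z₁ z₂ z₃ z₄ h₁₂ h₃₄ h₁₃ h₂₄ e₁ e₂
        obtain ⟨j, a, b, c, d, rfl, rfl, rfl, rfl⟩ := D.exists_rep₄ (D.p_eq hCA h₁₂)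
          (D.p_eq hBA h₁₃) ((D.p_eq hCA h₁₂).trans (D.p_eq hBA h₂₄))
        have k₁₂ := D.composable hCA h₁₂
        have k₃₄ := D.composable hCA h₃₄
        have k₁₃ := D.composable hBA h₁₃
        have k₂₄ := D.composable hBA h₂₄
        have E₁ := D.mul_eq hCA h₁₂ rfl rfl k₁₂
        have E₂ := D.mul_eq hCA h₃₄ rfl rfl k₃₄
        have E₃ := D.mul_eq hBA h₁₃ rfl rfl k₁₃
        have E₄ := D.mul_eq hBA h₂₄ rfl rfl k₂₄
        -- Copies are rewritten into conditions within one piece; the goal depends on the original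
        -- proofs.
        have e₁' := e₁
        have e₂' := e₂
        rw [E₁, E₂] at e₁'
        rw [E₃, E₄] at e₂'
        refine (D.mul_eq hBA e₁ E₁.symm E₂.symm (D.composable hBA e₁')).trans
          (Eq.trans (congrArg _ ?_)
            (D.mul_eq hCA e₂ E₃.symm E₄.symm (D.composable hCA e₂')).symm)
        exact ((D.L j).face hDC hBA hDB hCA).interchange a b c d k₁₂ k₃₄ k₁₃ k₂₄ _ _ }

/-- A map between glued `n`-fold groupoids that respects the structure maps in the given pieces
is a morphism. -/
noncomputable def hom {D D' : Gluing.{u} n} (f : ∀ A, D.Q A → D'.Q A)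
    (hp : ∀ A z z', D.p A z = D.p A z' → D'.p A (f A z) = D'.p A (f A z'))
    (hr : Respects D.L D'.L fun A j j' a a' => f A (D.c j A a) = D'.c j' A a') :
    Hom D.ngpd D'.ngpd where
  map := f
  isFunctor {k B A} h :=
    { map_src := fun z => by
        obtain ⟨j, a, rfl⟩ := D.exists_rep z
        obtain ⟨j', a', e⟩ := D'.exists_rep (f A (D.c j A a))
        change D'.src h _ = f B (D.src h _)
        rw [← e, src_c, src_c, hr.src h j j' a a' e.symm]
      map_tgt := fun z => by
        obtain ⟨j, a, rfl⟩ := D.exists_rep z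
        obtain ⟨j', a', e⟩ := D'.exists_rep (f A (D.c j A a))
        change D'.tgt h _ = f B (D.tgt h _)
        rw [← e, tgt_c, tgt_c, hr.tgt h j j' a a' e.symm]
      map_one := fun z => by
        obtain ⟨j, a, rfl⟩ := D.exists_rep z
        obtain ⟨j', a', e⟩ := D'.exists_rep (f B (D.c j B a))
        change f A (D.one h _) = D'.one h _
        rw [← e, one_c, one_c, hr.one h j j' a a' e.symm]
      map_mul := fun z₁ z₂ e => by
        obtain ⟨j, ⟨⟨a, b⟩, hq⟩, rfl, rfl⟩ := D.exists_composable h e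
        -- The images again lie over one point by `hp`, so they have representatives in a common
        -- piece of the target, where they can be multiplied.
        obtain ⟨j', a', b', e₁, e₂⟩ := D'.exists_rep₂ (hp A _ _ (D.p_eq h e))
        have hq' : ((D'.L j').edge h).src a' = ((D'.L j').edge h).tgt b' := by
          apply D'.inj j' B
          rw [← hr.src h j j' a a' e₁.symm, ← hr.tgt h j j' b b' e₂.symm, hq]
        refine (congrArg (f A) (D.mul_eq h e rfl rfl hq)).trans ?_
        exact (hr.mul h j j' a a' b b' e₁.symm e₂.symm hq hq').trans
          (D'.mul_eq h _ e₁ e₂ hq').symm }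

end Gluing

/-! ### Iterated tangent maps in charts -/

section Chart

variable {K : Type u} [CommRing K] [TopologicalSpace K] [IsTopologicalRing K] {n : ℕ}
  {t : Fin n → K} {X Y Z : CnManifold K n} {f : X.carrier → Y.carrier} {g : Y.carrier → Z.carrier}
  {A : Finset (Fin n)}

/-- The domain of the map `ψ ∘ f ∘ φ⁻¹`. -/
def chartDom (f : X.carrier → Y.carrier) (φ : X.atlas) (ψ : Y.atlas) : Set X.model :=
  φ.1.target ∩ φ.1.symm ⁻¹' (f ⁻¹' ψ.1.source)

/-- `b` is the image of `a` under the iterated tangent map of `f`, written in charts. -/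
def ChartTan (t : Fin n → K) (f : X.carrier → Y.carrier) (A : Finset (Fin n)) (φ : X.atlas)
    (ψ : Y.atlas) (a : extDom t φ.1.target A) (b : extDom t ψ.1.target A) : Prop :=
  a.1 ∈ extDom t (chartDom f φ ψ) A ∧ HasTan t (fun v => ψ.1 (f (φ.1.symm v))) a.1 b.1

theorem isOpen_chartDom (hf : Continuous f) (φ : X.atlas) (ψ : Y.atlas) :
    IsOpen (chartDom f φ ψ) :=
  φ.1.symm.isOpen_inter_preimage (ψ.1.open_source.preimage hf)

theorem IsCnMap.cnOn (hf : IsCnMap X Y f) (φ : X.atlas) (ψ : Y.atlas) :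
    CnOn K n (fun v => ψ.1 (f (φ.1.symm v))) (chartDom f φ ψ) :=
  hf.2 φ.1 φ.2 ψ.1 ψ.2

theorem isCnMap_id (X : CnManifold K n) : IsCnMap X X id :=
  ⟨continuous_id, X.compatible⟩

theorem ChartTan.foot_eq (hK : Dense {s : K | IsUnit s}) (hf : IsCnMap X Y f) {φ : X.atlas}
    {ψ : Y.atlas} {a : extDom t φ.1.target A} {b : extDom t ψ.1.target A}
    (h : ChartTan t f A φ ψ a b) (C : Subs A) :
    foot t C b.1 = ψ.1 (f (φ.1.symm (foot t C a.1))) :=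
  h.2.foot_eq hK C ((hf.cnOn φ ψ).continuousOn.continuousAt
    ((isOpen_chartDom hf.1 φ ψ).mem_nhds (h.1 C)))

theorem ChartTan.symm_foot_eq (hK : Dense {s : K | IsUnit s}) (hf : IsCnMap X Y f) {φ : X.atlas}
    {ψ : Y.atlas} {a : extDom t φ.1.target A} {b : extDom t ψ.1.target A}
    (h : ChartTan t f A φ ψ a b) (C : Subs A) :
    ψ.1.symm (foot t C b.1) = f (φ.1.symm (foot t C a.1)) := by
  rw [h.foot_eq hK hf, ψ.1.left_inv (h.1 C).2]

theorem ChartTan.unique (hK : Dense {s : K | IsUnit s}) {φ : X.atlas}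
    {ψ : Y.atlas} {a : extDom t φ.1.target A} {b b' : extDom t ψ.1.target A}
    (h : ChartTan t f A φ ψ a b) (h' : ChartTan t f A φ ψ a b') : b = b' :=
  Subtype.ext (h.2.unique hK h'.2)

theorem exists_chartTan (hK : Dense {s : K | IsUnit s}) (hf : IsCnMap X Y f) (φ : X.atlas)
    (ψ : Y.atlas) (a : extDom t φ.1.target A)
    (ha : ∀ C, f (φ.1.symm (foot t C a.1)) ∈ ψ.1.source) :
    ∃ b, ChartTan t f A φ ψ a b := by
  have ha' : a.1 ∈ extDom t (chartDom f φ ψ) A := fun C => ⟨a.2 C, ha C⟩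
  obtain ⟨w, hw⟩ := (hf.cnOn φ ψ).exists_hasTan (isOpen_chartDom hf.1 φ ψ) ha'
  refine ⟨⟨w, fun C => ?_⟩, ha', hw⟩
  rw [hw.foot_eq hK C ((hf.cnOn φ ψ).continuousOn.continuousAt
    ((isOpen_chartDom hf.1 φ ψ).mem_nhds (ha' C)))]
  exact ψ.1.map_source (ha C)

theorem ChartTan.comp (hK : Dense {s : K | IsUnit s}) (hf : IsCnMap X Y f) {φ : X.atlas}
    {ψ : Y.atlas} {χ : Z.atlas} {a : extDom t φ.1.target A} {b : extDom t ψ.1.target A}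
    {c : extDom t χ.1.target A} (hab : ChartTan t f A φ ψ a b) (hbc : ChartTan t g A ψ χ b c) :
    ChartTan t (g ∘ f) A φ χ a c := by
  refine ⟨fun C => ⟨a.2 C, ?_⟩, ?_⟩
  · have := (hbc.1 C).2
    rw [mem_preimage, hab.symm_foot_eq hK hf] at this
    exact this
  · refine (hbc.2.comp hab.2).congr (isOpen_chartDom hf.1 φ ψ) hab.1 fun v hv => ?_
    simp only [comp_apply]
    rw [ψ.1.left_inv hv.2]

theorem ChartTan.refl (φ : X.atlas) (a : extDom t φ.1.target A) : ChartTan t id A φ φ a a := by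
  refine ⟨fun C => ⟨a.2 C, φ.1.map_target (a.2 C)⟩, ?_⟩
  exact (HasTan.refl t a.1).congr φ.1.open_target a.2 fun v hv => φ.1.right_inv hv

/-- The feet of `b` lie over those of `a`, so `b` has an image in φ. The composite belongs to the
identity of φ, and uniqueness forces this image to be `a`. -/
theorem ChartTan.symm (hK : Dense {s : K | IsUnit s}) {φ ψ : X.atlas}
    {a : extDom t φ.1.target A} {b : extDom t ψ.1.target A} (h : ChartTan t id A φ ψ a b) :
    ChartTan t id A ψ φ b a := by
  obtain ⟨a', ha'⟩ := exists_chartTan hK (isCnMap_id X) ψ φ b fun C => by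
    rw [h.symm_foot_eq hK (isCnMap_id X)]
    exact φ.1.map_target (a.2 C)
  rwa [← (h.comp hK (isCnMap_id X) ha').unique hK (ChartTan.refl φ a)]

/-- Each structure map leads to an element of the extended domain, which has a tangent image by
class C^n; the compatibility lemmas for `HasTan` compute this image. -/
theorem respects_chartTan (hK : Dense {s : K | IsUnit s}) (hf : IsCnMap X Y f) (t : Fin n → K) :
    Respects (fun φ : X.atlas => localNGpd t φ.1.target)
      (fun ψ : Y.atlas => localNGpd t ψ.1.target)
      fun A φ ψ a b => ChartTan t f A φ ψ a b := by
  have ex : ∀ {A : Finset (Fin n)} {φ : X.atlas} {ψ : Y.atlas} {v : Subs A → X.model},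
      v ∈ extDom t (chartDom f φ ψ) A → ∃ w, HasTan t (fun v => ψ.1 (f (φ.1.symm v))) v w :=
    fun hv => (hf.cnOn _ _).exists_hasTan (isOpen_chartDom hf.1 _ _) hv
  refine ⟨?_, ?_, ?_, ?_, ?_⟩
  · intro k B A h φ ψ a b hab
    have hm := mem_src t h hab.1
    obtain ⟨y, hy⟩ := ex hm
    obtain rfl := hab.2.src h hK hy
    exact ⟨hm, hy⟩
  · intro k B A h φ ψ a b hab
    have hm := mem_tgt t h hab.1
    obtain ⟨y, hy⟩ := ex hm
    obtain rfl := hab.2.tgt h hK hy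
    exact ⟨hm, hy⟩
  · intro k B A h φ ψ a b hab
    -- Membership holds because the extended domains of the open set `chartDom f φ ψ` form a
    -- groupoid of their own.
    have hm := ((localGpd t h (chartDom f φ ψ)).one ⟨a.1, hab.1⟩).2
    obtain ⟨y, hy⟩ := ex hm
    obtain rfl := hab.2.one h hK hy
    exact ⟨hm, hy⟩
  · intro k B A h φ ψ a b hab
    have hm := ((localGpd t h (chartDom f φ ψ)).inv ⟨a.1, hab.1⟩).2
    obtain ⟨y, hy⟩ := ex hm
    obtain rfl := hab.2.inv h hK hy
    exact ⟨hm, hy⟩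
  · intro k B A h φ ψ a a' b b' ha hb hab hab'
    have hab₀ := congrArg Subtype.val hab
    have hm := ((localGpd t h (chartDom f φ ψ)).mul ⟨a.1, ha.1⟩ ⟨b.1, hb.1⟩
      (Subtype.ext hab₀)).2
    obtain ⟨y, hy⟩ := ex hm
    obtain rfl := ha.2.mul h hK hb.2 hab₀ hy
    exact ⟨hm, hy⟩

/-- Since all iterated tangent families of a transition map consist of tangent images, the
existential quantifier over such families disappears. -/
theorem glueRel_iff (hK : Dense {s : K | IsUnit s}) (a b : Σ φ : X.atlas, extDom t φ.1.target A) :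
    GlueRel t X A a b ↔ ChartTan t id A a.1 b.1 a.2 b.2 := by
  have hc := (isCnMap_id X).cnOn a.1 b.1
  have ho := isOpen_chartDom (f := id) continuous_id a.1 b.1
  constructor
  · rintro ⟨ha, F, hF, hb⟩
    refine ⟨ha, ?_⟩
    rw [hb]
    exact IsIteratedTangent.hasTan hK hc ho hF A _ ha
  · rintro ⟨ha, hab⟩
    obtain ⟨F, hF, hT⟩ := exists_isIteratedTangent hK hc ho t
    exact ⟨ha, F, hF, hab.unique hK (hT A _ ha)⟩

theorem equivalence_glueRel (hK : Dense {s : K | IsUnit s}) (t : Fin n → K) (X : CnManifold K n)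
    (A : Finset (Fin n)) : Equivalence (GlueRel t X A) where
  refl a := (glueRel_iff hK a a).2 (ChartTan.refl _ _)
  symm h := (glueRel_iff hK _ _).2 (((glueRel_iff hK _ _).1 h).symm hK)
  trans h h' := (glueRel_iff hK _ _).2
    (((glueRel_iff hK _ _).1 h).comp hK (isCnMap_id X) ((glueRel_iff hK _ _).1 h'))

/-- The element of the glued set represented by an element of the local construction for the range
of a chart. -/
def glueMk (t : Fin n → K) (X : CnManifold K n) (φ : X.atlas) (A : Finset (Fin n))
    (a : extDom t φ.1.target A) : Glued t X A := Quot.mk _ ⟨φ, a⟩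

/-- The gluing relation is already an equivalence relation, so no chains of charts occur in the
quotient. -/
theorem glueMk_eq_iff (hK : Dense {s : K | IsUnit s}) {φ ψ : X.atlas}
    {a : extDom t φ.1.target A} {b : extDom t ψ.1.target A} :
    glueMk t X φ A a = glueMk t X ψ A b ↔ ChartTan t id A φ ψ a b := by
  rw [← glueRel_iff hK ⟨φ, a⟩ ⟨ψ, b⟩]
  exact ⟨fun h => ((equivalence_glueRel hK t X A).eqvGen_iff).1 (Quot.eqvGen_exact h), Quot.sound⟩

theorem glueMk_injective (hK : Dense {s : K | IsUnit s}) (φ : X.atlas) :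
    Injective (glueMk t X φ A) := fun a _ h =>
  (ChartTan.refl φ a).unique hK ((glueMk_eq_iff hK).1 h)

theorem exists_glueMk (z : Glued t X A) : ∃ φ a, glueMk t X φ A a = z := by
  obtain ⟨⟨φ, a⟩, rfl⟩ := Quot.exists_rep z
  exact ⟨φ, a, rfl⟩

/-- The points of `X` under an element of the glued set at `A`. -/
noncomputable def anchor (z : Glued t X A) (C : Subs A) : X.carrier :=
  (exists_glueMk z).choose.1.symm (foot t C (exists_glueMk z).choose_spec.choose.1)

theorem anchor_glueMk (hK : Dense {s : K | IsUnit s}) (φ : X.atlas) (a : extDom t φ.1.target A)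
    (C : Subs A) : anchor (glueMk t X φ A a) C = φ.1.symm (foot t C a.1) := by
  have := (exists_glueMk (glueMk t X φ A a)).choose_spec.choose_spec
  rw [glueMk_eq_iff hK] at this
  exact (this.symm_foot_eq hK (isCnMap_id X) C).symm

/-- The only obstruction to representing an element in a given chart is the position of its feet. -/
theorem exists_glueMk_eq (hK : Dense {s : K | IsUnit s}) (z : Glued t X A) (φ : X.atlas)
    (hφ : ∀ C, anchor z C ∈ φ.1.source) : ∃ a, glueMk t X φ A a = z := by
  obtain ⟨ψ, b, rfl⟩ := exists_glueMk z
  obtain ⟨a, ha⟩ := exists_chartTan hK (isCnMap_id X) ψ φ b fun C => by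
    have := hφ C
    rwa [anchor_glueMk hK] at this
  exact ⟨a, ((glueMk_eq_iff hK).2 ha).symm⟩

theorem foot_zero (C : Subs A) {V : Type u} [AddCommGroup V] [Module K V] (v : Subs A → V) :
    foot (0 : Fin n → K) C v = v ⟨∅, Finset.empty_subset A⟩ := by
  unfold foot
  rw [Fintype.sum_eq_single ⟨∅, Finset.empty_subset A⟩]
  · simp
  · intro S hS
    obtain ⟨i, hi⟩ := Finset.nonempty_iff_ne_empty.2 fun h => hS (Subtype.ext h)
    split_ifs
    · rw [Finset.prod_eq_zero hi rfl, zero_smul]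
    · rfl

theorem anchor_zero (hK : Dense {s : K | IsUnit s}) (ht : t = 0) (z : Glued t X A) (C : Subs A) :
    anchor z C = anchor z ⟨∅, Finset.empty_subset A⟩ := by
  subst ht
  obtain ⟨φ, a, rfl⟩ := exists_glueMk z
  rw [anchor_glueMk hK, anchor_glueMk hK, foot_zero, foot_zero]

/-- Each finite set of points under an element of a glued set lies in a chart domain. -/
def EnoughCharts (t : Fin n → K) (X : CnManifold K n) : Prop :=
  ∀ s : Set X.carrier, s.Finite → s.Nonempty → (t = 0 → s.Subsingleton) →
    ∃ φ ∈ X.atlas, s ⊆ φ.source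

/-- The gluing of the local constructions for the ranges of the charts of `X`. -/
noncomputable def chartGluing (hK : Dense {s : K | IsUnit s}) (t : Fin n → K) (X : CnManifold K n)
    (hX : EnoughCharts t X) : Gluing.{u} n where
  J := X.atlas
  L φ := localNGpd t φ.1.target
  Q := Glued t X
  c := glueMk t X
  -- For t = 0 this amounts to the base point. For t ≠ 0 it has a single element, so nothing is
  -- required of the elements to be covered: then finite sets of arbitrary points lie in charts.
  P := t = 0 → X.carrier
  p A z _ := anchor z ⟨∅, Finset.empty_subset A⟩
  inj φ A := glueMk_injective hK φ
  cover A z hz := by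
    obtain ⟨φ, hφ, hs⟩ := hX (⋃ i, range (anchor (z i))) (finite_iUnion fun i => finite_range _)
      ⟨_, mem_iUnion.2 ⟨0, ⟨⟨∅, Finset.empty_subset A⟩, rfl⟩⟩⟩ (by
        intro ht x hx y hy
        obtain ⟨i, C, rfl⟩ := mem_iUnion.1 hx
        obtain ⟨j, D, rfl⟩ := mem_iUnion.1 hy
        rw [anchor_zero hK ht, anchor_zero hK ht (z j)]
        exact congrFun (hz i j) ht)
    exact ⟨⟨φ, hφ⟩, fun i => exists_glueMk_eq hK _ _ fun C => hs (mem_iUnion.2 ⟨i, C, rfl⟩)⟩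
  respects := (respects_chartTan hK (isCnMap_id X) t).of_iff fun _ _ _ _ _ => glueMk_eq_iff hK
  p_src {k B A} h φ a := by
    funext _
    refine (anchor_glueMk hK φ _ _).trans (Eq.trans ?_ (anchor_glueMk hK φ a _).symm)
    exact congrArg φ.1.symm (foot_lo t h ⟨∅, Finset.empty_subset B⟩ a.1).symm
  p_tgt {k B A} h φ a := by
    funext ht
    refine (anchor_glueMk hK φ _ _).trans (Eq.trans ?_ ((anchor_glueMk hK φ a _).symm.trans
      (anchor_zero hK ht (glueMk t X φ A a) (hi h ⟨∅, Finset.empty_subset B⟩))))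
    exact congrArg φ.1.symm (foot_hi t h ⟨∅, Finset.empty_subset B⟩ a.1).symm

/-- The image is constructed in one chart around the images of all feet, a single point if t = 0.
The characterisation in arbitrary charts then follows by composing with transition maps and by
uniqueness. -/
theorem exists_tangentMap (hK : Dense {s : K | IsUnit s}) (hY : EnoughCharts t Y)
    (hf : IsCnMap X Y f) (z : Glued t X A) :
    ∃ y : Glued t Y A, ∀ φ ψ a b, z = glueMk t X φ A a →
      (y = glueMk t Y ψ A b ↔ ChartTan t f A φ ψ a b) := by
  obtain ⟨φ₀, a₀, rfl⟩ := exists_glueMk z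
  obtain ⟨ψ₀, hψ₀, hs⟩ := hY (range fun C => f (φ₀.1.symm (foot t C a₀.1))) (finite_range _)
    ⟨_, ⟨⟨∅, Finset.empty_subset A⟩, rfl⟩⟩ (by
      rintro rfl x ⟨C, rfl⟩ y ⟨D, rfl⟩
      simp only [foot_zero])
  obtain ⟨b₀, hb₀⟩ := exists_chartTan hK hf φ₀ ⟨ψ₀, hψ₀⟩ a₀ fun C => hs ⟨C, rfl⟩
  refine ⟨glueMk t Y ⟨ψ₀, hψ₀⟩ A b₀, fun φ ψ a b e => ?_⟩
  rw [glueMk_eq_iff hK] at e ⊢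
  constructor
  · exact fun h => ((e.symm hK).comp hK (isCnMap_id X) hb₀).comp hK hf h
  · intro h
    have h' : ChartTan t f A φ₀ ψ a₀ b := e.comp hK (isCnMap_id X) h
    -- The feet of `b₀` and of `b` are the same points of Y, so `b₀` can be transported to ψ; the
    -- result must be `b`.
    obtain ⟨b₁, hb₁⟩ := exists_chartTan hK (isCnMap_id Y) ⟨ψ₀, hψ₀⟩ ψ b₀ fun C => by
      rw [hb₀.symm_foot_eq hK hf]
      exact (h'.1 C).2
    rwa [h'.unique hK (hb₀.comp hK hf hb₁)]

/-- The iterated tangent map of a map between manifolds. -/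
noncomputable def tangentMap (hK : Dense {s : K | IsUnit s}) (hY : EnoughCharts t Y)
    (hf : IsCnMap X Y f) (A : Finset (Fin n)) (z : Glued t X A) : Glued t Y A :=
  (exists_tangentMap hK hY hf z).choose

theorem tangentMap_glueMk (hK : Dense {s : K | IsUnit s}) (hY : EnoughCharts t Y)
    (hf : IsCnMap X Y f) {φ : X.atlas} {ψ : Y.atlas} {a : extDom t φ.1.target A}
    {b : extDom t ψ.1.target A} :
    tangentMap hK hY hf A (glueMk t X φ A a) = glueMk t Y ψ A b ↔ ChartTan t f A φ ψ a b :=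
  (exists_tangentMap hK hY hf (glueMk t X φ A a)).choose_spec φ ψ a b rfl

theorem exists_chartTan_glueMk (hK : Dense {s : K | IsUnit s}) (hY : EnoughCharts t Y)
    (hf : IsCnMap X Y f) (z : Glued t X A) : ∃ φ a ψ b, z = glueMk t X φ A a ∧
      tangentMap hK hY hf A z = glueMk t Y ψ A b ∧ ChartTan t f A φ ψ a b := by
  obtain ⟨φ, a, rfl⟩ := exists_glueMk z
  obtain ⟨ψ, b, e⟩ := exists_glueMk (tangentMap hK hY hf A (glueMk t X φ A a))
  exact ⟨φ, a, ψ, b, rfl, e.symm, (tangentMap_glueMk hK hY hf).1 e.symm⟩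

theorem anchor_tangentMap (hK : Dense {s : K | IsUnit s}) (hY : EnoughCharts t Y)
    (hf : IsCnMap X Y f) (z : Glued t X A) (C : Subs A) :
    anchor (tangentMap hK hY hf A z) C = f (anchor z C) := by
  obtain ⟨φ, a, ψ, b, rfl, e, h⟩ := exists_chartTan_glueMk hK hY hf z
  rw [e, anchor_glueMk hK, anchor_glueMk hK, h.symm_foot_eq hK hf]

theorem tangentMap_id (hK : Dense {s : K | IsUnit s}) (hX : EnoughCharts t X)
    (h : IsCnMap X X id) (z : Glued t X A) : tangentMap hK hX h A z = z := by
  obtain ⟨φ, a, rfl⟩ := exists_glueMk z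
  exact (tangentMap_glueMk hK hX h).2 (ChartTan.refl φ a)

theorem tangentMap_comp (hK : Dense {s : K | IsUnit s}) (hY : EnoughCharts t Y)
    (hZ : EnoughCharts t Z) (hf : IsCnMap X Y f) (hg : IsCnMap Y Z g) (hgf : IsCnMap X Z (g ∘ f))
    (z : Glued t X A) :
    tangentMap hK hZ hgf A z = tangentMap hK hZ hg A (tangentMap hK hY hf A z) := by
  obtain ⟨φ, a, ψ, b, rfl, e, h⟩ := exists_chartTan_glueMk hK hY hf z
  obtain ⟨χ, c, e'⟩ := exists_glueMk (tangentMap hK hZ hg A (glueMk t Y ψ A b))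
  rw [e, ← e']
  exact (tangentMap_glueMk hK hZ hgf).2
    (h.comp hK hf ((tangentMap_glueMk hK hZ hg).1 e'.symm))

/-- The iterated tangent map of a map between manifolds, as a morphism. -/
noncomputable def tangentHom (hK : Dense {s : K | IsUnit s}) (hX : EnoughCharts t X)
    (hY : EnoughCharts t Y) (hf : IsCnMap X Y f) :
    Hom (chartGluing hK t X hX).ngpd (chartGluing hK t Y hY).ngpd :=
  Gluing.hom (fun A => tangentMap hK hY hf A)
    (fun A z z' h => by
      funext ht
      exact (anchor_tangentMap hK hY hf z _).trans ((congrArg f (congrFun h ht)).trans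
        (anchor_tangentMap hK hY hf z' _).symm))
    ((respects_chartTan hK hf t).of_iff fun _ _ _ _ _ => tangentMap_glueMk hK hY hf)

end Chart

/-! ### Pair groupoids over n-fold groupoids -/

theorem IsDouble.flip {A B C D : Type u} {R : Gpd A C} {S : Gpd B D} {P : Gpd A B} {Q : Gpd C D}
    (h : IsDouble R S P Q) : IsDouble P Q R S :=
  ⟨h.src_v, h.tgt_v, h.one_v, h.src_h, h.tgt_h, h.one_h,
    fun a b c d hab hcd hac hbd h₁ h₂ => (h.interchange a c b d hac hbd hab hcd h₂ h₁).symm⟩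

/-- The groupoid of families of morphisms of `G`. -/
def powGpd (J : Type) {G₁ G₀ : Type u} (G : Gpd G₁ G₀) : Gpd (J → G₁) (J → G₀) where
  src v j := G.src (v j)
  tgt v j := G.tgt (v j)
  one x j := G.one (x j)
  inv v j := G.inv (v j)
  mul a b h j := G.mul (a j) (b j) (congrFun h j)
  src_mul _ _ _ := funext fun _ => G.src_mul _ _ _
  tgt_mul _ _ _ := funext fun _ => G.tgt_mul _ _ _
  mul_assoc _ _ _ _ _ := funext fun _ => G.mul_assoc _ _ _ _ _
  src_one _ := funext fun _ => G.src_one _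
  tgt_one _ := funext fun _ => G.tgt_one _
  mul_one _ := funext fun _ => G.mul_one _
  one_mul _ := funext fun _ => G.one_mul _
  src_inv _ := funext fun _ => G.src_inv _
  tgt_inv _ := funext fun _ => G.tgt_inv _
  mul_inv _ := funext fun _ => G.mul_inv _
  inv_mul _ := funext fun _ => G.inv_mul _

theorem IsFunctor.pow (J : Type) {G₁ G₀ H₁ H₀ : Type u} {G : Gpd G₁ G₀} {H : Gpd H₁ H₀}
    {f₁ : G₁ → H₁} {f₀ : G₀ → H₀} (h : IsFunctor G H f₁ f₀) :
    IsFunctor (powGpd J G) (powGpd J H) (fun v j => f₁ (v j)) (fun v j => f₀ (v j)) :=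
  ⟨fun _ => funext fun _ => h.map_src _, fun _ => funext fun _ => h.map_tgt _,
    fun _ => funext fun _ => h.map_one _, fun _ _ _ => funext fun _ => h.map_mul _ _ _⟩

theorem IsDouble.pow (J : Type) {A B C D : Type u} {R : Gpd A C} {S : Gpd B D} {P : Gpd A B}
    {Q : Gpd C D} (h : IsDouble R S P Q) :
    IsDouble (powGpd J R) (powGpd J S) (powGpd J P) (powGpd J Q) :=
  ⟨h.src_h.pow J, h.tgt_h.pow J, h.one_h.pow J, h.src_v.pow J, h.tgt_v.pow J, h.one_v.pow J,
    fun _ _ _ _ _ _ _ _ _ _ => funext fun _ => h.interchange _ _ _ _ _ _ _ _ _ _⟩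

section

variable {n : ℕ} {k : Fin n} {I₀ I₁ : Finset (Fin n)} (h : IsEdge k I₀ I₁)

theorem isFunctor_pair {M N : Type u} (f : M → N) :
    IsFunctor (pairGpd M h) (pairGpd N h) (fun v S => f (v S)) (fun v S => f (v S)) where
  map_src _ := rfl
  map_tgt _ := rfl
  map_one x := fam_ext h (by simp [pairGpd]) (by simp [pairGpd])
  map_mul a b _ := fam_ext h (by simp [pairGpd]) (by simp [pairGpd])

theorem isDouble_pow_pair {G₁ G₀ : Type u} (G : Gpd G₁ G₀) :
    IsDouble (powGpd (Subs I₁) G) (powGpd (Subs I₀) G) (pairGpd G₁ h) (pairGpd G₀ h) where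
  src_h := isFunctor_pair h G.src
  tgt_h := isFunctor_pair h G.tgt
  one_h := isFunctor_pair h G.one
  src_v := ⟨fun _ => rfl, fun _ => rfl, fun _ => rfl, fun _ _ _ => rfl⟩
  tgt_v := ⟨fun _ => rfl, fun _ => rfl, fun _ => rfl, fun _ _ _ => rfl⟩
  one_v := by
    refine ⟨fun a => fam_ext h ?_ ?_, fun a => fam_ext h ?_ ?_, fun x => fam_ext h ?_ ?_,
      fun a b hab => fam_ext h ?_ ?_⟩ <;> intro S <;> simp [pairGpd, powGpd]
  interchange a b c d _ _ _ _ _ _ := by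
    refine fam_ext h ?_ ?_ <;> intro S <;> simp [pairGpd, powGpd]

variable (T : NGpd.{u} n) {Z₀ Z₁ : Finset (Fin n)}

/-- The pair groupoid on families in a vertex set of `T`. -/
def pairEdge (e : Z₁ = Z₀) : Gpd (Subs I₁ → T.vertex Z₁) (Subs I₀ → T.vertex Z₀) :=
  e ▸ pairGpd (T.vertex Z₁) h

/-- The groupoid of families of morphisms of an edge of `T`. -/
def powEdge (hZ : IsEdge k Z₀ Z₁) (e : I₁ = I₀) :
    Gpd (Subs I₁ → T.vertex Z₁) (Subs I₀ → T.vertex Z₀) :=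
  e ▸ powGpd (Subs I₁) (T.edge hZ)

end

/-! ### Faces with two pair edges, with none, and with one. -/

section Faces

variable {n : ℕ} {k l : Fin n} (T : NGpd.{u} n) {IA IB IC ID ZA ZB ZC ZD : Finset (Fin n)}

/-- The index sets are independent variables, so that the equalities between them can be eliminated
and the transports in the edges vanish; this is impossible for the sets A ∩ I and A \ I themselves.
-/
theorem isDouble_pair_pair (hDC : IsEdge k ID IC) (hBA : IsEdge k IB IA) (hDB : IsEdge l ID IB)
    (hCA : IsEdge l IC IA) (eDC : ZC = ZD) (eBA : ZA = ZB) (eDB : ZB = ZD) (eCA : ZA = ZC) :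
    IsDouble (pairEdge hCA T eCA) (pairEdge hDB T eDB) (pairEdge hBA T eBA)
      (pairEdge hDC T eDC) := by
  subst eDC eBA eDB
  exact (pairNGpd (T.vertex _)).face hDC hBA hDB hCA

theorem isDouble_pow_pow (hDC : IsEdge k ZD ZC) (hBA : IsEdge k ZB ZA) (hDB : IsEdge l ZD ZB)
    (hCA : IsEdge l ZC ZA) (eDC : IC = ID) (eBA : IA = IB) (eDB : IB = ID) (eCA : IA = IC) :
    IsDouble (powEdge T hCA eCA) (powEdge T hDB eDB) (powEdge T hBA eBA)
      (powEdge T hDC eDC) := by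
  subst eDC eBA eDB
  exact (T.face hDC hBA hDB hCA).pow _

theorem isDouble_powEdge_pairEdge (hDC : IsEdge k ID IC) (hBA : IsEdge k IB IA)
    (hDB : IsEdge l ZD ZB) (hCA : IsEdge l ZC ZA) (eDC : ZC = ZD) (eBA : ZA = ZB) (eDB : IB = ID)
    (eCA : IA = IC) :
    IsDouble (powEdge T hCA eCA) (powEdge T hDB eDB) (pairEdge hBA T eBA)
      (pairEdge hDC T eDC) := by
  subst eDC eBA eDB eCA
  exact isDouble_pow_pair hDC (T.edge hCA)

end Faces

/-! ### Replacing the edges in given directions by pair groupoids. -/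

section Mixed

variable {n : ℕ} {k : Fin n} {B A I : Finset (Fin n)}

theorem IsEdge.inter (h : IsEdge k B A) (hk : k ∈ I) : IsEdge k (B ∩ I) (A ∩ I) :=
  ⟨fun hB => h.1 (Finset.mem_inter.1 hB).1, by rw [h.2, Finset.insert_inter_of_mem hk]⟩

theorem IsEdge.inter_eq (h : IsEdge k B A) (hk : k ∉ I) : A ∩ I = B ∩ I := by
  rw [h.2, Finset.insert_inter_of_notMem hk]

theorem IsEdge.sdiff (h : IsEdge k B A) (hk : k ∉ I) : IsEdge k (B \ I) (A \ I) :=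
  ⟨fun hB => h.1 (Finset.mem_sdiff.1 hB).1, by rw [h.2, Finset.insert_sdiff_of_notMem _ hk]⟩

theorem IsEdge.sdiff_eq (h : IsEdge k B A) (hk : k ∈ I) : A \ I = B \ I := by
  rw [h.2, Finset.insert_sdiff_of_mem _ hk]

/-- The `n`-fold groupoid obtained from `T` by replacing the edges in the directions `i ∈ I` by
pair groupoids. -/
def mixed (I : Finset (Fin n)) (T : NGpd.{u} n) : NGpd.{u} n where
  vertex A := Subs (A ∩ I) → T.vertex (A \ I)
  edge {k B A} h := if hk : k ∈ I then pairEdge (h.inter hk) T (h.sdiff_eq hk)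
    else powEdge T (h.sdiff hk) (h.inter_eq hk)
  face {k l D B C A} hDC hBA hDB hCA := by
    by_cases hk : k ∈ I <;> by_cases hl : l ∈ I
    · simp only [dif_pos hk, dif_pos hl]
      exact isDouble_pair_pair T _ _ _ _ _ _ _ _
    · simp only [dif_pos hk, dif_neg hl]
      exact isDouble_powEdge_pairEdge T _ _ _ _ _ _ _ _
    · simp only [dif_neg hk, dif_pos hl]
      exact (isDouble_powEdge_pairEdge T _ _ _ _ _ _ _ _).flip
    · simp only [dif_neg hk, dif_neg hl]
      exact isDouble_pow_pow T _ _ _ _ _ _ _ _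

theorem mixed_edge_mem (T : NGpd.{u} n) (h : IsEdge k B A) (hk : k ∈ I) :
    (mixed I T).edge h = pairEdge (h.inter hk) T (h.sdiff_eq hk) := dif_pos hk

theorem mixed_edge_notMem (T : NGpd.{u} n) (h : IsEdge k B A) (hk : k ∉ I) :
    (mixed I T).edge h = powEdge T (h.sdiff hk) (h.inter_eq hk) := dif_neg hk

theorem isFunctor_pairEdge {T T' : NGpd.{u} n} (f : Hom T T') {I₀ I₁ Z₀ Z₁ : Finset (Fin n)}
    (h : IsEdge k I₀ I₁) (e : Z₁ = Z₀) :
    IsFunctor (pairEdge h T e) (pairEdge h T' e) (fun z C => f.map Z₁ (z C))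
      (fun z C => f.map Z₀ (z C)) := by
  subst e
  exact isFunctor_pair h _

theorem isFunctor_powEdge {T T' : NGpd.{u} n} (f : Hom T T') {I₀ I₁ Z₀ Z₁ : Finset (Fin n)}
    (h : IsEdge k Z₀ Z₁) (e : I₁ = I₀) :
    IsFunctor (powEdge T h e) (powEdge T' h e) (fun z C => f.map Z₁ (z C))
      (fun z C => f.map Z₀ (z C)) := by
  subst e
  exact (f.isFunctor h).pow _

/-- A criterion for functors to a groupoid `pairEdge`. -/
theorem isFunctor_to_pairEdge (T : NGpd.{u} n) {I₀ I₁ Z₀ Z₁ : Finset (Fin n)} {G₁ G₀ : Type u}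
    {G : Gpd G₁ G₀} (h : IsEdge k I₀ I₁) (e : Z₁ = Z₀) {f₁ : G₁ → Subs I₁ → T.vertex Z₁}
    {f₀ : G₀ → Subs I₀ → T.vertex Z₀} (h_src : ∀ a C, HEq (f₁ a (lo h C)) (f₀ (G.src a) C))
    (h_tgt : ∀ a C, HEq (f₁ a (hi h C)) (f₀ (G.tgt a) C)) :
    IsFunctor G (pairEdge h T e) f₁ f₀ := by
  subst e
  simp only [heq_eq_eq] at h_src h_tgt
  refine ⟨fun a => funext fun C => h_src a C, fun a => funext fun C => h_tgt a C,
    fun x => fam_ext h ?_ ?_, fun a b hab => fam_ext h ?_ ?_⟩ <;> intro C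
  · rw [h_src, G.src_one]; exact (join_lo h _ _ C).symm
  · rw [h_tgt, G.tgt_one]; exact (join_hi h _ _ C).symm
  · rw [h_src, G.src_mul, ← h_src]
    exact (join_lo h (fun S => f₁ b (lo h S)) (fun S => f₁ a (hi h S)) C).symm
  · rw [h_tgt, G.tgt_mul, ← h_tgt]
    exact (join_hi h (fun S => f₁ b (lo h S)) (fun S => f₁ a (hi h S)) C).symm

/-- A criterion for functors to a groupoid `powEdge`. -/
theorem isFunctor_to_powEdge (T : NGpd.{u} n) {I₀ I₁ Z₀ Z₁ : Finset (Fin n)} {G₁ G₀ : Type u}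
    {G : Gpd G₁ G₀} (h : IsEdge k Z₀ Z₁) (e : I₁ = I₀) {f₁ : G₁ → Subs I₁ → T.vertex Z₁}
    {f₀ : G₀ → Subs I₀ → T.vertex Z₀}
    (h_src : ∀ a C h₁ h₀, (T.edge h).src (f₁ a ⟨C, h₁⟩) = f₀ (G.src a) ⟨C, h₀⟩)
    (h_tgt : ∀ a C h₁ h₀, (T.edge h).tgt (f₁ a ⟨C, h₁⟩) = f₀ (G.tgt a) ⟨C, h₀⟩)
    (h_one : ∀ x C h₁ h₀, f₁ (G.one x) ⟨C, h₁⟩ = (T.edge h).one (f₀ x ⟨C, h₀⟩))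
    (h_mul : ∀ a b hab C hC h', f₁ (G.mul a b hab) ⟨C, hC⟩
      = (T.edge h).mul (f₁ a ⟨C, hC⟩) (f₁ b ⟨C, hC⟩) h') :
    IsFunctor G (powEdge T h e) f₁ f₀ := by
  subst e
  exact ⟨fun a => funext fun C => h_src a C.1 C.2 C.2, fun a => funext fun C => h_tgt a C.1 C.2 C.2,
    fun x => funext fun C => h_one x C.1 C.2 C.2,
    fun a b hab => funext fun C => h_mul a b hab C.1 C.2 _⟩

/-- The functoriality of `mixed I`. -/
def mixedHom (I : Finset (Fin n)) {T T' : NGpd.{u} n} (f : Hom T T') :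
    Hom (mixed I T) (mixed I T') where
  map A z C := f.map (A \ I) (z C)
  isFunctor {k B A} h := by
    by_cases hk : k ∈ I
    · rw [mixed_edge_mem T h hk, mixed_edge_mem T' h hk]
      exact isFunctor_pairEdge f _ _
    · rw [mixed_edge_notMem T h hk, mixed_edge_notMem T' h hk]
      exact isFunctor_powEdge f _ _

end Mixed

/-! ### Splitting off the invertible directions of the local construction -/

section Split

variable {K : Type u} [CommRing K] {n : ℕ} {V : Type u} [AddCommGroup V] [Module K V]
  {A B I : Finset (Fin n)} {k : Fin n}

/-- The subset `S ∪ T` of `A`, for `S ⊆ A \ I` and `T ⊆ A ∩ I`. -/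
def subsUnion (S : Subs (A \ I)) (T : Subs (A ∩ I)) : Subs A :=
  ⟨S.1 ∪ T.1, Finset.union_subset (S.2.trans Finset.sdiff_subset)
    (T.2.trans Finset.inter_subset_left)⟩

/-- A subset of `A` is the union of a subset of `A \ I` and a subset of `A ∩ I`. -/
def subsEquiv (A I : Finset (Fin n)) : Subs (A \ I) × Subs (A ∩ I) ≃ Subs A where
  toFun p := subsUnion p.1 p.2
  invFun R := (⟨R.1 \ I, Finset.sdiff_subset_sdiff R.2 subset_rfl⟩,
    ⟨R.1 ∩ I, Finset.inter_subset_inter_right R.2⟩)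
  left_inv := by
    rintro ⟨⟨S, hS⟩, ⟨T, hT⟩⟩
    refine Prod.ext (Subtype.ext ?_) (Subtype.ext ?_)
    · ext i
      have h1 := @hS i
      have h2 := @hT i
      simp only [subsUnion, Finset.mem_sdiff, Finset.mem_union, Finset.mem_inter] at *
      tauto
    · ext i
      have h1 := @hS i
      have h2 := @hT i
      simp only [subsUnion, Finset.mem_sdiff, Finset.mem_union, Finset.mem_inter] at *
      tauto
  right_inv R := Subtype.ext (Finset.sdiff_union_inter R.1 I)

theorem subsUnion_subset_iff (S D : Subs (A \ I)) (T C : Subs (A ∩ I)) :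
    (subsUnion S T).1 ⊆ (subsUnion D C).1 ↔ S.1 ⊆ D.1 ∧ T.1 ⊆ C.1 := by
  constructor
  · intro h
    constructor
    · intro i hi
      have h1 := Finset.mem_sdiff.1 (S.2 hi)
      rcases Finset.mem_union.1 (h (Finset.mem_union_left _ hi)) with h2 | h2
      · exact h2
      · exact absurd (Finset.mem_inter.1 (C.2 h2)).2 h1.2
    · intro i hi
      have h1 := Finset.mem_inter.1 (T.2 hi)
      rcases Finset.mem_union.1 (h (Finset.mem_union_right _ hi)) with h2 | h2
      · exact absurd h1.2 (Finset.mem_sdiff.1 (D.2 h2)).2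
      · exact h2
  · exact fun h => Finset.union_subset_union h.1 h.2

/-- The parameters `t i`, `i ∉ I`, completed by zeros. -/
def paramOff (t : Fin n → K) (I : Finset (Fin n)) : Fin n → K := fun i => if i ∈ I then 0 else t i

theorem paramOff_eq (t : Fin n → K) {i : Fin n} (hi : i ∈ A \ I) : paramOff t I i = t i :=
  if_neg (Finset.mem_sdiff.1 hi).2

/-- The families over `A \ I` that are obtained from a family over `A` by forming feet in the
directions `i ∈ A ∩ I`. -/
def partialFeet (t : Fin n → K) (I : Finset (Fin n)) (v : Subs A → V) (C : Subs (A ∩ I)) :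
    Subs (A \ I) → V := fun S => foot t C fun T => v (subsUnion S T)

/-- For disjoint S and T one has t_{S ∪ T} = t_S t_T, so feet can be formed in two stages. -/
theorem foot_partialFeet (t : Fin n → K) (v : Subs A → V) (D : Subs (A \ I)) (C : Subs (A ∩ I)) :
    foot (paramOff t I) D (partialFeet t I v C) = foot t (subsUnion D C) v := by
  rw [foot_congr fun i hi => paramOff_eq t hi]
  unfold partialFeet foot
  rw [← (subsEquiv A I).sum_comp, Fintype.sum_prod_type]
  refine Finset.sum_congr rfl fun S _ => ?_
  by_cases hS : S.1 ⊆ D.1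
  · rw [if_pos hS, Finset.smul_sum]
    refine Finset.sum_congr rfl fun T _ => ?_
    change _ = if (subsUnion S T).1 ⊆ (subsUnion D C).1 then
      (∏ i ∈ S.1 ∪ T.1, t i) • v (subsUnion S T) else 0
    simp only [subsUnion_subset_iff, hS, true_and]
    split_ifs
    · rw [smul_smul, Finset.prod_union]
      exact Finset.disjoint_left.2 fun i hi hi' =>
        (Finset.mem_sdiff.1 (S.2 hi)).2 (Finset.mem_inter.1 (T.2 hi')).2
    · rw [smul_zero]
  · rw [if_neg hS]
    refine (Finset.sum_eq_zero fun T _ => if_neg fun h => hS ?_).symm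
    exact ((subsUnion_subset_iff S D T C).1 h).1

theorem exists_subsUnion (R : Subs A) (I : Finset (Fin n)) :
    ∃ (D : Subs (A \ I)) (C : Subs (A ∩ I)), subsUnion D C = R :=
  ⟨_, _, (subsEquiv A I).apply_symm_apply R⟩

theorem mem_extDom_iff_partialFeet (t : Fin n → K) (I : Finset (Fin n)) (U : Set V)
    (v : Subs A → V) :
    v ∈ extDom t U A ↔ ∀ C, partialFeet t I v C ∈ extDom (paramOff t I) U (A \ I) := by
  constructor
  · intro hv C D
    rw [foot_partialFeet]
    exact hv _
  · intro hv R
    obtain ⟨D, C, rfl⟩ := exists_subsUnion R I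
    rw [← foot_partialFeet]
    exact hv C D

/-- The counterpart of `foot_inj`: the upper half is the difference quotient t_k⁻¹ (y - x) of the
solutions y and x for the two halves of the prescribed feet. -/
theorem exists_foot_eq {t : Fin n → K} : ∀ {A : Finset (Fin n)}, t ∈ unitsOn K A →
    ∀ m : Subs A → V, ∃ v, ∀ C, foot t C v = m C := by
  intro A
  induction A using Finset.induction_on with
  | empty =>
    refine fun _ m => ⟨m, fun C => ?_⟩
    rw [foot_of_empty, ← show C = ⟨∅, subset_rfl⟩ from Subtype.ext (Finset.subset_empty.1 C.2)]
  | insert k B hk ih =>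
    intro hu m
    have e := isEdge_insert hk
    obtain ⟨x, hx⟩ := ih (unitsOn_anti e.sub hu) fun C => m (lo e C)
    obtain ⟨y, hy⟩ := ih (unitsOn_anti e.sub hu) fun C => m (hi e C)
    obtain ⟨s, hs⟩ := hu k e.mem
    refine ⟨join e x fun S => ((s⁻¹ : Kˣ) : K) • (y S - x S), fun C => ?_⟩
    rcases sub_cases e C with ⟨T, rfl⟩ | ⟨T, rfl⟩
    · rw [foot_lo, ← hx]
      simp only [join_lo]
    · rw [foot_hi, tgtMap_join, ← hs, ← hy]
      simp [smul_smul]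

theorem partialFeet_injective {t : Fin n → K} (hI : ∀ i ∈ I, IsUnit (t i)) :
    Injective (partialFeet (A := A) (V := V) t I) := by
  intro v w h
  funext R
  obtain ⟨D, C, rfl⟩ := exists_subsUnion R I
  have := foot_inj (s := t) (A := A ∩ I) (fun i hi => hI i (Finset.mem_inter.1 hi).2)
    (v := fun T => v (subsUnion D T)) (w := fun T => w (subsUnion D T)) fun C =>
      congrFun (congrFun h C) D
  exact congrFun this C

theorem partialFeet_surjective {t : Fin n → K} (hI : ∀ i ∈ I, IsUnit (t i)) :
    Surjective (partialFeet (A := A) (V := V) t I) := by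
  intro z
  choose w hw using fun D : Subs (A \ I) => exists_foot_eq (t := t) (A := A ∩ I)
    (fun i hi => hI i (Finset.mem_inter.1 hi).2) fun C => z C D
  refine ⟨fun R => w ((subsEquiv A I).symm R).1 ((subsEquiv A I).symm R).2, ?_⟩
  funext C D
  rw [← hw D C]
  unfold partialFeet
  congr 1
  funext T
  have := (subsEquiv A I).symm_apply_apply (D, T)
  change w ((subsEquiv A I).symm (subsEquiv A I (D, T))).1
    ((subsEquiv A I).symm (subsEquiv A I (D, T))).2 = _
  rw [this]

theorem partialFeet_lo (h : IsEdge k B A) (hk : k ∈ I)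
    (t : Fin n → K) (v : Subs A → V) (C : Subs (B ∩ I)) (S : Finset (Fin n)) (hA : S ⊆ A \ I)
    (hB : S ⊆ B \ I) :
    partialFeet t I v (lo (h.inter hk) C) ⟨S, hA⟩
      = partialFeet t I (fun S => v (lo h S)) C ⟨S, hB⟩ :=
  foot_lo t (h.inter hk) C _

theorem partialFeet_hi (h : IsEdge k B A) (hk : k ∈ I)
    (t : Fin n → K) (v : Subs A → V) (C : Subs (B ∩ I)) (S : Finset (Fin n)) (hA : S ⊆ A \ I)
    (hB : S ⊆ B \ I) :
    partialFeet t I v (hi (h.inter hk) C) ⟨S, hA⟩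
      = partialFeet t I (tgtMap t h v) C ⟨S, hB⟩ := by
  refine (foot_hi t (h.inter hk) C _).trans (congrArg (foot t C) (funext fun T => ?_))
  refine congrArg (fun x => v _ + t k • v x) (Subtype.ext ?_)
  exact Finset.union_insert k S T.1

theorem foot_congr_set {A' : Finset (Fin n)} (e : A = A') (t : Fin n → K) (C : Finset (Fin n))
    (h : C ⊆ A) (h' : C ⊆ A') {v : Subs A → V} {v' : Subs A' → V}
    (H : ∀ S h₁ h₂, v ⟨S, h₁⟩ = v' ⟨S, h₂⟩) : foot t ⟨C, h⟩ v = foot t ⟨C, h'⟩ v' := by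
  subst e
  rw [show v = v' from funext fun S => H S.1 S.2 S.2]

theorem partialFeet_lo_off (h : IsEdge k B A) (hk : k ∉ I) (t : Fin n → K) (v : Subs A → V)
    (C : Finset (Fin n)) (hA : C ⊆ A ∩ I) (hB : C ⊆ B ∩ I) (S : Subs (B \ I)) :
    partialFeet t I v ⟨C, hA⟩ (lo (h.sdiff hk) S)
      = partialFeet t I (fun S => v (lo h S)) ⟨C, hB⟩ S :=
  foot_congr_set (h.inter_eq hk) t C hA hB fun _ _ _ => rfl

theorem partialFeet_hi_off (h : IsEdge k B A) (hk : k ∉ I) (t : Fin n → K) (v : Subs A → V)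
    (C : Finset (Fin n)) (hA : C ⊆ A ∩ I) (hB : C ⊆ B ∩ I) (S : Subs (B \ I)) :
    partialFeet t I v ⟨C, hA⟩ (hi (h.sdiff hk) S)
      = partialFeet t I (fun S => v (hi h S)) ⟨C, hB⟩ S :=
  foot_congr_set (h.inter_eq hk) t C hA hB fun T _ _ =>
    congrArg v (Subtype.ext (Finset.insert_union k S.1 T))

theorem heq_extDom {t : Fin n → K} {U : Set V} (e : A = B) {x : extDom t U A} {y : extDom t U B}
    (H : ∀ S h₁ h₂, x.1 ⟨S, h₁⟩ = y.1 ⟨S, h₂⟩) : HEq x y := by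
  subst e
  exact heq_of_eq (Subtype.ext (funext fun S => H S.1 S.2 S.2))

/-- The morphism from the local construction that forms feet in the directions `i ∈ I`. -/
def splitHom (t : Fin n → K) (I : Finset (Fin n)) (U : Set V) :
    Hom (localNGpd t U) (mixed I (localNGpd (paramOff t I) U)) where
  map A v C := ⟨partialFeet t I v.1 C, (mem_extDom_iff_partialFeet t I U v.1).1 v.2 C⟩
  isFunctor {k B A} h := by
    by_cases hk : k ∈ I
    · rw [mixed_edge_mem _ h hk]
      -- In a direction of I, the feet without k come from the source and those with k from the
      -- target; a functor to a pair groupoid is determined by this.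
      exact isFunctor_to_pairEdge _ _ _
        (fun v C => heq_extDom (h.sdiff_eq hk) fun S h₁ h₂ => partialFeet_lo h hk t v.1 C S h₁ h₂)
        (fun v C => heq_extDom (h.sdiff_eq hk) fun S h₁ h₂ => partialFeet_hi h hk t v.1 C S h₁ h₂)
    · rw [mixed_edge_notMem _ h hk]
      -- In the other directions, forming partial feet is linear and acts on both halves separately,
      -- so it commutes with the linear structure maps.
      refine isFunctor_to_powEdge _ _ _ (fun v C h₁ h₀ => ?_) (fun v C h₁ h₀ => ?_)
        (fun x C h₁ h₀ => ?_) (fun v w hvw C hC h' => ?_)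
      · exact Subtype.ext (funext fun S => partialFeet_lo_off h hk t v.1 C h₁ h₀ S)
      · refine Subtype.ext (funext fun S => ?_)
        change partialFeet t I v.1 ⟨C, h₁⟩ (lo (h.sdiff hk) S)
          + paramOff t I k • partialFeet t I v.1 ⟨C, h₁⟩ (hi (h.sdiff hk) S)
          = partialFeet t I (tgtMap t h v.1) ⟨C, h₀⟩ S
        rw [partialFeet_lo_off h hk t v.1 C h₁ h₀, partialFeet_hi_off h hk t v.1 C h₁ h₀,
          paramOff_eq t (h.sdiff hk).mem]
        unfold partialFeet tgtMap
        rw [foot_add, foot_smul]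
      · refine Subtype.ext (fam_ext (h.sdiff hk) (fun S => ?_) fun S => ?_)
        · refine (partialFeet_lo_off h hk t _ C h₁ h₀ S).trans ?_
          simp only [localNGpd, localGpd, join_lo]
        · refine (partialFeet_hi_off h hk t _ C h₁ h₀ S).trans ?_
          simp only [localNGpd, localGpd, join_hi]
          simp [partialFeet, foot]
      · have hB : C ⊆ B ∩ I := h.inter_eq hk ▸ hC
        refine Subtype.ext (fam_ext (h.sdiff hk) (fun S => ?_) fun S => ?_)
        · refine (partialFeet_lo_off h hk t _ C hC hB S).trans ?_
          simp only [localNGpd, localGpd, join_lo]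
          exact (partialFeet_lo_off h hk t _ C hC hB S).symm
        · refine (partialFeet_hi_off h hk t _ C hC hB S).trans ?_
          simp only [localNGpd, localGpd, join_hi]
          rw [partialFeet_hi_off h hk t _ C hC hB, partialFeet_hi_off h hk t _ C hC hB]
          exact foot_add _ _ _ _

theorem bijective_splitHom {t : Fin n → K} (hI : ∀ i ∈ I, IsUnit (t i)) (U : Set V) :
    (splitHom t I U).IsIso := by
  refine fun A => ⟨fun v w h => Subtype.ext (partialFeet_injective hI ?_), fun z => ?_⟩
  · funext C
    exact congrArg Subtype.val (congrFun h C)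
  · obtain ⟨v, hv⟩ := partialFeet_surjective hI fun C => (z C).1
    refine ⟨⟨v, (mem_extDom_iff_partialFeet t I U v).2 fun C => ?_⟩, funext fun C =>
      Subtype.ext (congrFun hv C)⟩
    rw [hv]
    exact (z C).2

end Split

/-! ### Splitting commutes with iterated tangent maps. -/

section SplitTangent

variable {K : Type u} [CommRing K] [TopologicalSpace K] [IsTopologicalRing K] {n : ℕ}
  {V W : Type u}
  [AddCommGroup V] [Module K V] [TopologicalSpace V] [IsTopologicalAddGroup V] [ContinuousSMul K V]
  [AddCommGroup W] [Module K W] [TopologicalSpace W] [IsTopologicalAddGroup W] [ContinuousSMul K W]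
  {A I : Finset (Fin n)} {t : Fin n → K}

theorem continuous_partialFeet (C : Subs (A ∩ I)) :
    Continuous fun p : (Subs A → V) × (Fin n → K) => partialFeet p.2 I p.1 C :=
  continuous_pi fun S => (continuous_foot C).comp
    (f := fun p : (Subs A → V) × (Fin n → K) => (fun T => p.1 (subsUnion S T), p.2))
    (by fun_prop)

theorem continuous_paramOff : Continuous fun s : Fin n → K => paramOff s I := by
  refine continuous_pi fun i => ?_
  unfold paramOff
  split_ifs <;> fun_prop

/-- For invertible parameters s, the feet of partial feet are feet of the whole family, so `f` acts
on them as required; both sides are limits of these families as s tends to `t`. -/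
theorem HasTan.partialFeet_eq (hK : Dense {s : K | IsUnit s}) [T2Space W] {f : V → W}
    {v : Subs A → V} {w : Subs A → W} (h : HasTan t f v w) (C : Subs (A ∩ I))
    {y : Subs (A \ I) → W} (hy : HasTan (paramOff t I) f (partialFeet t I v C) y) :
    y = partialFeet t I w C := by
  have := neBot_units hK A t
  have hs : Tendsto id (𝓝[unitsOn K A] t) (𝓝 t) := nhdsWithin_le_nhds
  have hu : ∀ᶠ s in 𝓝[unitsOn K A] t, s ∈ unitsOn K A := self_mem_nhdsWithin
  obtain ⟨w', h1, h2⟩ := h.along (tendsto_const_nhds (x := v)) hs hu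
  refine hy.eq_of_tendsto (((continuous_partialFeet C).tendsto (v, t)).comp
      ((tendsto_const_nhds (x := v)).prodMk_nhds hs))
    ((continuous_paramOff.tendsto t).comp hs) (hu.mono fun s h' i hi => ?_)
    (((continuous_partialFeet C).tendsto (w, t)).comp (h1.prodMk_nhds hs)) ?_
  · have := h' i (Finset.mem_sdiff.1 hi).1
    rwa [comp_apply, id, paramOff_eq s hi]
  · filter_upwards [h2] with s hs' D
    simp only [comp_apply, id, foot_partialFeet]
    exact hs' _

end SplitTangent

/-! ### The n-fold groupoid of a manifold -/

theorem hom_ext {n : ℕ} {G H : NGpd.{u} n} {f g : Hom G H}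
    (h : ∀ A z, f.map A z = g.map A z) : f = g := by
  cases f
  cases g
  congr
  funext A z
  exact h A z

/-- The morphism from a piece to the glued `n`-fold groupoid. -/
noncomputable def Gluing.piece {n : ℕ} (D : Gluing.{u} n) (j : D.J) : Hom (D.L j) D.ngpd where
  map := D.c j
  isFunctor h :=
    { map_src := fun a => D.src_c h j a
      map_tgt := fun a => D.tgt_c h j a
      map_one := fun a => (D.one_c h j a).symm
      map_mul := fun _ _ hab => (D.mul_eq h _ rfl rfl hab).symm }

/-- The functor from a pair groupoid on families in a vertex set of `T` to a pair groupoid. -/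
theorem isFunctor_from_pairEdge {n : ℕ} {k : Fin n} (T : NGpd.{u} n)
    {A B I₀ I₁ Z₀ Z₁ : Finset (Fin n)} {M : Type u} (p : ∀ Z, T.vertex Z → M) (h : IsEdge k B A)
    (hI : IsEdge k I₀ I₁) (e : Z₁ = Z₀) {r₁ : Subs A → Subs I₁} {r₀ : Subs B → Subs I₀}
    (h_lo : ∀ C, r₁ (lo h C) = lo hI (r₀ C)) (h_hi : ∀ C, r₁ (hi h C) = hi hI (r₀ C)) :
    IsFunctor (pairEdge hI T e) (pairGpd M h) (fun z C => p Z₁ (z (r₁ C)))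
      (fun z C => p Z₀ (z (r₀ C))) := by
  subst e
  refine ⟨fun z => ?_, fun z => ?_, fun x => fam_ext h ?_ ?_, fun a b _ => fam_ext h ?_ ?_⟩
  · funext C
    exact congrArg (fun S => p Z₁ (z S)) (h_lo C)
  · funext C
    exact congrArg (fun S => p Z₁ (z S)) (h_hi C)
  all_goals
    intro C
    simp [pairEdge, pairGpd, h_lo, h_hi]

/-- The morphism between local constructions given by an inclusion. -/
def inclusionHom {K : Type u} [CommRing K] {n : ℕ} (t : Fin n → K) {V : Type u} [AddCommGroup V]
    [Module K V] {U U' : Set V} (h : U ⊆ U') : Hom (localNGpd t U) (localNGpd t U') where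
  map _ v := ⟨v.1, fun C => h (v.2 C)⟩
  isFunctor _ := ⟨fun _ => rfl, fun _ => rfl, fun _ => rfl, fun _ _ _ => rfl⟩

/-! ### Definition of the n-fold groupoid of a manifold and of its chart morphisms. -/

section Main

variable {K : Type u} [CommRing K] [TopologicalSpace K] [IsTopologicalRing K] {n : ℕ}

open Classical in
/-- The directions in which the parameter is invertible. -/
noncomputable def unitDirs (t : Fin n → K) : Finset (Fin n) :=
  Finset.univ.filter fun i => IsUnit (t i)

theorem mem_unitDirs {t : Fin n → K} {i : Fin n} : i ∈ unitDirs t ↔ IsUnit (t i) := by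
  simp [unitDirs]

/-- The non-invertible parameters. -/
noncomputable abbrev offParam (t : Fin n → K) : Fin n → K := paramOff t (unitDirs t)

theorem exists_chart_of_subsingleton (X : CnManifold K n) {s : Set X.carrier} (hs : s.Nonempty)
    (hs' : s.Subsingleton) : ∃ φ ∈ X.atlas, s ⊆ φ.source := by
  obtain ⟨x, hx⟩ := hs
  obtain ⟨φ, hφ, h⟩ := X.exists_chart x
  exact ⟨φ, hφ, fun y hy => hs' hx hy ▸ h⟩

/-- Over a field a non-invertible parameter is zero, so only sets with one point have to be covered.
Otherwise the manifold axiom covers every finite set. -/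
theorem enoughCharts (t : Fin n → K) (X : CnManifold K n) : EnoughCharts (offParam t) X := by
  intro s hf hs h0
  rcases X.exists_common_chart with hF | hc
  · refine exists_chart_of_subsingleton X hs (h0 (funext fun i => ?_))
    unfold offParam paramOff
    split_ifs with hi
    · rfl
    · by_contra hne
      obtain ⟨b, hb⟩ := hF.mul_inv_cancel hne
      exact hi (mem_unitDirs.2 (IsUnit.of_mul_eq_one b hb))
  · exact hc s hf hs

variable (hK : Dense {s : K | IsUnit s}) (t : Fin n → K)

/-- The glued `n`-fold groupoid for the non-invertible parameters. -/
noncomputable abbrev offNGpd (X : CnManifold K n) : NGpd.{u} n :=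
  (chartGluing hK (offParam t) X (enoughCharts t X)).ngpd

/-- The `n`-fold groupoid `M^n_t` of a manifold `M`. -/
noncomputable def symNGpd (X : CnManifold K n) : NGpd.{u} n :=
  mixed (unitDirs t) (offNGpd hK t X)

/-- The morphism `f^n_t` induced by a map `f` of class `C^n`. -/
noncomputable def symHom {X Y : CnManifold K n} {f : X.carrier → Y.carrier} (hf : IsCnMap X Y f) :
    Hom (symNGpd hK t X) (symNGpd hK t Y) :=
  mixedHom (unitDirs t) (tangentHom hK (enoughCharts t X) (enoughCharts t Y) hf)

/-- The inclusion of the local construction for a subset of the range of a chart. -/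
noncomputable def chartHom (X : CnManifold K n) (φ : X.atlas) {U : Set X.model}
    (h : U ⊆ φ.1.target) : Hom (localNGpd t U) (symNGpd hK t X) :=
  ((mixedHom (unitDirs t)
    ((chartGluing hK (offParam t) X (enoughCharts t X)).piece φ)).comp
      (splitHom t (unitDirs t) φ.1.target)).comp (inclusionHom t h)

variable {V W : Type u} [AddCommGroup V] [Module K V] [TopologicalSpace V]
  [IsTopologicalAddGroup V] [ContinuousSMul K V] [T2Space V]
  [AddCommGroup W] [Module K W] [TopologicalSpace W]
  [IsTopologicalAddGroup W] [ContinuousSMul K W] [T2Space W]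

/-- The chart of an open set. -/
noncomputable def inclChart (U : Opens V) (hU : Nonempty U) :
    (openManifold (K := K) n U).atlas := ⟨U.openPartialHomeomorphSubtypeCoe hU, hU, rfl⟩

theorem inclChart_target (U : Opens V) (hU : Nonempty U) :
    @Eq (Set V) (inclChart (K := K) (n := n) U hU).1.target (U : Set V) := by
  change (U.openPartialHomeomorphSubtypeCoe hU).target = (U : Set V)
  simp

theorem inclChart_source (U : Opens V) (hU : Nonempty U) :
    @Eq (Set U) (inclChart (K := K) (n := n) U hU).1.source univ := by
  change (U.openPartialHomeomorphSubtypeCoe hU).source = univ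
  simp

theorem inclChart_symm (U : Opens V) (hU : Nonempty U) {v : V} (hv : v ∈ U) :
    (inclChart (K := K) (n := n) U hU).1.symm v = (⟨v, hv⟩ : U) :=
  Subtype.ext ((inclChart (K := K) (n := n) U hU).1.right_inv
    ((inclChart_target (K := K) (n := n) U hU).symm ▸ hv))

theorem nonempty_of_extDom {t : Fin n → K} {U : Opens V} {A : Finset (Fin n)}
    (v : extDom t (U : Set V) A) : Nonempty U := ⟨⟨_, v.2 ⟨∅, Finset.empty_subset A⟩⟩⟩

open Classical in
/-- The morphism from the local construction for an open set `U` to the `n`-fold groupoid of the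
manifold `U`. -/
noncomputable def openHom (U : Opens V) :
    Hom (localNGpd t (U : Set V)) (symNGpd hK t (openManifold n U)) :=
  if hU : Nonempty U then
    chartHom hK t (openManifold n U) (inclChart U hU) (inclChart_target U hU).symm.subset
  else
    -- An empty `U` has no chart, but then the local vertex sets are empty too.
    { map := fun _ v => (hU (nonempty_of_extDom v)).elim
      isFunctor := fun _ => ⟨fun v => (hU (nonempty_of_extDom v)).elim,
        fun v => (hU (nonempty_of_extDom v)).elim, fun v => (hU (nonempty_of_extDom v)).elim,
        fun v => (hU (nonempty_of_extDom v)).elim⟩ }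

theorem openHom_eq (U : Opens V) (hU : Nonempty U) : openHom hK t U =
    chartHom hK t (openManifold n U) (inclChart U hU) (inclChart_target U hU).symm.subset :=
  dif_pos hU

/-- The morphism induced by a chart. -/
noncomputable def symChart (X : CnManifold K n) (φ : X.atlas) :
    Hom (localNGpd t φ.1.target) (symNGpd hK t X) :=
  (symHom hK t (isCnMap_chartInv X φ.1 φ.2)).comp (openHom hK t ⟨φ.1.target, φ.1.open_target⟩)

/-- In the inclusion chart of its range and in φ, the map φ⁻¹ is the identity, so its tangent images
are the identity as well. -/
theorem symChart_eq (X : CnManifold K n) (φ : X.atlas) :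
    symChart hK t X φ = chartHom hK t X φ subset_rfl := by
  refine hom_ext fun A v => ?_
  have hU : Nonempty (⟨φ.1.target, φ.1.open_target⟩ : Opens X.model) :=
    nonempty_of_extDom (t := t) (U := ⟨φ.1.target, φ.1.open_target⟩) v
  unfold symChart
  rw [openHom_eq hK t _ hU]
  funext C
  refine (tangentMap_glueMk hK (enoughCharts t X) (isCnMap_chartInv X φ.1 φ.2)).2 ?_
  have hm := (mem_extDom_iff_partialFeet t (unitDirs t) φ.1.target v.1).1 v.2 C
  have ht := inclChart_target (K := K) (n := n) ⟨φ.1.target, φ.1.open_target⟩ hU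
  have hs : ∀ x ∈ φ.1.target, chartInv X φ.1
      ((inclChart (K := K) (n := n) ⟨φ.1.target, φ.1.open_target⟩ hU).1.symm x) = φ.1.symm x := by
    intro x hx
    rw [inclChart_symm _ hU (v := x) hx]
    rfl
  refine ⟨fun D => ⟨ht.symm.subset (hm D), ?_⟩, ?_⟩
  · rw [mem_preimage, mem_preimage]
    exact (congrArg (· ∈ φ.1.source) (hs _ (hm D))).mpr (φ.1.map_target (hm D))
  · refine (HasTan.refl _ _).congr φ.1.open_target hm fun x hx => ?_
    exact (congrArg φ.1 (hs x hx)).trans (φ.1.right_inv hx)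

end Main

/-! ### Injectivity of charts, base points and functoriality. -/

section Main

variable {K : Type u} [CommRing K] [TopologicalSpace K] [IsTopologicalRing K] {n : ℕ}
  (hK : Dense {s : K | IsUnit s}) (t : Fin n → K)

theorem isUnit_of_mem_unitDirs {t : Fin n → K} : ∀ i ∈ unitDirs t, IsUnit (t i) :=
  fun _ => mem_unitDirs.1

theorem chartHom_injective (X : CnManifold K n) (φ : X.atlas) {U : Set X.model}
    (h : U ⊆ φ.1.target) (A : Finset (Fin n)) : Injective ((chartHom hK t X φ h).map A) := by
  intro v w e
  refine Subtype.ext (partialFeet_injective (isUnit_of_mem_unitDirs (t := t)) (funext fun C => ?_))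
  exact congrArg Subtype.val (glueMk_injective hK φ (congrFun e C))

theorem exists_chartHom_eq (X : CnManifold K n) (φ : X.atlas) {A : Finset (Fin n)}
    (z : (symNGpd hK t X).vertex A)
    (hz : ∀ C, ∃ a, glueMk (offParam t) X φ (A \ unitDirs t) a = z C) :
    ∃ v, (chartHom hK t X φ subset_rfl).map A v = z := by
  choose a ha using hz
  obtain ⟨v, hv⟩ := (bijective_splitHom isUnit_of_mem_unitDirs φ.1.target A).2 a
  refine ⟨v, funext fun C => ?_⟩
  rw [← ha C, ← hv]
  rfl

/-- The point under an element of a vertex set at `∅` of the `n`-fold groupoid of a manifold. -/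
noncomputable def basePoint (X : CnManifold K n) (z : (symNGpd hK t X).vertex ∅) : X.carrier :=
  anchor (t := offParam t) (z ⟨∅, Finset.empty_subset _⟩) ⟨∅, Finset.empty_subset _⟩

/-- Over the empty set an element is nothing but its base point; the condition on invertible
parameters in `foot_inj` is then vacuous. -/
theorem eq_of_anchor_eq (hK : Dense {s : K | IsUnit s}) {t : Fin n → K}
    {X : CnManifold K n} {A : Finset (Fin n)} (hA : A = ∅)
    {z z' : Glued t X A}
    (h : anchor z ⟨∅, Finset.empty_subset A⟩ = anchor z' ⟨∅, Finset.empty_subset A⟩) :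
    z = z' := by
  subst hA
  have h' : ∀ C, anchor z C = anchor z' C := fun C => by
    rwa [show C = ⟨∅, Finset.empty_subset ∅⟩ from Subtype.ext (Finset.subset_empty.1 C.2)]
  obtain ⟨φ, a, rfl⟩ := exists_glueMk z
  obtain ⟨b, rfl⟩ := exists_glueMk_eq hK z' φ fun C => by
    rw [← h' C, anchor_glueMk hK]
    exact φ.1.map_target (a.2 C)
  congr 1
  refine Subtype.ext (foot_inj (s := t) (fun i hi => absurd hi (Finset.notMem_empty i)) fun C => ?_)
  have := h' C
  rw [anchor_glueMk hK, anchor_glueMk hK] at this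
  exact φ.1.symm.injOn (a.2 C) (b.2 C) this

theorem exists_anchor_eq (hK : Dense {s : K | IsUnit s}) (t : Fin n → K)
    (X : CnManifold K n) (A : Finset (Fin n))
    (x : X.carrier) : ∃ z : Glued t X A, anchor z ⟨∅, Finset.empty_subset A⟩ = x := by
  obtain ⟨φ, hφ, hx⟩ := X.exists_chart x
  have hf := fun C : Subs A => foot_single t C (φ x)
  refine ⟨glueMk t X ⟨φ, hφ⟩ A ⟨fun S => if S.1 = ∅ then φ x else 0, fun C => ?_⟩, ?_⟩
  · rw [hf]
    exact φ.map_source hx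
  · rw [anchor_glueMk hK, hf]
    exact φ.left_inv hx

theorem basePoint_bijective (X : CnManifold K n) : Bijective (basePoint hK t X) := by
  constructor
  · intro z z' h
    funext C
    rw [show C = ⟨∅, Finset.empty_subset _⟩ from
      Subtype.ext (Finset.subset_empty.1 (C.2.trans Finset.inter_subset_left))]
    exact eq_of_anchor_eq hK (Finset.empty_sdiff _) h
  · intro x
    obtain ⟨z, hz⟩ := exists_anchor_eq hK (offParam t) X (∅ \ unitDirs t) x
    exact ⟨fun _ => z, hz⟩

theorem symHom_id (X : CnManifold K n) (h : IsCnMap X X id) :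
    symHom hK t h = Hom.id (symNGpd hK t X) :=
  hom_ext fun _ z => funext fun C => tangentMap_id hK (enoughCharts t X) h (z C)

theorem symHom_comp {X Y Z : CnManifold K n} {f : X.carrier → Y.carrier}
    {g : Y.carrier → Z.carrier} (hf : IsCnMap X Y f) (hg : IsCnMap Y Z g)
    (hgf : IsCnMap X Z (g ∘ f)) : symHom hK t hgf = (symHom hK t hg).comp (symHom hK t hf) :=
  hom_ext fun _ z => funext fun C =>
    tangentMap_comp hK (enoughCharts t Y) (enoughCharts t Z) hf hg hgf (z C)

theorem basePoint_symHom {X Y : CnManifold K n} {f : X.carrier → Y.carrier} (hf : IsCnMap X Y f)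
    (z : (symNGpd hK t X).vertex ∅) :
    basePoint hK t Y ((symHom hK t hf).map ∅ z) = f (basePoint hK t X z) :=
  anchor_tangentMap hK (enoughCharts t Y) hf _ _

/-! ### Comparison with the direct gluing of the local constructions. -/

section Gluing

variable {t}

theorem ChartTan.partialFeet (hK : Dense {s : K | IsUnit s}) {X Y : CnManifold K n}
    {f : X.carrier → Y.carrier}
    (hf : IsCnMap X Y f) {A : Finset (Fin n)} {φ : X.atlas} {ψ : Y.atlas}
    {a : extDom t φ.1.target A} {b : extDom t ψ.1.target A} (h : ChartTan t f A φ ψ a b)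
    (I : Finset (Fin n)) (C : Subs (A ∩ I)) :
    ChartTan (paramOff t I) f (A \ I) φ ψ (((splitHom t I φ.1.target).map A a) C)
      (((splitHom t I ψ.1.target).map A b) C) := by
  have hm := (mem_extDom_iff_partialFeet t I (chartDom f φ ψ) a.1).1 h.1 C
  obtain ⟨y, hy⟩ := (hf.cnOn φ ψ).exists_hasTan (isOpen_chartDom hf.1 φ ψ) hm
  obtain rfl := h.2.partialFeet_eq hK C hy
  exact ⟨hm, hy⟩

/-- Splitting commutes with transition maps, which gives one direction. Conversely, equality of all
partial feet places every foot of `a` in the domain of the transition map; its image has the same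
class as `b`, and chart morphisms are injective. -/
theorem chartHom_eq_iff (X : CnManifold K n) {A : Finset (Fin n)} {φ ψ : X.atlas}
    {a : extDom t φ.1.target A} {b : extDom t ψ.1.target A} :
    (chartHom hK t X φ subset_rfl).map A a = (chartHom hK t X ψ subset_rfl).map A b ↔
      ChartTan t id A φ ψ a b := by
  have key : ∀ {b' : extDom t ψ.1.target A}, ChartTan t id A φ ψ a b' →
      (chartHom hK t X φ subset_rfl).map A a = (chartHom hK t X ψ subset_rfl).map A b' :=
    fun h => funext fun C => (glueMk_eq_iff hK).2 (h.partialFeet hK (isCnMap_id X) _ C)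
  refine ⟨fun h => ?_, key⟩
  have hm : a.1 ∈ extDom t (chartDom id φ ψ) A :=
    (mem_extDom_iff_partialFeet t (unitDirs t) _ a.1).2 fun C =>
      ((glueMk_eq_iff hK).1 (congrFun h C)).1
  obtain ⟨b', hb'⟩ := exists_chartTan hK (isCnMap_id X) φ ψ a fun C => (hm C).2
  rwa [chartHom_injective hK t X ψ subset_rfl A (h.symm.trans (key hb'))]

/-- The comparison map from the directly glued set is always injective. The hypothesis is needed for
surjectivity: an element of a pair groupoid may consist of points that no chart has in common. -/
theorem isGlued_symChart (X : CnManifold K n)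
    (hX : ∀ (A : Finset (Fin n)) (z : (symNGpd hK t X).vertex A), ∃ φ ∈ X.atlas, ∀ C D,
      anchor (t := offParam t) (z C) D ∈ φ.source) :
    IsGlued t X (symNGpd hK t X) (symChart hK t X) := by
  intro A
  let e : Glued t X A → (symNGpd hK t X).vertex A :=
    Quot.lift (fun a => (chartHom hK t X a.1 subset_rfl).map A a.2) fun a b hab =>
      (chartHom_eq_iff hK X).2 ((glueRel_iff hK a b).1 hab)
  have he : Bijective e := by
    constructor
    · intro z z' h
      obtain ⟨φ, a, rfl⟩ := exists_glueMk z
      obtain ⟨ψ, b, rfl⟩ := exists_glueMk z'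
      exact (glueMk_eq_iff hK).2 ((chartHom_eq_iff hK X).1 h)
    · intro z
      obtain ⟨φ, hφ, hz⟩ := hX A z
      obtain ⟨v, hv⟩ := exists_chartHom_eq hK t X ⟨φ, hφ⟩ z fun C =>
        exists_glueMk_eq hK _ _ (hz C)
      exact ⟨glueMk t X ⟨φ, hφ⟩ A v, hv⟩
  refine ⟨Equiv.ofBijective e he, fun φ v => ?_⟩
  rw [symChart_eq]
  rfl

theorem isGlued_of_common_chart (X : CnManifold K n)
    (hX : ∀ s : Set X.carrier, s.Finite → s.Nonempty → ∃ φ ∈ X.atlas, s ⊆ φ.source) :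
    IsGlued t X (symNGpd hK t X) (symChart hK t X) := by
  refine isGlued_symChart hK X fun A z => ?_
  obtain ⟨φ, hφ, hs⟩ := hX (⋃ C, range (anchor (t := offParam t) (z C)))
    (finite_iUnion fun i => finite_range _)
    ⟨_, mem_iUnion.2 ⟨⟨∅, Finset.empty_subset _⟩, ⟨⟨∅, Finset.empty_subset _⟩, rfl⟩⟩⟩
  exact ⟨φ, hφ, fun C D => hs (mem_iUnion.2 ⟨C, D, rfl⟩)⟩

theorem isGlued_zero (X : CnManifold K n) :
    IsGlued (0 : Fin n → K) X (symNGpd hK 0 X) (symChart hK 0 X) := by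
  rcases X.exists_common_chart with hF | hc
  -- In a nontrivial ring 0 is not a unit, so there are no pair directions, and each element lies
  -- over a single point.
  · have := hF.nontrivial
    have hI : unitDirs (0 : Fin n → K) = ∅ := by
      ext i; simp [mem_unitDirs]
    have hp : offParam (0 : Fin n → K) = 0 := by
      funext i; simp [paramOff, hI]
    refine isGlued_symChart hK X fun A z => ?_
    have hs : (⋃ C, range (anchor (t := offParam (0 : Fin n → K)) (z C))).Subsingleton := by
      intro x hx y hy
      obtain ⟨C, D, rfl⟩ := mem_iUnion.1 hx
      obtain ⟨C', D', rfl⟩ := mem_iUnion.1 hy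
      have : C = C' := Subtype.ext (by
        have h1 := C.2
        have h2 := C'.2
        simp only [hI, Finset.inter_empty, Finset.subset_empty] at h1 h2
        rw [h1, h2])
      rw [this]
      exact (anchor_zero hK hp (z C') D).trans (anchor_zero hK hp (z C') D').symm
    have hne : (⋃ C, range (anchor (t := offParam (0 : Fin n → K)) (z C))).Nonempty := ⟨_, mem_iUnion.2
      ⟨⟨∅, Finset.empty_subset _⟩, ⟨⟨∅, Finset.empty_subset _⟩, rfl⟩⟩⟩
    obtain ⟨φ, hφ, h⟩ := exists_chart_of_subsingleton X hne hs
    exact ⟨φ, hφ, fun C D => h (mem_iUnion.2 ⟨C, D, rfl⟩)⟩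
  · exact isGlued_of_common_chart hK X hc

end Gluing

/-! ### Invertible parameters: the n-fold pair groupoid. -/

section Pair

variable {t} (ht : ∀ i, IsUnit (t i))

theorem sdiff_unitDirs (ht : ∀ i, IsUnit (t i)) (A : Finset (Fin n)) : A \ unitDirs t = ∅ :=
  Finset.sdiff_eq_empty_iff_subset.2 fun i _ => mem_unitDirs.2 (ht i)

/-- The morphism to the `n`-fold pair groupoid, for invertible parameters. -/
noncomputable def pairHom (X : CnManifold K n) : Hom (symNGpd hK t X) (pairNGpd X.carrier) where
  map A z C := anchor (t := offParam t) (z ⟨C.1 ∩ unitDirs t, Finset.inter_subset_inter_right C.2⟩)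
    ⟨∅, Finset.empty_subset _⟩
  isFunctor {k B A} h := by
    have hk : k ∈ unitDirs t := mem_unitDirs.2 (ht k)
    refine (mixed_edge_mem (offNGpd hK t X) h hk).symm ▸ ?_
    refine isFunctor_from_pairEdge (offNGpd hK t X)
      (fun Z z => anchor (t := offParam t) z ⟨∅, Finset.empty_subset Z⟩) h _ _ (fun C => ?_)
      fun C => ?_
    · rfl
    · exact Subtype.ext (Finset.insert_inter_of_mem hk)

/-- No direction remains outside I, so an element is a family of elements over ∅, that is, a family
of points. -/
theorem pairHom_bijective (X : CnManifold K n) : (pairHom hK ht X).IsIso := by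
  have hu : ∀ S : Finset (Fin n), S ∩ unitDirs t = S := fun S =>
    Finset.inter_eq_left.2 fun i _ => mem_unitDirs.2 (ht i)
  intro A
  constructor
  · intro z z' h
    funext C
    have := congrFun h ⟨C.1, C.2.trans Finset.inter_subset_left⟩
    simp only [pairHom, hu] at this
    exact eq_of_anchor_eq hK (sdiff_unitDirs ht A) this
  · intro m
    choose z hz using exists_anchor_eq hK (offParam t) X (A \ unitDirs t)
    refine ⟨fun C => z (m ⟨C.1, C.2.trans Finset.inter_subset_left⟩), funext fun C => ?_⟩
    refine (hz _).trans (congrArg m (Subtype.ext (hu C.1)))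

theorem pairHom_base (X : CnManifold K n) (z : (symNGpd hK t X).vertex ∅) :
    (pairHom hK ht X).map ∅ z = fun _ => basePoint hK t X z := by
  funext C
  have : (⟨C.1 ∩ unitDirs t, Finset.inter_subset_inter_right C.2⟩ : Subs (∅ ∩ unitDirs t))
      = ⟨∅, Finset.empty_subset _⟩ :=
    Subtype.ext (Finset.subset_empty.1 (Finset.inter_subset_left.trans C.2))
  simp only [pairHom, this]
  rfl

end Pair

/-! ### Open subsets of topological modules. -/

section Open

variable {V W : Type u} [AddCommGroup V] [Module K V] [TopologicalSpace V]
  [IsTopologicalAddGroup V] [ContinuousSMul K V] [T2Space V]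
  [AddCommGroup W] [Module K W] [TopologicalSpace W]
  [IsTopologicalAddGroup W] [ContinuousSMul K W] [T2Space W]

theorem openHom_map (U : Opens V) (hU : Nonempty U) {A : Finset (Fin n)}
    (v : extDom t (U : Set V) A) (C : Subs (A ∩ unitDirs t)) :
    (openHom hK t U).map A v C = glueMk (offParam t) (openManifold n U) (inclChart U hU)
      (A \ unitDirs t) ⟨partialFeet t (unitDirs t) v.1 C, fun D =>
        (inclChart_target U hU).symm.subset
          ((mem_extDom_iff_partialFeet t (unitDirs t) _ v.1).1 v.2 C D)⟩ := by
  rw [openHom_eq hK t U hU]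
  rfl

/-- The single chart of a non-empty `U` contains every point, so each element is represented in it.
-/
theorem openHom_bijective (U : Opens V) : (openHom hK t U).IsIso := by
  intro A
  constructor
  · intro v w h
    have hU := nonempty_of_extDom v
    rw [openHom_eq hK t U hU] at h
    exact chartHom_injective hK t _ _ _ A h
  · intro z
    have hU : Nonempty U := ⟨anchor (t := offParam t) (z ⟨∅, Finset.empty_subset _⟩)
      ⟨∅, Finset.empty_subset _⟩⟩
    obtain ⟨v, hv⟩ := exists_chartHom_eq hK t (openManifold n U) (inclChart U hU) z fun C =>
      exists_glueMk_eq hK _ _ fun D => (inclChart_source U hU).symm.subset (mem_univ _)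
    refine ⟨⟨v.1, fun C => (inclChart_target U hU).subset (v.2 C)⟩, ?_⟩
    rw [openHom_eq hK t U hU]
    exact hv

theorem basePoint_openHom (U : Opens V) (v : extDom t (U : Set V) ∅) :
    (basePoint hK t (openManifold n U) ((openHom hK t U).map ∅ v)).1 = v.1 ⟨∅, subset_rfl⟩ := by
  have hU := nonempty_of_extDom v
  have hm : v.1 ⟨∅, subset_rfl⟩ ∈ U := (extDom_empty t U v.1).1 v.2
  unfold basePoint
  rw [openHom_map hK t U hU, anchor_glueMk hK]
  have e : foot (offParam t) (A := ∅ \ unitDirs t) ⟨∅, Finset.empty_subset _⟩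
      (partialFeet t (unitDirs t) v.1 ⟨∅, Finset.empty_subset _⟩) = v.1 ⟨∅, subset_rfl⟩ := by
    rw [foot_partialFeet, foot_of_empty]
  exact (congrArg (fun x => ((inclChart (K := K) (n := n) U hU).1.symm x).1) e).trans
    (congrArg Subtype.val (inclChart_symm U hU hm))

open Classical in
theorem symHom_openHom (U : Opens V) (U' : Opens W) (f : U → U')
    (hf : IsCnMap (openManifold (K := K) n U) (openManifold n U') f) :
    ∃ Tf : ∀ A : Finset (Fin n), (Subs A → V) → (Subs A → W),
      IsIteratedTangent t (U : Set V) (fun x => (f x : W)) Tf ∧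
      ∀ (A : Finset (Fin n)) (v : extDom t (U : Set V) A),
        ∃ w : extDom t (U' : Set W) A, w.1 = Tf A v.1 ∧
          (symHom hK t hf).map A ((openHom hK t U).map A v) = (openHom hK t U').map A w := by
  -- The calculus concerns maps on the whole module, so `f` is extended by zero; only its values on
  -- the open set `U` matter.
  let F : V → W := fun v => if h : v ∈ U then f ⟨v, h⟩ else 0
  have hF : ∀ x : U, F x = f x := fun x => dif_pos x.2
  have hloc : ∀ (hU : Nonempty U) (hU' : Nonempty U'), EqOn (α := V) (fun v =>
      (inclChart (K := K) (n := n) U' hU').1 (f ((inclChart (K := K) (n := n) U hU).1.symm v)))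
      F (U : Set V) := by
    intro hU hU' v hv
    have := inclChart_symm (K := K) (n := n) U hU hv
    simp only [this]
    exact (hF ⟨v, hv⟩).symm
  have hdom : ∀ (hU : Nonempty U) (hU' : Nonempty U'),
      chartDom (X := openManifold (K := K) n U) (Y := openManifold n U') f (inclChart U hU)
        (inclChart U' hU') = (U : Set V) := by
    intro hU hU'
    unfold chartDom
    rw [inclChart_source U' hU']
    exact (inter_univ _).trans (inclChart_target U hU)
  have hc : CnOn K n F U := by
    by_cases hU : Nonempty U
    · have hU' : Nonempty U' := hU.map f
      have := hf.cnOn (inclChart U hU) (inclChart U' hU')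
      rw [hdom hU hU'] at this
      exact this.congr (hloc hU hU').symm
    · exact (cnOn_linear n (0 : V →L[K] W) _).congr fun v hv => absurd ⟨⟨v, hv⟩⟩ hU
  obtain ⟨Tf, hTf, hT⟩ := exists_isIteratedTangent hK hc U.isOpen t
  have hTf' : IsIteratedTangent t (U : Set V) (fun x => (f x : W)) Tf := by
    have e : (fun x : (U : Set V) => (f x : W)) = fun x : (U : Set V) => F x :=
      funext fun x => (hF x).symm
    rwa [e]
  refine ⟨Tf, hTf', fun A v => ?_⟩
  have hU := nonempty_of_extDom v
  have hU' : Nonempty U' := hU.map f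
  have hw := hT A v.1 v.2
  refine ⟨⟨Tf A v.1, fun C => ?_⟩, rfl, funext fun C => ?_⟩
  · rw [hw.foot_eq hK C (hc.continuousOn.continuousAt (U.isOpen.mem_nhds (v.2 C))),
      hF ⟨_, v.2 C⟩]
    exact (f _).2
  · rw [openHom_map hK t U' hU']
    change tangentMap hK (enoughCharts t (openManifold n U')) hf _ ((openHom hK t U).map A v C) = _
    rw [openHom_map hK t U hU]
    refine (tangentMap_glueMk hK (enoughCharts t (openManifold n U')) hf).2 ?_
    have hm := (mem_extDom_iff_partialFeet t (unitDirs t) (U : Set V) v.1).1 v.2 C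
    obtain ⟨y, hy⟩ := hc.exists_hasTan U.isOpen hm
    -- The tangent image of the partial feet of `v` is given by the partial feet of `Tf A v`.
    obtain rfl := hw.partialFeet_eq hK C hy
    refine ⟨?_, hy.congr U.isOpen hm (hloc hU hU')⟩
    rw [hdom hU hU']
    exact hm

end Open

end Main

end SymCubic

theorem theorem5p7 {K : Type u} [CommRing K] [TopologicalSpace K] [IsTopologicalRing K]
    (hK : Dense {s : K | IsUnit s}) (n : ℕ) (t : Fin n → K) :
    ∃ (G : CnManifold K n → NGpd.{u} n)
      (base : ∀ X : CnManifold K n, (G X).vertex ∅ ≃ X.carrier)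
      (F : ∀ (X Y : CnManifold K n) (f : X.carrier → Y.carrier), IsCnMap X Y f →
        SymCubic.Hom (G X) (G Y))
      (E : ∀ (V : Type u) [AddCommGroup V] [Module K V] [TopologicalSpace V]
        [IsTopologicalAddGroup V] [ContinuousSMul K V] [T2Space V] (U : Opens V),
        SymCubic.Hom (localNGpd t (U : Set V)) (G (openManifold n U)))
      (χ : ∀ (X : CnManifold K n) (φ : X.atlas),
        SymCubic.Hom (localNGpd t φ.1.target) (G X)),
      -- `F f` lies over `f`, and `F` is functorial
      (∀ (X Y : CnManifold K n) (f : X.carrier → Y.carrier) (hf : IsCnMap X Y f)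
        (z : (G X).vertex ∅), base Y ((F X Y f hf).map ∅ z) = f (base X z)) ∧
      (∀ (X : CnManifold K n) (h : IsCnMap X X id), F X X id h = SymCubic.Hom.id (G X)) ∧
      (∀ (X Y Z : CnManifold K n) (f : X.carrier → Y.carrier) (g : Y.carrier → Z.carrier)
        (hf : IsCnMap X Y f) (hg : IsCnMap Y Z g) (hgf : IsCnMap X Z (g ∘ f)),
        F X Z (g ∘ f) hgf = (F Y Z g hg).comp (F X Y f hf)) ∧
      -- on open sets, `G` and `F` are the local construction and the iterated tangent maps
      (∀ (V : Type u) [AddCommGroup V] [Module K V] [TopologicalSpace V]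
        [IsTopologicalAddGroup V] [ContinuousSMul K V] [T2Space V] (U : Opens V),
        (E V U).IsIso ∧
        ∀ v : extDom t (U : Set V) ∅,
          (base (openManifold n U) ((E V U).map ∅ v)).1 = v.1 ⟨∅, subset_rfl⟩) ∧
      (∀ (V W : Type u) [AddCommGroup V] [Module K V] [TopologicalSpace V]
        [IsTopologicalAddGroup V] [ContinuousSMul K V] [T2Space V]
        [AddCommGroup W] [Module K W] [TopologicalSpace W]
        [IsTopologicalAddGroup W] [ContinuousSMul K W] [T2Space W]
        (U : Opens V) (U' : Opens W) (f : U → U')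
        (hf : IsCnMap (openManifold (K := K) n U) (openManifold n U') f),
        ∃ Tf : ∀ A : Finset (Fin n), (Subs A → V) → (Subs A → W),
          IsIteratedTangent t (U : Set V) (fun x => (f x : W)) Tf ∧
          ∀ (A : Finset (Fin n)) (v : extDom t (U : Set V) A),
            ∃ w : extDom t (U' : Set W) A, w.1 = Tf A v.1 ∧
              (F (openManifold n U) (openManifold n U') f hf).map A ((E V U).map A v)
                = (E W U').map A w) ∧
      -- charts embed the local construction, and `G` is glued from charts if there are enough
      (∀ (X : CnManifold K n) (φ : X.atlas),
        χ X φ = (F _ X (chartInv X φ.1) (isCnMap_chartInv X φ.1 φ.2)).comp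
          (E X.model ⟨φ.1.target, φ.1.open_target⟩) ∧
        ∀ A, Function.Injective ((χ X φ).map A)) ∧
      (∀ X : CnManifold K n,
        (∀ s : Set X.carrier, s.Finite → s.Nonempty → ∃ φ ∈ X.atlas, s ⊆ φ.source) →
        IsGlued t X (G X) (χ X)) ∧
      -- the case `t = (0, …, 0)`
      (∀ (h0 : t = 0) (X : CnManifold K n),
        IsNFoldTangentBundle X (G X) (fun φ => h0 ▸ χ X φ)) ∧
      -- the case of invertible `t_1, …, t_n`
      ((∀ i, IsUnit (t i)) →
        ∃ P : ∀ X : CnManifold K n, SymCubic.Hom (G X) (pairNGpd X.carrier),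
          (∀ X : CnManifold K n, (P X).IsIso ∧
            ∀ z : (G X).vertex ∅, (P X).map ∅ z = fun _ => base X z) ∧
          ∀ (X Y : CnManifold K n) (f : X.carrier → Y.carrier) (hf : IsCnMap X Y f)
            (A : Finset (Fin n)) (z : (G X).vertex A),
            (P Y).map A ((F X Y f hf).map A z) = f ∘ (P X).map A z) := by
  refine ⟨symNGpd hK t, fun X => Equiv.ofBijective _ (basePoint_bijective hK t X),
    fun X Y f hf => symHom hK t hf, fun V => openHom hK t, symChart hK t,
    fun X Y f hf => basePoint_symHom hK t hf, symHom_id hK t,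
    fun X Y Z f g hf hg hgf => symHom_comp hK t hf hg hgf,
    fun V _ _ _ _ _ _ U => ⟨openHom_bijective hK t U, basePoint_openHom hK t U⟩,
    fun V W _ _ _ _ _ _ _ _ _ _ _ _ U U' f hf => symHom_openHom hK t U U' f hf,
    fun X φ => ⟨rfl, fun A => ?_⟩, isGlued_of_common_chart hK, ?_, fun ht => ?_⟩
  · rw [symChart_eq]
    exact chartHom_injective hK t X φ subset_rfl A
  · intro h0 X
    -- After the substitution the transport of the chart morphisms along t = 0 is trivial.
    subst h0
    exact isGlued_zero hK X
  · exact ⟨pairHom hK ht, fun X => ⟨pairHom_bijective hK ht X, pairHom_base hK ht X⟩,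
      fun X Y f hf A z => funext fun C =>
        anchor_tangentMap hK (enoughCharts t Y) hf _ _⟩
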